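/- All function spaces consist of (real or complex) vector fields on $\mathbb R^3$. Fix a nonnegative radial $\chi\in C_0^\infty(B(0,1))$ with $\chi(\xi)=1$ for $|\xi|\le \tfrac12$, put $\varphi(\xi)=\chi(\xi/2)-\chi(\xi)$, $\Delta_{-1}u=\mathcal F^{-1}(\chi\,\mathcal F u)$ and $\Delta_q u=\mathcal F^{-1}(\varphi(2^{-q}\cdot)\mathcal F u)$ for $q\ge 0$. The Besov space $B^s_{p,r}$ consists of the tempered distributions $u$ for which $$\|u\|_{B^s_{p,r}}=\|\Delta_{-1}u\|_{L^p}+\Big(\sum_{q\ge0}\big(2^{qs}\|\Delta_qu\|_{L^p}\big)^r\Big)^{1/r}<\infty .$$ Let $\mathbb P$ be the Leray projector onto divergence-free fields. For $u,v\in L^3$ let $B(u,v)$ be the tempered distribution $B(u,v)=\mathbb P\,\mathrm{div}(u\otimes v)$, that is, $B(u,v)_i=\Lambda\big(R_j(u_jv_i)+R_iR_kR_l(u_kv_l)\big)$ with summation over repeated indices, $\Lambda=(-\Delta)^{1/2}$ and $R_k=\partial_k\Lambda^{-1}$; thus, for Schwartz fields $w$, $\langle B(u,v),w\rangle=-\int_{\mathbb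 R^3} (u\otimes v):\nabla\mathbb P w\,dx$. Here $\langle\cdot,\cdot\rangle$ is the bilinear duality (no conjugation). For $\nabla\cdot u=0$ this is the advective term $\mathbb P(u\cdot\nabla v)$: if $u,v$ are smooth, $u,v,\nabla u,\nabla v\in L^3$ and $\nabla\cdot u=0$, then $\langle B(u,v),w\rangle=\int (u\cdot\nabla v)\cdot\mathbb P w\,dx$ for all Schwartz fields $w$. **Proposition.** 1. Every $u\in B^{1/3}_{3,2}$ is an $L^3$ function, so that $B$ is defined on $B^{1/3}_{3,2}\times B^{1/3}_{3,2}$. There exist bilinear maps $C:B^{1/3}_{3,2}\times B^{1/3}_{3,2}\to B^{-1/3}_{3/2,2}$ and $I:B^{1/3}_{3,2}\times B^{1/3}_{3,2}\to B^{-2/3}_{9/5,2}$ (taking real fields to real fields) and a constant $K$ such that for all $u,v\in B^{1/3}_{3,2}$ (in particular for all those with $\nabla\cdot u=0$) $B(u,v)=C(u,v)+I(u,v)$, $$\|C(u,v)\|_{B^{-1/3}_{3/2,2}}\le K\|u\|_{B^{1/3}_{3,2}}\|v\|_{B^{1/3}_{3,2}},\qquad \|I(u,v)\|_{B^{-2/3}_{9/5,2}}\le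 K\|u\|_{B^{1/3}_{3,2}}\|v\|_{B^{1/3}_{3,2}} .$$ 2. The space $X=B^{1/2}_{18/7,2}$ consists of $L^3$ functions and contains the Schwartz fields, and there is a trilinear form $T$ on $X^3$, real at real fields, and a constant $K$ with $$|T(u,v,w)|\le K\|u\|_X\|v\|_X\|w\|_X\quad (u,v,w\in X)$$ which extends $\langle B(u,v),w\rangle$: $T(u,v,w)=\langle B(u,v),w\rangle$ for all $u,v\in X$ and all Schwartz fields $w$, and $T(u,v,w)=\int B(u,v)\cdot w\,dx$ for all $u,v,w\in X$ for which the distribution $B(u,v)$ is a function in $L^{3/2}$. It is the unique continuous extension: any continuous function on $X^3$ which equals $\langle B(u,v),w\rangle$ for all smooth $u,v\in X$ and all Schwartz fields $w$ is $T$. The same uniqueness holds among functions on the subset of $X^3$ in which $u$ is divergence-free, or all fields are real, or both. 3. $H^{5/6}\subset B^{1/2}_{18/7,2}$ with continuous inclusion, and all of part 2 holds with $X=H^{5/6}$ and its norm; the extension there is the restriction of the one in part 2. -/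

import Mathlib

open MeasureTheory Filter Topology FourierTransform
open scoped SchwartzMap ENNReal NNReal ContDiff LineDeriv

noncomputable section

namespace Advective

/-- Physical (and frequency) space. -/
abbrev R3 : Type := EuclideanSpace ℝ (Fin 3)

/-- Values of vector fields; real fields are the special case singled out by `IsRealField`. -/
abbrev C3 : Type := EuclideanSpace ℂ (Fin 3)

/-- Tempered vector-valued distributions on `ℝ³`. -/
abbrev VField : Type := 𝓢'(R3, C3)

/-- The `j`-th vector of the standard basis of `ℝ³`. -/
def basisVec (j : Fin 3) : R3 := EuclideanSpace.single j (1 : ℝ)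

/-! ### Distributions given by functions, and the Lebesgue norm of a distribution -/

/-- The distribution `u` is (integration against) the function `f`, and `f ∈ L^p`. -/
def IsLpFun (p : ℝ≥0∞) (u : VField) (f : R3 → C3) : Prop :=
  MemLp f p volume ∧ ∀ φ : 𝓢(R3, ℂ), u φ = ∫ x, φ x • f x

/-- `‖u‖_{L^p}` for a tempered distribution: the norm of the function representing `u`, and `∞`
if `u` is not an `L^p` function. -/
def lpENorm (p : ℝ≥0∞) (u : VField) : ℝ≥0∞ :=
  ⨅ f : {f : R3 → C3 // IsLpFun p u f}, eLpNorm f.1 p volume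

/-! ### Littlewood-Paley decomposition and Besov spaces -/

/-- The cut-off functions from which Littlewood-Paley decompositions are built: nonnegative,
radial, smooth, compactly supported in the open unit ball, equal to one on `|ξ| ≤ 1/2`. -/
structure IsLPCutoff (χ : R3 → ℝ) : Prop where
  smooth : ContDiff ℝ ∞ χ
  nonneg : ∀ ξ, 0 ≤ χ ξ
  radial : ∀ ξ η, ‖ξ‖ = ‖η‖ → χ ξ = χ η
  support : HasCompactSupport χ ∧ tsupport χ ⊆ Metric.ball 0 1
  eq_one : ∀ ξ, ‖ξ‖ ≤ 1 / 2 → χ ξ = 1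

/-- `φ(ξ) = χ(ξ/2) - χ(ξ)`. -/
def annulus (χ : R3 → ℝ) (ξ : R3) : ℝ := χ ((2 : ℝ)⁻¹ • ξ) - χ ξ

/-- The Fourier multiplier `u ↦ 𝓕⁻¹(m(ξ) 𝓕u)`, where `ξ` is the angular frequency: Mathlib's
Fourier transform has the kernel `exp(-2πi x·η)`, so that `ξ = 2πη`. -/
def multiplier (m : R3 → ℝ) (u : VField) : VField :=
  TemperedDistribution.fourierMultiplierCLM C3
    (fun η : R3 => ((m ((2 * Real.pi) • η) : ℝ) : ℂ)) u

/-- The low-frequency block `Δ_{-1}`. -/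
def lowBlock (χ : R3 → ℝ) (u : VField) : VField := multiplier χ u

/-- The dyadic blocks `Δ_q`, `q ≥ 0`. -/
def block (χ : R3 → ℝ) (q : ℕ) (u : VField) : VField :=
  multiplier (fun ξ => annulus χ (((2 : ℝ) ^ q)⁻¹ • ξ)) u

/-- The inhomogeneous Besov norm
`‖Δ_{-1}u‖_{L^p} + (∑_{q ≥ 0} (2^{qs} ‖Δ_q u‖_{L^p})^r)^{1/r}`. -/
def besovENorm (χ : R3 → ℝ) (s : ℝ) (p : ℝ≥0∞) (r : ℝ) (u : VField) : ℝ≥0∞ :=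
  lpENorm p (lowBlock χ u) +
    (∑' q : ℕ, (ENNReal.ofReal ((2 : ℝ) ^ ((q : ℝ) * s)) * lpENorm p (block χ q u)) ^ r) ^ (1 / r)

/-- The norm of the Sobolev space `H^s`. -/
def sobolevENorm (s : ℝ) (u : VField) : ℝ≥0∞ :=
  lpENorm 2 (TemperedDistribution.besselPotential R3 C3 s u)

/-! ### The spaces as vector spaces -/

theorem IsLpFun.add {p : ℝ≥0∞} (hp : 1 ≤ p) {u v : VField} {f g : R3 → C3}
    (hu : IsLpFun p u f) (hv : IsLpFun p v g) : IsLpFun p (u + v) (f + g) := by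
  refine ⟨hu.1.add hv.1, fun φ => ?_⟩
  have hpq : ENNReal.HolderConjugate p (1 - p⁻¹)⁻¹ := ENNReal.HolderConjugate.inv_one_sub_inv' hp
  have key : ∀ {h : R3 → C3}, MemLp h p volume → Integrable (fun x => φ x • h x) volume := by
    intro h hh
    rw [← memLp_one_iff_integrable]
    exact hh.smul (φ.memLp (1 - p⁻¹)⁻¹ volume)
  have : (u + v) φ = u φ + v φ := rfl
  rw [this, hu.2, hv.2, ← integral_add (key hu.1) (key hv.1)]
  simp [smul_add]

theorem IsLpFun.smul {p : ℝ≥0∞} (c : ℂ) {u : VField} {f : R3 → C3}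
    (hu : IsLpFun p u f) : IsLpFun p (c • u) (c • f) := by
  refine ⟨hu.1.const_smul c, fun φ => ?_⟩
  have : (c • u) φ = c • u φ := rfl
  rw [this, hu.2, ← integral_smul]
  refine integral_congr_ae (Eventually.of_forall fun x => ?_)
  simp [smul_comm c]

theorem lpENorm_add_le {p : ℝ≥0∞} (hp : 1 ≤ p) (u v : VField) :
    lpENorm p (u + v) ≤ lpENorm p u + lpENorm p v := by
  unfold lpENorm
  simp_rw [ENNReal.iInf_add, ENNReal.add_iInf]
  refine le_iInf fun f => le_iInf fun g => ?_
  have h := eLpNorm_add_le (μ := volume) f.2.1.1 g.2.1.1 hp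
  exact le_trans (iInf_le (fun h : {h : R3 → C3 // IsLpFun p (u + v) h} => eLpNorm h.1 p volume)
    ⟨f.1 + g.1, f.2.add hp g.2⟩) h

theorem lpENorm_zero (p : ℝ≥0∞) : lpENorm p 0 = 0 := by
  have h : IsLpFun p 0 (0 : R3 → C3) := ⟨MemLp.zero, fun φ => by
    have : (0 : VField) φ = 0 := rfl
    simp [this]⟩
  refine le_antisymm ((iInf_le _ ⟨0, h⟩).trans ?_) (zero_le)
  simp

theorem lpENorm_smul_le (p : ℝ≥0∞) (c : ℂ) (u : VField) :
    lpENorm p (c • u) ≤ ‖c‖ₑ * lpENorm p u := by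
  rcases eq_or_ne c 0 with rfl | hc
  · have h : (0 : ℂ) • u = 0 := zero_smul ℂ u
    rw [h, lpENorm_zero]
    exact zero_le
  · unfold lpENorm
    rw [ENNReal.mul_iInf_of_ne (by simpa using hc) (by simp)]
    refine le_iInf fun f => (iInf_le _ ⟨c • f.1, f.2.smul c⟩).trans ?_
    exact eLpNorm_const_smul_le

theorem multiplier_add (m : R3 → ℝ) (u v : VField) :
    multiplier m (u + v) = multiplier m u + multiplier m v := map_add _ _ _

theorem multiplier_smul (m : R3 → ℝ) (c : ℂ) (u : VField) :
    multiplier m (c • u) = c • multiplier m u := map_smul _ _ _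

theorem multiplier_zero (m : R3 → ℝ) : multiplier m 0 = 0 := map_zero _

theorem besovENorm_lt_top_iff {χ : R3 → ℝ} {s : ℝ} {p : ℝ≥0∞} {r : ℝ} (hr : 1 ≤ r) (u : VField) :
    besovENorm χ s p r u < ⊤ ↔ lpENorm p (lowBlock χ u) < ⊤ ∧
      ∑' q : ℕ, (ENNReal.ofReal ((2 : ℝ) ^ ((q : ℝ) * s)) * lpENorm p (block χ q u)) ^ r < ⊤ := by
  have hr' : 0 < 1 / r := by positivity
  rw [besovENorm, ENNReal.add_lt_top, ENNReal.rpow_lt_top_iff_of_pos hr']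

/-- The inhomogeneous Besov space `B^s_{p,r}` of vector fields on `ℝ³`. -/
def besov (χ : R3 → ℝ) (s : ℝ) (p : ℝ≥0∞) (r : ℝ) [hp : Fact (1 ≤ p)] [hr : Fact (1 ≤ r)] :
    Submodule ℂ VField where
  carrier := {u | besovENorm χ s p r u < ⊤}
  zero_mem' := by
    have h1 : 0 < r := by have := hr.out; positivity
    simp [besovENorm, lowBlock, block, multiplier_zero, lpENorm_zero, h1]
  add_mem' := by
    intro u v hu hv
    simp only [Set.mem_ofPred_eq, besovENorm_lt_top_iff hr.out] at hu hv ⊢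
    refine ⟨?_, ?_⟩
    · rw [lowBlock, multiplier_add]
      exact (lpENorm_add_le hp.out _ _).trans_lt (ENNReal.add_lt_top.2 ⟨hu.1, hv.1⟩)
    · refine lt_of_le_of_lt (ENNReal.tsum_le_tsum (g := fun q : ℕ => (2 : ℝ≥0∞) ^ (r - 1) *
        ((ENNReal.ofReal ((2 : ℝ) ^ ((q : ℝ) * s)) * lpENorm p (block χ q u)) ^ r +
          (ENNReal.ofReal ((2 : ℝ) ^ ((q : ℝ) * s)) * lpENorm p (block χ q v)) ^ r))
        fun q => ?_) ?_
      · refine le_trans ?_ (ENNReal.rpow_add_le_mul_rpow_add_rpow _ _ hr.out)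
        refine ENNReal.rpow_le_rpow ?_ (zero_le_one.trans hr.out)
        rw [← mul_add, block, multiplier_add]
        gcongr
        exact lpENorm_add_le hp.out _ _
      · rw [ENNReal.tsum_mul_left, ENNReal.tsum_add]
        refine ENNReal.mul_lt_top ?_ (ENNReal.add_lt_top.2 ⟨hu.2, hv.2⟩)
        exact ENNReal.rpow_lt_top_of_nonneg (by linarith [hr.out]) (by simp)
  smul_mem' := by
    intro c u hu
    simp only [Set.mem_ofPred_eq, besovENorm_lt_top_iff hr.out] at hu ⊢
    refine ⟨?_, ?_⟩
    · rw [lowBlock, multiplier_smul]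
      exact (lpENorm_smul_le p c _).trans_lt (ENNReal.mul_lt_top enorm_lt_top hu.1)
    · have h0 : 0 ≤ r := zero_le_one.trans hr.out
      refine lt_of_le_of_lt (ENNReal.tsum_le_tsum (g := fun q : ℕ => ‖c‖ₑ ^ r *
        (ENNReal.ofReal ((2 : ℝ) ^ ((q : ℝ) * s)) * lpENorm p (block χ q u)) ^ r)
        fun q => ?_) ?_
      · rw [← ENNReal.mul_rpow_of_nonneg _ _ h0]
        refine ENNReal.rpow_le_rpow ?_ h0
        rw [block, multiplier_smul, mul_left_comm]
        gcongr
        exact lpENorm_smul_le p c _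
      · rw [ENNReal.tsum_mul_left]
        exact ENNReal.mul_lt_top (ENNReal.rpow_lt_top_of_nonneg h0 enorm_ne_top) hu.2

/-- The Sobolev space `H^s` of vector fields on `ℝ³`. -/
def sobolev (s : ℝ) : Submodule ℂ VField where
  carrier := {u | sobolevENorm s u < ⊤}
  zero_mem' := by simp [sobolevENorm, lpENorm_zero]
  add_mem' := by
    intro u v hu hv
    simp only [Set.mem_ofPred_eq, sobolevENorm, map_add] at hu hv ⊢
    exact (lpENorm_add_le (by norm_num) _ _).trans_lt (ENNReal.add_lt_top.2 ⟨hu, hv⟩)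
  smul_mem' := by
    intro c u hu
    simp only [Set.mem_ofPred_eq, sobolevENorm, map_smul] at hu ⊢
    exact (lpENorm_smul_le 2 c _).trans_lt (ENNReal.mul_lt_top enorm_lt_top hu)

instance : Fact ((1 : ℝ≥0∞) ≤ 3) := ⟨by norm_num⟩

instance : Fact ((1 : ℝ≥0∞) ≤ 3 / 2) :=
  ⟨by rw [ENNReal.le_div_iff_mul_le (by simp) (by simp)]; norm_num⟩

instance : Fact ((1 : ℝ≥0∞) ≤ 9 / 5) :=
  ⟨by rw [ENNReal.le_div_iff_mul_le (by simp) (by simp)]; norm_num⟩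

instance : Fact ((1 : ℝ≥0∞) ≤ 18 / 7) :=
  ⟨by rw [ENNReal.le_div_iff_mul_le (by simp) (by simp)]; norm_num⟩

instance : Fact ((1 : ℝ) ≤ 2) := ⟨by norm_num⟩

/-! ### The Leray projector and the advective term -/

/-- The vector `ξ ∈ ℝ³` as an element of `ℂ³`. -/
def toC3 (ξ : R3) : C3 := WithLp.toLp 2 fun k => ((ξ k : ℝ) : ℂ)

/-- The Leray projection of a Schwartz vector field, the (smooth) function with Fourier
transform `(I - |ξ|⁻² ξ ⊗ ξ) 𝓕w(ξ)`. -/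
def leray (w : 𝓢(R3, C3)) : R3 → C3 :=
  𝓕⁻ (fun ξ : R3 =>
    (𝓕 (w : R3 → C3)) ξ -
      ((∑ j : Fin 3, ((ξ j : ℝ) : ℂ) * (𝓕 (w : R3 → C3)) ξ j) / ((‖ξ‖ ^ 2 : ℝ) : ℂ)) • toC3 ξ)

/-- The `j`-th partial derivative of a vector function. -/
def partialD (j : Fin 3) (f : R3 → C3) (x : R3) : C3 := fderiv ℝ f x (basisVec j)

/-- The tempered distribution `B(f,g) = ℙ div(f ⊗ g)`, that is
`B(f,g)_i = Λ(R_j(f_j g_i) + R_i R_k R_l(f_k g_l))` with the Riesz transforms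
`R_k = ∂_k Λ⁻¹`, for `f, g ∈ L³`, evaluated at a Schwartz field `w`. As the Leray projector is
symmetric for the bilinear duality, the value is `-∫ (f ⊗ g) : ∇ℙw`. -/
def advection (f g : R3 → C3) (w : 𝓢(R3, C3)) : ℂ :=
  -∫ x, ∑ j : Fin 3, ∑ k : Fin 3, f x j * g x k * partialD j (leray w) x k

/-- `(f·∇)g`. -/
def convect (f g : R3 → C3) (x : R3) : C3 := ∑ j : Fin 3, f x j • partialD j g x

/-- The bilinear product `a·b = ∑ a_k b_k` (no conjugation). -/
def dot (a b : C3) : ℂ := ∑ k : Fin 3, a k * b k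

/-- The duality pairing `⟨u, w⟩ = ∑_k ⟨u_k, w_k⟩` of a vector distribution with a Schwartz field. -/
def pair (u : VField) (w : 𝓢(R3, C3)) : ℂ :=
  ∑ k : Fin 3, u (w.postcompCLM (EuclideanSpace.proj (𝕜 := ℂ) k)) k

/-- Divergence-free in the sense of distributions. -/
def IsDivFree (u : VField) : Prop := ∀ φ : 𝓢(R3, ℂ), ∑ j : Fin 3, (∂_{basisVec j} u) φ j = 0

/-- Real vector fields: real values on real test functions. -/
def IsRealField (u : VField) : Prop :=
  ∀ φ : 𝓢(R3, ℂ), (∀ x, (φ x).im = 0) → ∀ k : Fin 3, (u φ k).im = 0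

/-- A Schwartz vector field as a distribution. -/
def ofSchwartz (w : 𝓢(R3, C3)) : VField := SchwartzMap.toTemperedDistributionCLM R3 C3 volume w

/-! ### Extensions of the trilinear form -/

/-- Continuity of `T` on `U × V × W` with respect to the norm `N`. -/
def ContOn3 (N : VField → ℝ≥0∞) (U V W : Set VField) (T : VField → VField → VField → ℂ) : Prop :=
  ∀ u ∈ U, ∀ v ∈ V, ∀ w ∈ W, ∀ (u' v' w' : ℕ → VField),
    (∀ n, u' n ∈ U) → (∀ n, v' n ∈ V) → (∀ n, w' n ∈ W) →
    Tendsto (fun n => N (u' n - u)) atTop (𝓝 0) → Tendsto (fun n => N (v' n - v)) atTop (𝓝 0) →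
    Tendsto (fun n => N (w' n - w)) atTop (𝓝 0) →
    Tendsto (fun n => T (u' n) (v' n) (w' n)) atTop (𝓝 (T u v w))

/-- The function `T` on `U × V × W` has the values `⟨B(u,v), w⟩` at all smooth fields `u, v ∈ L³`
and all Schwartz fields `w` that lie in `U`, `V`, `W`. -/
def AgreesOnSmooth (U V W : Set VField) (T : VField → VField → VField → ℂ) : Prop :=
  ∀ u ∈ U, ∀ v ∈ V, ∀ (f g : R3 → C3) (w : 𝓢(R3, C3)), ofSchwartz w ∈ W →
    IsLpFun 3 u f → IsLpFun 3 v g → ContDiff ℝ ∞ f → ContDiff ℝ ∞ g →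
    T u v (ofSchwartz w) = advection f g w

/-- Any two continuous functions on `U × V × W` with the values `⟨B(u,v), w⟩` at smooth fields
coincide there. -/
def ExtensionUnique (N : VField → ℝ≥0∞) (U V W : Set VField) : Prop :=
  ∀ T₁ T₂ : VField → VField → VField → ℂ,
    ContOn3 N U V W T₁ → ContOn3 N U V W T₂ →
    AgreesOnSmooth U V W T₁ → AgreesOnSmooth U V W T₂ →
    ∀ u ∈ U, ∀ v ∈ V, ∀ w ∈ W, T₁ u v w = T₂ u v w

/-- `T` is the unique continuous extension of the trilinear form `⟨B(u,v), w⟩` to the space `X`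
with the norm `N`. -/
structure IsUniqueExtension (X : Submodule ℂ VField) (N : VField → ℝ≥0∞)
    (T : X →ₗ[ℂ] X →ₗ[ℂ] X →ₗ[ℂ] ℂ) : Prop where
  /-- `T` is bounded, hence continuous. -/
  bound : ∃ K : ℝ≥0, ∀ u v w : X, ‖T u v w‖ₑ ≤ K * N u * N v * N w
  /-- All fields in the space are in `L³`, so that `B(u,v)` is defined for all `u, v` in it. -/
  mem_L3 : ∀ u : X, ∃ f, IsLpFun 3 u f
  /-- All Schwartz fields are in the space. -/
  schwartz_mem : ∀ w : 𝓢(R3, C3), ofSchwartz w ∈ X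
  /-- `T(u,v,w)` is the value of the distribution `B(u,v)` at `w`, for every Schwartz field `w`. -/
  eq_schwartz : ∀ (u v w : X) (f g : R3 → C3) (ψ : 𝓢(R3, C3)), IsLpFun 3 u f → IsLpFun 3 v g →
    (w : VField) = ofSchwartz ψ → T u v w = advection f g ψ
  /-- `T(u,v,w) = ∫ B(u,v)·w dx` whenever the distribution `B(u,v)` is a function in the dual
  `L^{3/2}` of `L³`. -/
  eq_integral : ∀ (u v w : X) (f g h b : R3 → C3), IsLpFun 3 u f → IsLpFun 3 v g →
    IsLpFun 3 w h → MemLp b (3 / 2) volume →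
    (∀ ψ : 𝓢(R3, C3), ∫ x, dot (b x) (ψ x) = advection f g ψ) →
    T u v w = ∫ x, dot (b x) (h x)
  /-- `T` is real at real fields. -/
  real : ∀ u v w : X, IsRealField u → IsRealField v → IsRealField w → (T u v w).im = 0
  /-- Uniqueness on the whole space. -/
  unique : ExtensionUnique N X X X
  /-- Uniqueness among functions of divergence-free `u`. -/
  unique_divFree : ExtensionUnique N (X ∩ {u | IsDivFree u}) X X
  /-- Uniqueness for real fields, with arbitrary and with divergence-free `u`. -/
  unique_real : ExtensionUnique N (X ∩ {u | IsRealField u}) (X ∩ {v | IsRealField v})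
    (X ∩ {w | IsRealField w})
  unique_real_divFree : ExtensionUnique N (X ∩ {u | IsDivFree u ∧ IsRealField u})
    (X ∩ {v | IsRealField v}) (X ∩ {w | IsRealField w})

end Advective

end

noncomputable section

namespace Advective

/-! ### Lebesgue norms of distributions -/

/-! The advective term is a sum, over index triples `(j,k,l)`, of the order-one Fourier multipliers
`∂_j ℙ_{kl}` applied to the products `u_j v_k e_l`. For `u, v ∈ L³` the products lie in `L^{3/2}`.
For such a symbol `σ`, the function `σ 𝓕⁻φ` is in `L¹ ∩ L²`, so its transform is in `L³` and the
multiplier can be defined by duality (`hmul`). No singular integral theory is needed: away from the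
origin a dyadic piece of the multiplier is convolution with a dilated Schwartz kernel, and the
low-frequency block is a series of pieces at frequencies `2^{-n}` with norms of order `2^{-n}`.
Hence the block `D n` of the multiplier costs a factor `2^n` in every `L^r`, `1 ≤ r < ∞`
(`exists_lpENorm_D_hmul_le`).

With `u = ∑ D_n u` and `v = ∑ D_n v`, the product splits into diagonal terms `D_n u ⊗ D_n v` and two
paraproducts, in which a block of one field meets the lower blocks of the other. Every term of index
`n` has its frequencies below `2^{n+2}`, so the block `m` of the result sees only `n ≥ m - 3`. This
one-sided localisation is enough, because the order before differentiation is some `s > 0`: the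
weights leave `2^{-(n-m)s}`, and convolution with a geometric kernel preserves `ℓ²`
(`lTwo_le_of_le_tsum_dist`, `exists_lTwo_coef_hmul_le`).

`C` is the diagonal part: its terms have size `2^{-2n/3}` in `L^{3/2}`, which gives the order `2/3 -
1`. `I` is the rest: a block of size `2^{-n/3}` in `L³` times a low-frequency sum bounded in
`L^{9/2}`, which gives the order `1/3 - 1` in `L^{9/5}`. The uniform `L^{9/2}` bound is the critical
embedding of `B^{1/3}_{3,2}` (`exists_lpENorm_S_le_lTwo`), where summability exponent two requires
an argument beyond the triangle inequality.

The space `B^{1/2}_{18/7,2}` embeds in `B^{1/3}_{3,2}`. With blocks measured in `L^{18/7}`, the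
paraproduct estimate puts all of `B(u,v)` into `B^{-1/2}_{18/11,2}` (`exists_lTwo_coef_advL_le`).
This is in duality with the space itself, and the trilinear form is the composition with the duality
pairing (`dual`). Uniqueness is density: the cut-offs `S_n u` are smooth, converge to `u`, and stay
real or divergence-free if `u` is, while Schwartz fields (real ones among real fields) are dense
(`isUniqueExtension_of`). The statement for `H^{5/6}` follows by Plancherel and Bernstein, which
embed it in the Besov space. -/

/-- The embedding of `L^p` fields into tempered distributions. -/
abbrev emb (p : ℝ≥0∞) [Fact (1 ≤ p)] : Lp C3 p (volume : Measure R3) →L[ℂ] VField :=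
  Lp.toTemperedDistributionCLM C3 volume p

theorem emb_apply {p : ℝ≥0∞} [Fact (1 ≤ p)] (f : Lp C3 p (volume : Measure R3)) (φ : 𝓢(R3, ℂ)) :
    emb p f φ = ∫ x, φ x • f x :=
  Lp.toTemperedDistribution_apply f φ

theorem isLpFun_emb {p : ℝ≥0∞} [Fact (1 ≤ p)] (f : Lp C3 p (volume : Measure R3)) :
    IsLpFun p (emb p f) f :=
  ⟨Lp.memLp f, emb_apply f⟩

theorem IsLpFun.emb_toLp {p : ℝ≥0∞} [Fact (1 ≤ p)] {u : VField} {f : R3 → C3}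
    (h : IsLpFun p u f) : emb p (h.1.toLp f) = u := by
  ext1 φ
  rw [emb_apply, h.2]
  refine integral_congr_ae ?_
  filter_upwards [h.1.coeFn_toLp] with x hx
  rw [hx]

/-- Locally integrable functions with the same integrals against Schwartz functions coincide. -/
theorem ae_eq_of_forall_integral_smul_eq {E : Type*} [NormedAddCommGroup E] [NormedSpace ℂ E]
    [CompleteSpace E] {f g : R3 → E}
    (hf : LocallyIntegrable f volume) (hg : LocallyIntegrable g volume)
    (h : ∀ φ : 𝓢(R3, ℂ), ∫ x, φ x • f x = ∫ x, φ x • g x) : f =ᵐ[volume] g := by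
  refine ae_eq_of_integral_contDiff_smul_eq hf hg fun φ hφ hc => ?_
  have hg₁ : HasCompactSupport (Complex.ofRealCLM ∘ φ) := hc.comp_left rfl
  have hg₂ : ContDiff ℝ ∞ (Complex.ofRealCLM ∘ φ) := by fun_prop
  simpa using h (hg₁.toSchwartzMap hg₂)

theorem IsLpFun.ae_eq {p q : ℝ≥0∞} (hp : 1 ≤ p) (hq : 1 ≤ q) {u : VField} {f g : R3 → C3}
    (hf : IsLpFun p u f) (hg : IsLpFun q u g) : f =ᵐ[volume] g :=
  ae_eq_of_forall_integral_smul_eq (hf.1.locallyIntegrable hp) (hg.1.locallyIntegrable hq)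
    fun φ => by rw [← hf.2, ← hg.2]

theorem lpENorm_eq_eLpNorm {p : ℝ≥0∞} (hp : 1 ≤ p) {u : VField} {f : R3 → C3}
    (hf : IsLpFun p u f) : lpENorm p u = eLpNorm f p volume := by
  refine le_antisymm (iInf_le _ (⟨f, hf⟩ : {f : R3 → C3 // IsLpFun p u f})) (le_iInf fun g => ?_)
  exact (eLpNorm_congr_ae (hf.ae_eq hp hp g.2)).le

theorem lpENorm_emb {p : ℝ≥0∞} [hp : Fact (1 ≤ p)] (f : Lp C3 p (volume : Measure R3)) :
    lpENorm p (emb p f) = ‖f‖ₑ := by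
  rw [lpENorm_eq_eLpNorm hp.out (isLpFun_emb f), Lp.enorm_def]

theorem exists_isLpFun {p : ℝ≥0∞} {u : VField} (h : lpENorm p u < ⊤) : ∃ f, IsLpFun p u f := by
  by_contra hc
  have : IsEmpty {f : R3 → C3 // IsLpFun p u f} := ⟨fun f => hc ⟨f.1, f.2⟩⟩
  simp [lpENorm] at h

theorem exists_emb_eq {p : ℝ≥0∞} [Fact (1 ≤ p)] {u : VField} (h : lpENorm p u < ⊤) :
    ∃ f, emb p f = u := by
  obtain ⟨f, hf⟩ := exists_isLpFun h
  exact ⟨_, hf.emb_toLp⟩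

theorem IsLpFun.lpENorm_lt_top {p : ℝ≥0∞} (hp : 1 ≤ p) {u : VField} {f : R3 → C3}
    (hf : IsLpFun p u f) : lpENorm p u < ⊤ := by
  rw [lpENorm_eq_eLpNorm hp hf]
  exact hf.1.2

theorem emb_injective {p : ℝ≥0∞} [Fact (1 ≤ p)] : Function.Injective (emb p) :=
  LinearMap.ker_eq_bot.1 Lp.ker_toTemperedDistributionCLM_eq_bot

theorem lpENorm_neg (p : ℝ≥0∞) (u : VField) : lpENorm p (-u) = lpENorm p u := by
  have key : ∀ v : VField, lpENorm p (-v) ≤ lpENorm p v := fun v => by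
    have h : (-1 : ℂ) • v = -v := neg_one_smul ℂ v
    simpa [h] using lpENorm_smul_le p (-1) v
  exact le_antisymm (key u) (by simpa using key (-u))

theorem lpENorm_sub_le {p : ℝ≥0∞} (hp : 1 ≤ p) (u v : VField) :
    lpENorm p (u - v) ≤ lpENorm p u + lpENorm p v := by
  rw [sub_eq_add_neg, ← lpENorm_neg p v]
  exact lpENorm_add_le hp _ _

theorem lpENorm_sum_le {p : ℝ≥0∞} (hp : 1 ≤ p) {ι : Type*} (s : Finset ι) (U : ι → VField) :
    lpENorm p (∑ i ∈ s, U i) ≤ ∑ i ∈ s, lpENorm p (U i) := by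
  classical
  induction s using Finset.induction_on with
  | empty => simp [lpENorm_zero]
  | insert i s hi ih =>
    rw [Finset.sum_insert hi, Finset.sum_insert hi]
    exact (lpENorm_add_le hp _ _).trans (by gcongr)

/-- The Lebesgue norm of a weakly convergent series of distributions. -/
theorem lpENorm_le_tsum {p : ℝ≥0∞} [hp : Fact (1 ≤ p)] {u : VField} {U : ℕ → VField}
    (h : ∀ φ : 𝓢(R3, ℂ), Tendsto (fun n => (∑ i ∈ Finset.range n, U i) φ) atTop (𝓝 (u φ))) :
    lpENorm p u ≤ ∑' i, lpENorm p (U i) := by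
  by_cases hfin : ∑' i, lpENorm p (U i) = ⊤
  · rw [hfin]; exact le_top
  have hlt : ∀ i, lpENorm p (U i) < ⊤ := fun i =>
    lt_of_le_of_lt (ENNReal.le_tsum i) (lt_top_iff_ne_top.2 hfin)
  choose f hf using fun i => exists_emb_eq (hlt i)
  have hn : ∀ i, lpENorm p (U i) = ‖f i‖ₑ := fun i => by rw [← hf i, lpENorm_emb]
  simp_rw [hn] at hfin ⊢
  -- Absolute convergence in the Banach space `L^p` gives a norm limit. It represents `u` because
  -- the embedding into distributions is continuous and weak limits are unique.
  have hs : Summable f := Summable.of_enorm hfin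
  have hu : emb p (∑' i, f i) = u := by
    ext1 φ
    have h1 : Tendsto (fun n => (emb p (∑ i ∈ Finset.range n, f i)) φ) atTop
        (𝓝 (emb p (∑' i, f i) φ)) := by
      have hc : Continuous fun v : VField => v φ := by fun_prop
      exact ((hc.comp (emb p).continuous).tendsto _).comp hs.tendsto_sum_tsum_nat
    refine tendsto_nhds_unique h1 ?_
    simp_rw [map_sum, hf]
    exact h φ
  rw [← hu, lpENorm_emb]
  exact enorm_tsum_le_tsum_enorm

theorem isLpFun_ofSchwartz (p : ℝ≥0∞) (w : 𝓢(R3, C3)) : IsLpFun p (ofSchwartz w) w :=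
  ⟨w.memLp p, fun φ => SchwartzMap.toTemperedDistributionCLM_apply_apply volume w φ⟩

theorem lpENorm_ofSchwartz {p : ℝ≥0∞} (hp : 1 ≤ p) (w : 𝓢(R3, C3)) :
    lpENorm p (ofSchwartz w) = eLpNorm w p volume :=
  lpENorm_eq_eLpNorm hp (isLpFun_ofSchwartz p w)

/-! ### Young's inequality -/

/-- Jensen's inequality for the weight `k`, obtained from Hölder with `k = k^{1/r} k^{1-1/r}`, then
Tonelli and translation invariance. With values in `[0,∞]` no integrability has to be checked. -/
theorem lintegral_rpow_convolution_le {k F : R3 → ℝ≥0∞} (hk : AEMeasurable k volume)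
    (hF : AEMeasurable F volume) {r : ℝ} (hr : 1 ≤ r) :
    ∫⁻ x, (∫⁻ y, k y * F (x - y)) ^ r ≤ (∫⁻ y, k y) ^ r * ∫⁻ x, F x ^ r := by
  have hr0 : 0 < r := by linarith
  have hFx : ∀ x, AEMeasurable (fun y => F (x - y)) volume := fun x =>
    hF.comp_quasiMeasurePreserving (quasiMeasurePreserving_sub_left volume x)
  have hJ : ∀ x, (∫⁻ y, k y * F (x - y)) ^ r ≤
      (∫⁻ y, k y) ^ (r - 1) * ∫⁻ y, k y * F (x - y) ^ r := by
    intro x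
    -- At `r = 1` there is no finite conjugate exponent, but the claim is then an equality.
    rcases hr.eq_or_lt with rfl | hr1
    · simp
    have hc : r.HolderConjugate (r / (r - 1)) := Real.HolderConjugate.conjExponent hr1
    have h := ENNReal.lintegral_mul_le_Lp_mul_Lq volume hc
      (f := fun y => k y ^ (1 / r) * F (x - y)) (g := fun y => k y ^ (1 - 1 / r))
      ((hk.pow_const _).mul (hFx x)) (hk.pow_const _)
    have e1 : ∀ y, ((fun y => k y ^ (1 / r) * F (x - y)) * fun y => k y ^ (1 - 1 / r)) y =
        k y * F (x - y) := fun y => by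
      have h0 : 0 ≤ 1 - 1 / r := by
        rw [sub_nonneg, div_le_one hr0]; exact hr
      simp only [Pi.mul_apply]
      rw [mul_right_comm, ← ENNReal.rpow_add_of_nonneg _ _ (by positivity) h0]
      simp
    have e2 : ∀ y, (k y ^ (1 / r) * F (x - y)) ^ r = k y * F (x - y) ^ r := fun y => by
      rw [ENNReal.mul_rpow_of_nonneg _ _ hr0.le, ← ENNReal.rpow_mul, one_div_mul_cancel hr0.ne',
        ENNReal.rpow_one]
    have e3 : ∀ y, (k y ^ (1 - 1 / r)) ^ (r / (r - 1)) = k y := fun y => by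
      have : (1 - 1 / r) * (r / (r - 1)) = 1 := by
        have : r - 1 ≠ 0 := by linarith
        field_simp
      rw [← ENNReal.rpow_mul, this, ENNReal.rpow_one]
    simp_rw [e1, e2, e3] at h
    calc (∫⁻ y, k y * F (x - y)) ^ r
        ≤ ((∫⁻ y, k y * F (x - y) ^ r) ^ (1 / r) * (∫⁻ y, k y) ^ (1 / (r / (r - 1)))) ^ r := by
          gcongr
      _ = _ := by
          rw [ENNReal.mul_rpow_of_nonneg _ _ hr0.le, ← ENNReal.rpow_mul, ← ENNReal.rpow_mul,
            one_div_mul_cancel hr0.ne', ENNReal.rpow_one, mul_comm]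
          congr 2
          field_simp
  have hm : AEMeasurable (Function.uncurry fun x y => k y * F (x - y) ^ r)
      ((volume : Measure R3).prod volume) := by
    refine AEMeasurable.mul (hk.comp_quasiMeasurePreserving Measure.quasiMeasurePreserving_snd) ?_
    exact ((hF.comp_quasiMeasurePreserving
      (quasiMeasurePreserving_sub_of_right_invariant volume volume)).pow_const r)
  calc ∫⁻ x, (∫⁻ y, k y * F (x - y)) ^ r
      ≤ ∫⁻ x, (∫⁻ y, k y) ^ (r - 1) * ∫⁻ y, k y * F (x - y) ^ r := lintegral_mono hJ
    _ ≤ (∫⁻ y, k y) ^ (r - 1) * ∫⁻ x, ∫⁻ y, k y * F (x - y) ^ r := by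
        exact (lintegral_const_mul'' _ hm.lintegral_prod_right').le
    _ = (∫⁻ y, k y) ^ (r - 1) * ∫⁻ y, ∫⁻ x, k y * F (x - y) ^ r := by
        rw [lintegral_lintegral_swap hm]
    _ = (∫⁻ y, k y) ^ (r - 1) * ∫⁻ y, k y * ∫⁻ x, F x ^ r := by
        congr 1
        refine lintegral_congr fun y => ?_
        rw [lintegral_const_mul'', lintegral_sub_right_eq_self (fun x => F x ^ r)]
        exact (hF.comp_quasiMeasurePreserving
          (measurePreserving_sub_right volume y).quasiMeasurePreserving).pow_const r
    _ = (∫⁻ y, k y) ^ r * ∫⁻ x, F x ^ r := by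
        rw [lintegral_mul_const'' _ hk, ← mul_assoc]
        congr 1
        nth_rewrite 2 [← ENNReal.rpow_one (∫⁻ y, k y)]
        rw [← ENNReal.rpow_add_of_nonneg _ _ (by linarith) zero_le_one]
        simp

/-- Interpolation between `L^p` and `L^∞`. -/
theorem eLpNorm_le_of_enorm_le {E : Type*} [NormedAddCommGroup E] {p q : ℝ≥0∞} (hp : 1 ≤ p) (hpq : p ≤ q) (hq : q ≠ ⊤) {f : R3 → E}
    {M : ℝ≥0∞} (hMt : M ≠ ⊤) (hM : ∀ᵐ x, ‖f x‖ₑ ≤ M) :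
    eLpNorm f q volume ≤
      M ^ (1 - p.toReal / q.toReal) * eLpNorm f p volume ^ (p.toReal / q.toReal) := by
  have hp' : p ≠ ⊤ := ne_top_of_le_ne_top hq hpq
  have hp0 : p ≠ 0 := (zero_lt_one.trans_le hp).ne'
  have hq0 : q ≠ 0 := (zero_lt_one.trans_le (hp.trans hpq)).ne'
  have hr0 : 0 < p.toReal := ENNReal.toReal_pos hp0 hp'
  have hs0 : 0 < q.toReal := ENNReal.toReal_pos hq0 hq
  have hrs : p.toReal ≤ q.toReal := ENNReal.toReal_mono hq hpq
  rw [eLpNorm_eq_lintegral_rpow_enorm_toReal hp0 hp', eLpNorm_eq_lintegral_rpow_enorm_toReal hq0 hq]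
  calc (∫⁻ x, ‖f x‖ₑ ^ q.toReal) ^ (1 / q.toReal)
      ≤ (∫⁻ x, M ^ (q.toReal - p.toReal) * ‖f x‖ₑ ^ p.toReal) ^ (1 / q.toReal) := by
        gcongr ?_ ^ _
        refine lintegral_mono_ae ?_
        filter_upwards [hM] with x hx
        calc ‖f x‖ₑ ^ q.toReal
            = ‖f x‖ₑ ^ (q.toReal - p.toReal) * ‖f x‖ₑ ^ p.toReal := by
              rw [← ENNReal.rpow_add_of_nonneg _ _ (by linarith) hr0.le]; simp
          _ ≤ _ := by
              gcongr
    _ ≤ (M ^ (q.toReal - p.toReal) * ∫⁻ x, ‖f x‖ₑ ^ p.toReal) ^ (1 / q.toReal) := by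
        gcongr
        rw [lintegral_const_mul' _ _ (ENNReal.rpow_ne_top_of_nonneg (by linarith) hMt)]
    _ = _ := by
        have e1 : (q.toReal - p.toReal) * (1 / q.toReal) = 1 - p.toReal / q.toReal := by
          field_simp
        have e2 : 1 / p.toReal * (p.toReal / q.toReal) = 1 / q.toReal := by field_simp
        rw [ENNReal.mul_rpow_of_nonneg _ _ (by positivity), ← ENNReal.rpow_mul, e1,
          ← ENNReal.rpow_mul, e2]

section Young

variable {E : Type*} [NormedAddCommGroup E] [NormedSpace ℂ E]

theorem eLpNorm_integral_smul_sub_le {p : ℝ≥0∞} (hp : 1 ≤ p) (hp' : p ≠ ⊤) {K : R3 → ℂ}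
    {f : R3 → E} (hK : AEStronglyMeasurable K volume) (hf : AEStronglyMeasurable f volume) :
    eLpNorm (fun x => ∫ y, K y • f (x - y)) p volume ≤ eLpNorm K 1 volume * eLpNorm f p volume := by
  have hp0 : p ≠ 0 := (zero_lt_one.trans_le hp).ne'
  have hr : 1 ≤ p.toReal := by
    rw [← ENNReal.toReal_one]; exact ENNReal.toReal_mono hp' hp
  have hr0 : 0 < p.toReal := by linarith
  rw [eLpNorm_eq_lintegral_rpow_enorm_toReal hp0 hp', eLpNorm_eq_lintegral_rpow_enorm_toReal hp0 hp',
    eLpNorm_one_eq_lintegral_enorm]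
  calc (∫⁻ x, ‖∫ y, K y • f (x - y)‖ₑ ^ p.toReal) ^ (1 / p.toReal)
      ≤ (∫⁻ x, (∫⁻ y, ‖K y‖ₑ * ‖f (x - y)‖ₑ) ^ p.toReal) ^ (1 / p.toReal) := by
        gcongr with x
        refine (enorm_integral_le_lintegral_enorm _).trans ?_
        simp_rw [enorm_smul]
        exact le_rfl
    _ ≤ ((∫⁻ y, ‖K y‖ₑ) ^ p.toReal * ∫⁻ x, ‖f x‖ₑ ^ p.toReal) ^ (1 / p.toReal) := by
        gcongr
        exact lintegral_rpow_convolution_le hK.enorm hf.enorm hr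
    _ = _ := by
        rw [ENNReal.mul_rpow_of_nonneg _ _ (by positivity), ← ENNReal.rpow_mul,
          mul_one_div_cancel hr0.ne', ENNReal.rpow_one]

/-- The endpoint `L^p → L^∞` of Young's inequality. Interpolated with `L^p → L^p` it yields the
bounds from `L^p` to `L^q` with `q ≥ p`. -/
theorem enorm_integral_smul_sub_le {p q : ℝ≥0∞} [hpq : ENNReal.HolderConjugate p q] {K : R3 → ℂ}
    {f : R3 → E} (hK : AEStronglyMeasurable K volume) (hf : AEStronglyMeasurable f volume) (x : R3) :
    ‖∫ y, K y • f (x - y)‖ₑ ≤ eLpNorm K q volume * eLpNorm f p volume := by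
  refine (enorm_integral_le_lintegral_enorm _).trans ?_
  have hqp : ENNReal.HolderTriple q p 1 := ENNReal.HolderTriple.symm
  rw [← eLpNorm_one_eq_lintegral_enorm]
  have hmp : MeasurePreserving (fun y : R3 => x - y) volume volume :=
    Measure.measurePreserving_sub_left volume x
  rw [← eLpNorm_comp_measurePreserving (p := p) hf hmp]
  exact eLpNorm_smul_le_mul_eLpNorm (p := q) (q := p) (r := 1)
    (hf.comp_quasiMeasurePreserving hmp.quasiMeasurePreserving) hK

/-! ### Dilated symbols and their convolution kernels -/

/-- The dilation `η ↦ a(l⁻¹ η)` of a Schwartz symbol. -/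
def dil (l : ℝ) (hl : 0 < l) (a : 𝓢(R3, ℂ)) : 𝓢(R3, ℂ) :=
  SchwartzMap.compCLMOfContinuousLinearEquiv ℂ
    (ContinuousLinearEquiv.smulLeft (R₁ := ℝ) (M₁ := R3) (Units.mk0 l⁻¹ (inv_pos.2 hl).ne')) a

theorem dil_apply {l : ℝ} (hl : 0 < l) (a : 𝓢(R3, ℂ)) (η : R3) : dil l hl a η = a (l⁻¹ • η) := by
  simp [dil, Units.smul_def]

theorem fourierInv_dil_apply {l : ℝ} (hl : 0 < l) (a : 𝓢(R3, ℂ)) (x : R3) :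
    (𝓕⁻ (dil l hl a)) x = ((l ^ 3 : ℝ) : ℂ) • (𝓕⁻ a) (l • x) := by
  rw [SchwartzMap.fourierInv_coe, SchwartzMap.fourierInv_coe, Real.fourierInv_eq',
    Real.fourierInv_eq']
  have h := Measure.integral_comp_inv_smul (volume : Measure R3)
    (fun v : R3 => Complex.exp (↑(2 * Real.pi * inner ℝ v (l • x)) * Complex.I) • a v) l
  have h3 : |l ^ Module.finrank ℝ R3| = l ^ 3 := by
    rw [abs_of_pos (by positivity)]; simp [R3]
  rw [h3] at h
  rw [Complex.coe_smul, ← h]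
  refine integral_congr_ae (Eventually.of_forall fun v => ?_)
  simp only [dil_apply, inner_smul_left, inner_smul_right]
  congr 4
  simp [hl.ne']

/-- The kernel of the dilated symbol is `l³ K(l x)`; the change of variables costs `l^{-3/r}`. -/
theorem eLpNorm_fourierInv_dil {l : ℝ} (hl : 0 < l) (a : 𝓢(R3, ℂ)) (r : ℝ≥0∞) :
    eLpNorm (𝓕⁻ (dil l hl a) : 𝓢(R3, ℂ)) r volume =
      ENNReal.ofReal (l ^ (3 * (1 - (1 / r).toReal))) *
        eLpNorm (𝓕⁻ a : 𝓢(R3, ℂ)) r volume := by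
  have h1 : ((𝓕⁻ (dil l hl a) : 𝓢(R3, ℂ)) : R3 → ℂ) =
      ((l ^ 3 : ℝ) : ℂ) • ((𝓕⁻ a : 𝓢(R3, ℂ)) ∘ fun x : R3 => l • x) := by
    ext x
    simp [fourierInv_dil_apply]
  have hd : ENNReal.ofReal |(l ^ Module.finrank ℝ R3)⁻¹| = ENNReal.ofReal (l ^ (-3 : ℝ)) := by
    rw [abs_of_pos (by positivity), Real.rpow_neg hl.le]
    simp [R3]
  have hpos : ENNReal.ofReal (l ^ (-3 : ℝ)) ≠ 0 := by
    have : 0 < l ^ (-3 : ℝ) := by positivity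
    simpa using this
  rw [h1, eLpNorm_const_smul, ← eLpNorm_map_measure (𝓕⁻ a : 𝓢(R3, ℂ)).continuous.aestronglyMeasurable
    (by fun_prop), Measure.map_addHaar_smul _ hl.ne', hd,
    eLpNorm_smul_measure_of_ne_zero hpos, smul_eq_mul, ← mul_assoc]
  congr 1
  rw [ENNReal.ofReal_rpow_of_pos (by positivity), ← Real.rpow_mul hl.le,
    ← ofReal_norm, ← ENNReal.ofReal_mul (by positivity)]
  congr 1
  simp only [Complex.norm_real, Real.norm_eq_abs]
  rw [abs_of_pos (by positivity), ← Real.rpow_natCast, ← Real.rpow_add hl]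
  congr 1
  push_cast
  ring

/-- Fourier multipliers with Schwartz symbols act by convolution. -/
theorem fourierMultiplierCLM_apply_eq_integral [CompleteSpace E] (a : 𝓢(R3, ℂ)) (ψ : 𝓢(R3, E))
    (x : R3) :
    SchwartzMap.fourierMultiplierCLM E (a : R3 → ℂ) ψ x = ∫ y, (𝓕⁻ a) y • ψ (x - y) := by
  have h := SchwartzMap.convolution_apply (ContinuousLinearMap.lsmul ℂ ℂ) (𝓕⁻ a) ψ x
  rw [convolution_def] at h
  simp only [ContinuousLinearMap.lsmul_apply] at h
  rw [← h, SchwartzMap.fourierMultiplierCLM_apply]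
  congr 1
  have : 𝓕⁻ (SchwartzMap.smulLeftCLM E (a : R3 → ℂ) (𝓕 ψ)) =
      𝓕⁻ (SchwartzMap.pairing (ContinuousLinearMap.lsmul ℂ ℂ) (𝓕 (𝓕⁻ a)) (𝓕 ψ)) := by
    congr 1
    ext η
    simp [SchwartzMap.smulLeftCLM_apply_apply a.hasTemperateGrowth]
  rw [this]
  rfl

/-- For `L^p → L^p` the kernel enters through its scale-invariant `L¹` norm, for `L^p → L^∞` through
its `L^{p'}` norm, which scales like `l^{3/p}`. Interpolating with `θ = p/q` leaves
`l^{(3/p)(1-θ)}`, the Bernstein factor. -/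
theorem eLpNorm_multiplier_dil_le [CompleteSpace E] {p q : ℝ≥0∞} (hp : 1 ≤ p) (hpq : p ≤ q)
    (hq : q ≠ ⊤) {l : ℝ} (hl : 0 < l) (a : 𝓢(R3, ℂ)) (ψ : 𝓢(R3, E)) :
    eLpNorm (SchwartzMap.fourierMultiplierCLM E (dil l hl a : R3 → ℂ) ψ) q volume ≤
      (eLpNorm (𝓕⁻ a : 𝓢(R3, ℂ)) (1 - p⁻¹)⁻¹ volume ^ (1 - p.toReal / q.toReal) *
        eLpNorm (𝓕⁻ a : 𝓢(R3, ℂ)) 1 volume ^ (p.toReal / q.toReal)) *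
      ENNReal.ofReal (l ^ (3 * (1 / p.toReal - 1 / q.toReal))) * eLpNorm ψ p volume := by
  have hp' : p ≠ ⊤ := ne_top_of_le_ne_top hq hpq
  have hp0 : p ≠ 0 := (zero_lt_one.trans_le hp).ne'
  have hq0 : q ≠ 0 := (zero_lt_one.trans_le (hp.trans hpq)).ne'
  have hr0 : 0 < p.toReal := ENNReal.toReal_pos hp0 hp'
  have hs0 : 0 < q.toReal := ENNReal.toReal_pos hq0 hq
  have hrs : p.toReal ≤ q.toReal := ENNReal.toReal_mono hq hpq
  have hc : ENNReal.HolderConjugate p (1 - p⁻¹)⁻¹ := ENNReal.HolderConjugate.inv_one_sub_inv' hp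
  have hθ : 0 ≤ 1 - p.toReal / q.toReal := by
    rw [sub_nonneg, div_le_one hs0]; exact hrs
  have e0 : (⇑(SchwartzMap.fourierMultiplierCLM E (dil l hl a : R3 → ℂ) ψ) : R3 → E) =
      fun x => ∫ y, (𝓕⁻ (dil l hl a) : 𝓢(R3, ℂ)) y • ψ (x - y) :=
    funext fun x => fourierMultiplierCLM_apply_eq_integral _ _ _
  have e1 : eLpNorm (𝓕⁻ (dil l hl a) : 𝓢(R3, ℂ)) 1 volume =
      eLpNorm (𝓕⁻ a : 𝓢(R3, ℂ)) 1 volume := by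
    rw [eLpNorm_fourierInv_dil]; simp
  have e2 : eLpNorm (𝓕⁻ (dil l hl a) : 𝓢(R3, ℂ)) (1 - p⁻¹)⁻¹ volume =
      ENNReal.ofReal (l ^ (3 / p.toReal)) * eLpNorm (𝓕⁻ a : 𝓢(R3, ℂ)) (1 - p⁻¹)⁻¹ volume := by
    rw [eLpNorm_fourierInv_dil]
    congr 3
    rw [one_div, inv_inv, ENNReal.toReal_sub_of_le (by simpa using hp) (by simp)]
    simp [ENNReal.toReal_inv]
    ring
  have hK1 := eLpNorm_integral_smul_sub_le hp hp'
    (𝓕⁻ (dil l hl a) : 𝓢(R3, ℂ)).continuous.aestronglyMeasurable ψ.continuous.aestronglyMeasurable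
  have hK2 := enorm_integral_smul_sub_le (p := p) (q := (1 - p⁻¹)⁻¹)
    (𝓕⁻ (dil l hl a) : 𝓢(R3, ℂ)).continuous.aestronglyMeasurable ψ.continuous.aestronglyMeasurable
  rw [← e0, e1] at hK1
  rw [e2] at hK2
  have hK2' : ∀ x, ‖SchwartzMap.fourierMultiplierCLM E (dil l hl a : R3 → ℂ) ψ x‖ₑ ≤
      ENNReal.ofReal (l ^ (3 / p.toReal)) * eLpNorm (𝓕⁻ a : 𝓢(R3, ℂ)) (1 - p⁻¹)⁻¹ volume *
        eLpNorm ψ p volume := fun x => by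
    rw [e0]; exact hK2 x
  have hA : eLpNorm (𝓕⁻ a : 𝓢(R3, ℂ)) (1 - p⁻¹)⁻¹ (volume : Measure R3) ≠ ⊤ :=
    ((𝓕⁻ a : 𝓢(R3, ℂ)).memLp _ volume).2.ne
  have hψ : eLpNorm ψ p (volume : Measure R3) ≠ ⊤ := (ψ.memLp _ volume).2.ne
  have hfin := eLpNorm_le_of_enorm_le hp hpq hq
    (ENNReal.mul_ne_top (ENNReal.mul_ne_top ENNReal.ofReal_ne_top hA) hψ)
    (Eventually.of_forall hK2')
  refine hfin.trans ?_
  generalize eLpNorm (𝓕⁻ a : 𝓢(R3, ℂ)) (1 - p⁻¹)⁻¹ (volume : Measure R3) = A at *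
  generalize eLpNorm (𝓕⁻ a : 𝓢(R3, ℂ)) 1 (volume : Measure R3) = B at *
  generalize eLpNorm ψ p (volume : Measure R3) = N at *
  set θ := p.toReal / q.toReal with hθ_def
  have hθ0 : 0 ≤ θ := by positivity
  calc (ENNReal.ofReal (l ^ (3 / p.toReal)) * A * N) ^ (1 - θ) * _ ^ θ
      ≤ (ENNReal.ofReal (l ^ (3 / p.toReal)) * A * N) ^ (1 - θ) * (B * N) ^ θ := by gcongr
    _ = (A ^ (1 - θ) * B ^ θ) * ENNReal.ofReal (l ^ (3 / p.toReal)) ^ (1 - θ) *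
          (N ^ (1 - θ) * N ^ θ) := by
        rw [ENNReal.mul_rpow_of_nonneg _ _ hθ, ENNReal.mul_rpow_of_nonneg _ _ hθ,
          ENNReal.mul_rpow_of_nonneg _ _ hθ0]
        ring
    _ = _ := by
        rw [← ENNReal.rpow_add_of_nonneg _ _ hθ hθ0, ENNReal.ofReal_rpow_of_pos (by positivity),
          ← Real.rpow_mul hl.le]
        have : 3 / p.toReal * (1 - θ) = 3 * (1 / p.toReal - 1 / q.toReal) := by
          rw [hθ_def]; field_simp
        rw [this]
        simp

end Young

/-! ### Fourier multipliers on distributions -/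

/-- Fourier multipliers on vector distributions. -/
abbrev Mul (a : R3 → ℂ) : VField →L[ℂ] VField := TemperedDistribution.fourierMultiplierCLM C3 a

theorem Mul_ofSchwartz {a : R3 → ℂ} (ha : a.HasTemperateGrowth) (ψ : 𝓢(R3, C3)) :
    Mul a (ofSchwartz ψ) = ofSchwartz (SchwartzMap.fourierMultiplierCLM C3 a ψ) :=
  TemperedDistribution.fourierMultiplierCLM_toTemperedDistributionCLM_eq ha ψ

/-- A multiplier bound for Schwartz fields extends to `L^p`. -/
theorem lpENorm_Mul_le_of_schwartz {p q : ℝ≥0∞} (hp : 1 ≤ p) (hp' : p ≠ ⊤) (hq : 1 ≤ q)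
    {a : R3 → ℂ} (ha : a.HasTemperateGrowth) {M : ℝ≥0∞} (hM0 : M ≠ 0) (hM : M ≠ ⊤)
    (h : ∀ ψ : 𝓢(R3, C3), eLpNorm (SchwartzMap.fourierMultiplierCLM C3 a ψ) q volume ≤
      M * eLpNorm ψ p volume) (u : VField) :
    lpENorm q (Mul a u) ≤ M * lpENorm p u := by
  have hpF : Fact (1 ≤ p) := ⟨hp⟩
  have hqF : Fact (1 ≤ q) := ⟨hq⟩
  by_cases hu : lpENorm p u = ⊤
  -- `M ≠ 0` is needed here, since `0 * ∞ = 0` would make the right-hand side vanish.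
  · rw [hu, ENNReal.mul_top hM0]; exact le_top
  obtain ⟨f, rfl⟩ := exists_emb_eq (lt_top_iff_ne_top.2 hu)
  obtain ⟨g, hg, hgf⟩ := mem_closure_iff_seq_limit.1
    ((SchwartzMap.denseRange_toLpCLM (E := R3) (F := C3) (μ := volume) hp') f)
  choose ψ hψ using hg
  have hemb : ∀ n, emb p (g n) = ofSchwartz (ψ n) := fun n => by
    rw [← hψ n]
    exact Lp.toTemperedDistribution_toLp_eq (ψ n)
  set k : ℕ → Lp C3 q (volume : Measure R3) := fun n =>
    SchwartzMap.toLpCLM ℝ C3 q volume (SchwartzMap.fourierMultiplierCLM C3 a (ψ n)) with hk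
  have hkemb : ∀ n, emb q (k n) = Mul a (emb p (g n)) := fun n => by
    rw [hemb, Mul_ofSchwartz ha]
    exact Lp.toTemperedDistribution_toLp_eq _
  have hbound : ∀ v : Lp C3 p (volume : Measure R3), ∀ w : Lp C3 q (volume : Measure R3),
      ∀ ρ : 𝓢(R3, C3), emb p v = ofSchwartz ρ → emb q w = Mul a (emb p v) → ‖w‖ₑ ≤ M * ‖v‖ₑ := by
    intro v w ρ h1 h2
    rw [← lpENorm_emb, ← lpENorm_emb, h2, h1, Mul_ofSchwartz ha, lpENorm_ofSchwartz hp,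
      lpENorm_ofSchwartz hq]
    exact h ρ
  -- The bound for differences of Schwartz approximants makes their images Cauchy in `L^q`. By weak
  -- continuity of `Mul a` the limit represents the multiplier applied to `f`.
  have hcauchy : CauchySeq k := by
    rw [EMetric.cauchySeq_iff]
    intro ε hε
    have hgc := hgf.cauchySeq
    rw [EMetric.cauchySeq_iff] at hgc
    obtain ⟨N, hN⟩ := hgc (ε / M) (ENNReal.div_pos hε.ne' hM)
    refine ⟨N, fun m hm n hn => ?_⟩
    rw [edist_eq_enorm_sub]
    refine lt_of_le_of_lt (hbound (g m - g n) (k m - k n) (ψ m - ψ n) ?_ ?_) ?_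
    · rw [map_sub, hemb, hemb]
      exact (map_sub (SchwartzMap.toTemperedDistributionCLM R3 C3 volume) _ _).symm
    · rw [map_sub, map_sub, map_sub, hkemb, hkemb]
    · rw [← edist_eq_enorm_sub, mul_comm]
      exact ENNReal.mul_lt_of_lt_div (hN m hm n hn)
  obtain ⟨w, hw⟩ := cauchySeq_tendsto_of_complete hcauchy
  have heq : emb q w = Mul a (emb p f) := by
    have h1 := ((emb q).continuous.tendsto w).comp hw
    have h2 := (((Mul a).comp (emb p)).continuous.tendsto f).comp hgf
    refine tendsto_nhds_unique h1 (h2.congr fun n => ?_)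
    exact (hkemb n).symm
  rw [← heq, lpENorm_emb, lpENorm_emb]
  have h3 : Tendsto (fun n => M * ‖g n‖ₑ) atTop (𝓝 (M * ‖f‖ₑ)) :=
    ENNReal.Tendsto.const_mul ((continuous_enorm.tendsto f).comp hgf) (Or.inr hM)
  exact le_of_tendsto_of_tendsto' ((continuous_enorm.tendsto w).comp hw) h3
    fun n => hbound (g n) (k n) (ψ n) (hemb n) (hkemb n)

/-- Bernstein's inequality: multipliers with dilated symbols from `L^p` to `L^q`. -/
theorem exists_lpENorm_Mul_dil_le {p q : ℝ≥0∞} (hp : 1 ≤ p) (hpq : p ≤ q) (hq : q ≠ ⊤)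
    (a : 𝓢(R3, ℂ)) : ∃ C : ℝ≥0, ∀ (l : ℝ) (hl : 0 < l) (u : VField),
      lpENorm q (Mul (dil l hl a) u) ≤
        C * ENNReal.ofReal (l ^ (3 * (1 / p.toReal - 1 / q.toReal))) * lpENorm p u := by
  have hA : ∀ r, eLpNorm (𝓕⁻ a : 𝓢(R3, ℂ)) r (volume : Measure R3) ≠ ⊤ := fun r =>
    ((𝓕⁻ a : 𝓢(R3, ℂ)).memLp _ volume).2.ne
  have hp' : p ≠ ⊤ := ne_top_of_le_ne_top hq hpq
  have hp0 : p ≠ 0 := (zero_lt_one.trans_le hp).ne'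
  have hq0 : q ≠ 0 := (zero_lt_one.trans_le (hp.trans hpq)).ne'
  have hs0 : 0 < q.toReal := ENNReal.toReal_pos hq0 hq
  have hrs : p.toReal ≤ q.toReal := ENNReal.toReal_mono hq hpq
  have hθ : 0 ≤ 1 - p.toReal / q.toReal := by
    rw [sub_nonneg, div_le_one hs0]; exact hrs
  have hD : eLpNorm (𝓕⁻ a : 𝓢(R3, ℂ)) (1 - p⁻¹)⁻¹ volume ^ (1 - p.toReal / q.toReal) *
      eLpNorm (𝓕⁻ a : 𝓢(R3, ℂ)) 1 volume ^ (p.toReal / q.toReal) ≠ ⊤ :=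
    ENNReal.mul_ne_top (ENNReal.rpow_ne_top_of_nonneg hθ (hA _))
      (ENNReal.rpow_ne_top_of_nonneg (by positivity) (hA _))
  lift (eLpNorm (𝓕⁻ a : 𝓢(R3, ℂ)) (1 - p⁻¹)⁻¹ volume ^ (1 - p.toReal / q.toReal) *
      eLpNorm (𝓕⁻ a : 𝓢(R3, ℂ)) 1 volume ^ (p.toReal / q.toReal)) to ℝ≥0 using hD with D hDD
  -- The `+ 1` keeps the constant nonzero, as `lpENorm_Mul_le_of_schwartz` demands.
  refine ⟨D + 1, fun l hl u => ?_⟩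
  have hpos : 0 < l ^ (3 * (1 / p.toReal - 1 / q.toReal)) := by positivity
  refine lpENorm_Mul_le_of_schwartz hp hp' (hp.trans hpq) (dil l hl a).hasTemperateGrowth ?_ ?_
    (fun ψ => ?_) u
  · exact mul_ne_zero (by simp) (by simpa using hpos)
  · exact ENNReal.mul_ne_top ENNReal.coe_ne_top ENNReal.ofReal_ne_top
  · refine (eLpNorm_multiplier_dil_le hp hpq hq hl a ψ).trans ?_
    rw [← hDD]
    gcongr
    simp

/-! ### Dilated cut-offs as approximations of the identity on Schwartz space -/

section Cutoff

variable {E : Type*} [NormedAddCommGroup E] [NormedSpace ℂ E]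

/-- Each derivative of `a(l⁻¹ η)` brings a factor `l⁻¹ ≤ 1`, so the dilates are bounded uniformly in
`l ≥ 1`. -/
theorem norm_iteratedFDeriv_dil_le {l : ℝ} (hl : 1 ≤ l) (a : 𝓢(R3, ℂ)) (i : ℕ) (x : R3) :
    ‖iteratedFDeriv ℝ i (dil l (by linarith) a) x‖ ≤ SchwartzMap.seminorm ℝ 0 i a := by
  have h1 : (dil l (by linarith) a : R3 → ℂ) =
      (a : R3 → ℂ) ∘ (l⁻¹ • ContinuousLinearMap.id ℝ R3 : R3 →L[ℝ] R3) := by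
    ext η
    simp [dil_apply]
  rw [h1, ContinuousLinearMap.iteratedFDeriv_comp_right _ (a.smooth i) _ le_rfl]
  refine (ContinuousMultilinearMap.norm_compContinuousLinearMap_le _ _).trans ?_
  have h2 : ‖(l⁻¹ • ContinuousLinearMap.id ℝ R3 : R3 →L[ℝ] R3)‖ ≤ 1 := by
    rw [norm_smul, Real.norm_of_nonneg (by positivity)]
    calc l⁻¹ * _ ≤ 1 * 1 := by
          gcongr
          · exact inv_le_one_of_one_le₀ hl
          · exact ContinuousLinearMap.norm_id_le
      _ = 1 := by norm_num
  calc _ ≤ SchwartzMap.seminorm ℝ 0 i a * 1 := by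
        gcongr
        · exact SchwartzMap.norm_iteratedFDeriv_le_seminorm ℝ a i _
        · exact Finset.prod_le_one (fun _ _ => norm_nonneg _) fun _ _ => h2
    _ = _ := mul_one _

/-- Dilated cut-offs converge to the identity on Schwartz space. -/
theorem tendsto_smulLeftCLM_dil (a : 𝓢(R3, ℂ)) {r : ℝ} (hr : 0 < r)
    (ha : ∀ η, ‖η‖ ≤ r → a η = 1) (ψ : 𝓢(R3, E)) :
    Tendsto (fun n : ℕ => SchwartzMap.smulLeftCLM E (dil ((2 : ℝ) ^ n) (by positivity) a : R3 → ℂ) ψ)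
      atTop (𝓝 ψ) := by
  rw [(schwartz_withSeminorms ℝ R3 E).tendsto_nhds]
  rintro ⟨k, m⟩ ε hε
  -- The difference vanishes for `‖x‖ < 2^n r`. Elsewhere `‖x‖ / (2^n r) ≥ 1` can be inserted, which
  -- gains `2^{-n}` at the price of one more power of `‖x‖`: hence `k + 1` in this Leibniz bound.
  set M : ℝ := (∑ i ∈ Finset.range (m + 1), (m.choose i : ℝ) * SchwartzMap.seminorm ℝ 0 i a *
    SchwartzMap.seminorm ℝ (k + 1) (m - i) ψ) + SchwartzMap.seminorm ℝ (k + 1) m ψ with hM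
  have hM0 : 0 ≤ M := by positivity
  have hbound : ∀ n : ℕ, schwartzSeminormFamily ℝ R3 E (k, m)
      (SchwartzMap.smulLeftCLM E (dil ((2 : ℝ) ^ n) (by positivity) a : R3 → ℂ) ψ - ψ) ≤
      M / r * (1 / 2) ^ n := by
    intro n
    rw [SchwartzMap.schwartzSeminormFamily_apply]
    refine SchwartzMap.seminorm_le_bound ℝ k m _ (by positivity) fun x => ?_
    have hfun : (⇑(SchwartzMap.smulLeftCLM E (dil ((2 : ℝ) ^ n) (by positivity) a : R3 → ℂ) ψ - ψ) :
        R3 → E) = (fun η => dil ((2 : ℝ) ^ n) (by positivity) a η • ψ η) - ψ := by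
      ext η
      simp [SchwartzMap.smulLeftCLM_apply_apply (dil ((2 : ℝ) ^ n) (by positivity) a).hasTemperateGrowth]
    have hp : (0 : ℝ) < 2 ^ n := by positivity
    rw [hfun]
    by_cases hx : ‖x‖ < 2 ^ n * r
    · have h0 : ((fun η => dil ((2 : ℝ) ^ n) (by positivity) a η • ψ η) - ⇑ψ : R3 → E) =ᶠ[𝓝 x]
          fun _ => 0 := by
        filter_upwards [(isOpen_lt continuous_norm continuous_const).mem_nhds hx] with y hy
        have : a (((2 : ℝ) ^ n)⁻¹ • y) = 1 := by
          apply ha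
          rw [norm_smul, Real.norm_of_nonneg (by positivity), inv_mul_le_iff₀ hp]
          exact le_of_lt hy
        simp [dil_apply, this]
      rw [(h0.iteratedFDeriv ℝ m).eq_of_nhds]
      have : iteratedFDeriv ℝ m (fun _ : R3 => (0 : E)) x = 0 := by
        rw [show (fun _ : R3 => (0 : E)) = 0 from rfl, iteratedFDeriv_zero]
        rfl
      rw [this]
      simp only [norm_zero, mul_zero]
      positivity
    · push Not at hx
      have hd : ContDiff ℝ m (dil ((2 : ℝ) ^ n) (by positivity) a : R3 → ℂ) :=
        (dil ((2 : ℝ) ^ n) (by positivity) a).smooth m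
      have hψ : ContDiff ℝ m (ψ : R3 → E) := ψ.smooth m
      have hs : ContDiff ℝ m (fun η => dil ((2 : ℝ) ^ n) (by positivity) a η • ψ η) := hd.smul hψ
      have h1 : ‖iteratedFDeriv ℝ m ((fun η => dil ((2 : ℝ) ^ n) (by positivity) a η • ψ η) - ⇑ψ) x‖ ≤
          (∑ i ∈ Finset.range (m + 1), (m.choose i : ℝ) * SchwartzMap.seminorm ℝ 0 i a *
            ‖iteratedFDeriv ℝ (m - i) ψ x‖) + ‖iteratedFDeriv ℝ m ψ x‖ := by
        rw [iteratedFDeriv_sub_apply hs.contDiffAt hψ.contDiffAt]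
        refine (norm_sub_le _ _).trans ?_
        gcongr
        refine (norm_iteratedFDeriv_smul_le hd hψ x le_rfl).trans ?_
        gcongr with i hi
        exact norm_iteratedFDeriv_dil_le (one_le_pow₀ (by norm_num)) a i x
      have h2 : ‖x‖ ^ (k + 1) * ‖iteratedFDeriv ℝ m
          ((fun η => dil ((2 : ℝ) ^ n) (by positivity) a η • ψ η) - ⇑ψ) x‖ ≤ M := by
        calc _ ≤ ‖x‖ ^ (k + 1) * ((∑ i ∈ Finset.range (m + 1),
              (m.choose i : ℝ) * SchwartzMap.seminorm ℝ 0 i a *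
              ‖iteratedFDeriv ℝ (m - i) ψ x‖) + ‖iteratedFDeriv ℝ m ψ x‖) := by gcongr
          _ = (∑ i ∈ Finset.range (m + 1), (m.choose i : ℝ) * SchwartzMap.seminorm ℝ 0 i a *
              (‖x‖ ^ (k + 1) * ‖iteratedFDeriv ℝ (m - i) ψ x‖)) +
              ‖x‖ ^ (k + 1) * ‖iteratedFDeriv ℝ m ψ x‖ := by
            rw [mul_add, Finset.mul_sum]
            congr 1
            exact Finset.sum_congr rfl fun i _ => by ring
          _ ≤ M := by
            rw [hM]
            gcongr
            · exact SchwartzMap.le_seminorm ℝ (k + 1) (m - _) ψ x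
            · exact SchwartzMap.le_seminorm ℝ (k + 1) m ψ x
      have hx0 : 0 < ‖x‖ := lt_of_lt_of_le (by positivity) hx
      set G := ‖iteratedFDeriv ℝ m
        ((fun η => dil ((2 : ℝ) ^ n) (by positivity) a η • ψ η) - ⇑ψ) x‖ with hG
      have hG0 : 0 ≤ G := norm_nonneg _
      calc ‖x‖ ^ k * G ≤ ‖x‖ ^ k * (‖x‖ / (2 ^ n * r)) * G := by
            gcongr
            exact le_mul_of_one_le_right (by positivity) ((one_le_div (by positivity)).2 hx)
        _ = (‖x‖ ^ (k + 1) * G) / (2 ^ n * r) := by ring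
        _ ≤ M / (2 ^ n * r) := by gcongr
        _ = M / r * (1 / 2) ^ n := by
            rw [one_div, inv_pow]
            field_simp
  have hlim : Tendsto (fun n : ℕ => M / r * (1 / 2 : ℝ) ^ n) atTop (𝓝 0) := by
    simpa using (tendsto_pow_atTop_nhds_zero_of_lt_one (by norm_num)
      (by norm_num : (1 / 2 : ℝ) < 1)).const_mul (M / r)
  filter_upwards [hlim.eventually (gt_mem_nhds hε)] with n hn
  exact (hbound n).trans_lt hn

end Cutoff

/-! ### Algebra of multipliers -/

theorem Mul_Mul {a b : R3 → ℂ} (ha : a.HasTemperateGrowth) (hb : b.HasTemperateGrowth) (u : VField) :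
    Mul a (Mul b u) = Mul (a * b) u := by
  rw [TemperedDistribution.fourierMultiplierCLM_fourierMultiplierCLM_apply hb ha, mul_comm]

theorem Mul_comm {a b : R3 → ℂ} (ha : a.HasTemperateGrowth) (hb : b.HasTemperateGrowth)
    (u : VField) : Mul a (Mul b u) = Mul b (Mul a u) := by
  rw [Mul_Mul ha hb, Mul_Mul hb ha, mul_comm]

theorem Mul_sub_symbol {a b : R3 → ℂ} (ha : a.HasTemperateGrowth) (hb : b.HasTemperateGrowth)
    (u : VField) : Mul (a - b) u = Mul a u - Mul b u := by
  simp only [TemperedDistribution.fourierMultiplierCLM_apply]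
  rw [TemperedDistribution.smulLeftCLM_sub ha hb]
  exact map_sub (FourierTransform.fourierInvCLM ℂ 𝓢'(R3, C3)) _ _

theorem Mul_smul_symbol {a : R3 → ℂ} (ha : a.HasTemperateGrowth) (z : ℂ) (u : VField) :
    Mul (z • a) u = z • Mul a u := by
  have h := TemperedDistribution.fourierMultiplierCLM_smul (F := C3) ha z
  exact congrArg (fun T => T u) h

theorem Mul_zero_symbol (u : VField) : Mul (0 : R3 → ℂ) u = 0 := by
  have h := Mul_sub_symbol (Function.HasTemperateGrowth.const (0 : ℂ))
    (Function.HasTemperateGrowth.const (0 : ℂ)) u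
  rw [sub_self, sub_self] at h
  exact h

/-! ### The Littlewood-Paley symbols -/

namespace IsLPCutoff

variable {χ : R3 → ℝ} (hχ : IsLPCutoff χ)

include hχ in
theorem hasCompactSupport_lowSym :
    HasCompactSupport fun η : R3 => ((χ ((2 * Real.pi) • η) : ℝ) : ℂ) := by
  have h : HasCompactSupport fun η : R3 => χ ((2 * Real.pi) • η) :=
    hχ.support.1.comp_homeomorph (Homeomorph.smulOfNeZero (2 * Real.pi) (by positivity))
  exact h.comp_left (g := fun t : ℝ => (t : ℂ)) (by simp)

include hχ in
theorem contDiff_lowSym :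
    ContDiff ℝ ∞ fun η : R3 => ((χ ((2 * Real.pi) • η) : ℝ) : ℂ) := by
  have := hχ.smooth
  exact Complex.ofRealCLM.contDiff.comp (this.comp (contDiff_const_smul _))

/-- The symbol of `Δ_{-1}` as a Schwartz function. -/
def lowSym : 𝓢(R3, ℂ) := hχ.hasCompactSupport_lowSym.toSchwartzMap hχ.contDiff_lowSym

theorem lowSym_apply (η : R3) : hχ.lowSym η = ((χ ((2 * Real.pi) • η) : ℝ) : ℂ) := rfl

/-- The symbol of `Δ_0`. -/
def annSym : 𝓢(R3, ℂ) := dil 2 two_pos hχ.lowSym - hχ.lowSym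

/-- The symbol of `S_n`, the sum of the blocks up to frequency `2^n`. -/
def sSym (n : ℕ) : 𝓢(R3, ℂ) := dil ((2 : ℝ) ^ n) (by positivity) hχ.lowSym

/-- The symbols of the blocks, numbered from `0`. -/
def dSym : ℕ → 𝓢(R3, ℂ)
  | 0 => hχ.lowSym
  | n + 1 => dil ((2 : ℝ) ^ n) (by positivity) hχ.annSym

/-- The low-frequency cut-off `S_n`. -/
def S (n : ℕ) : VField →L[ℂ] VField := Mul (hχ.sSym n)

/-- The blocks, numbered from `0`: `D 0 = Δ_{-1}`, `D (n + 1) = Δ_n`. -/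
def D (n : ℕ) : VField →L[ℂ] VField := Mul (hχ.dSym n)

theorem lowBlock_eq (u : VField) : lowBlock χ u = hχ.D 0 u := rfl

theorem block_eq (n : ℕ) (u : VField) : block χ n u = hχ.D (n + 1) u := by
  have h : (fun η : R3 => ((annulus χ (((2 : ℝ) ^ n)⁻¹ • ((2 * Real.pi) • η)) : ℝ) : ℂ)) =
      (hχ.dSym (n + 1) : R3 → ℂ) := by
    ext η
    simp only [dSym, dil_apply, annSym, sub_apply, lowSym_apply, annulus]
    rw [show (2 * Real.pi) • (2 : ℝ)⁻¹ • ((2 : ℝ) ^ n)⁻¹ • η =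
      (2 : ℝ)⁻¹ • ((2 : ℝ) ^ n)⁻¹ • (2 * Real.pi) • η by simp only [smul_smul]; congr 1; ring,
      smul_comm (2 * Real.pi) ((2 : ℝ) ^ n)⁻¹ η]
    push_cast
    rfl
  rw [block, multiplier, h]
  rfl

theorem sSym_apply (n : ℕ) (η : R3) :
    hχ.sSym n η = ((χ (((2 : ℝ) ^ n)⁻¹ • (2 * Real.pi) • η) : ℝ) : ℂ) := by
  rw [sSym, dil_apply, lowSym_apply, smul_comm]

theorem sSym_zero : hχ.sSym 0 = hχ.dSym 0 := by
  ext η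
  simp [sSym_apply, dSym, lowSym_apply]

theorem dSym_succ (n : ℕ) : hχ.dSym (n + 1) = hχ.sSym (n + 1) - hχ.sSym n := by
  ext η
  simp only [dSym, sSym, dil_apply, annSym, sub_apply, smul_smul]
  congr 3
  rw [pow_succ]
  field_simp

theorem norm_two_pi_smul (η : R3) : ‖(2 * Real.pi) • η‖ = 2 * Real.pi * ‖η‖ := by
  rw [norm_smul, Real.norm_of_nonneg (by positivity)]

include hχ in
theorem eq_zero {ξ : R3} (h : 1 ≤ ‖ξ‖) : χ ξ = 0 := by
  by_contra hc
  have := hχ.support.2 (subset_tsupport _ (Function.mem_support.2 hc))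
  simp only [Metric.mem_ball, dist_zero_right] at this
  linarith

/-- The supports behind all localisation below, with `|ξ| = 2π‖η‖`: the symbol of `S n` is one up to
`2^n / 2` and zero from `2^n` on, so for `n ≥ 1` that of `D n` lives in `2^n / 4 ≤ |ξ| ≤ 2^n`. -/
theorem sSym_eq_one {n : ℕ} {η : R3} (h : 2 * Real.pi * ‖η‖ ≤ 2 ^ n / 2) : hχ.sSym n η = 1 := by
  rw [sSym_apply, hχ.eq_one]
  · simp
  · rw [norm_smul, norm_two_pi_smul, Real.norm_of_nonneg (by positivity),
      inv_mul_le_iff₀ (by positivity)]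
    linarith

theorem sSym_eq_zero {n : ℕ} {η : R3} (h : 2 ^ n ≤ 2 * Real.pi * ‖η‖) : hχ.sSym n η = 0 := by
  rw [sSym_apply, hχ.eq_zero]
  · simp
  · rw [norm_smul, norm_two_pi_smul, Real.norm_of_nonneg (by positivity),
      le_inv_mul_iff₀ (by positivity)]
    linarith

theorem dSym_eq_zero_of_le {n : ℕ} {η : R3} (h : 2 ^ n ≤ 2 * Real.pi * ‖η‖) :
    hχ.dSym n η = 0 := by
  cases n with
  | zero => rw [← sSym_zero, hχ.sSym_eq_zero h]
  | succ n =>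
    rw [dSym_succ, sub_apply, hχ.sSym_eq_zero h, hχ.sSym_eq_zero, sub_zero]
    rw [pow_succ] at h
    have : (0 : ℝ) < 2 ^ n := by positivity
    linarith

theorem dSym_eq_zero_of_ge {n : ℕ} {η : R3} (h : 2 * Real.pi * ‖η‖ ≤ 2 ^ n / 2) :
    hχ.dSym (n + 1) η = 0 := by
  rw [dSym_succ, sub_apply, hχ.sSym_eq_one h, hχ.sSym_eq_one, sub_self]
  rw [pow_succ]
  have : (0 : ℝ) < 2 ^ n := by positivity
  linarith

theorem lowSym_neg (η : R3) : hχ.lowSym (-η) = hχ.lowSym η := by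
  rw [lowSym_apply, lowSym_apply, hχ.radial _ ((2 * Real.pi) • η)]
  simp

theorem sSym_neg (n : ℕ) (η : R3) : hχ.sSym n (-η) = hχ.sSym n η := by
  rw [sSym, dil_apply, dil_apply, smul_neg, lowSym_neg]

theorem conj_sSym (n : ℕ) (η : R3) : starRingEnd ℂ (hχ.sSym n η) = hχ.sSym n η := by
  rw [sSym_apply, Complex.conj_ofReal]

theorem dSym_neg (n : ℕ) (η : R3) : hχ.dSym n (-η) = hχ.dSym n η := by
  cases n with
  | zero => rw [← sSym_zero, sSym_neg]
  | succ n => simp only [dSym_succ, sub_apply, sSym_neg]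

theorem conj_dSym (n : ℕ) (η : R3) : starRingEnd ℂ (hχ.dSym n η) = hχ.dSym n η := by
  cases n with
  | zero => rw [← sSym_zero, conj_sSym]
  | succ n => simp only [dSym_succ, sub_apply, map_sub, conj_sSym]

theorem sum_D (n : ℕ) (u : VField) : ∑ i ∈ Finset.range (n + 1), hχ.D i u = hχ.S n u := by
  induction n with
  | zero => simp [S, D, sSym_zero]
  | succ n ih =>
    have h : (⇑(hχ.dSym (n + 1)) : R3 → ℂ) = ⇑(hχ.sSym (n + 1)) - ⇑(hχ.sSym n) := by
      rw [dSym_succ]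
      rfl
    rw [Finset.sum_range_succ, ih, S, S, D, h, Mul_sub_symbol (hχ.sSym _).hasTemperateGrowth (hχ.sSym _).hasTemperateGrowth]
    abel

theorem S_D {m n : ℕ} (h : n < m) (u : VField) : hχ.S m (hχ.D n u) = hχ.D n u := by
  rw [S, D, Mul_Mul (hχ.sSym _).hasTemperateGrowth (hχ.dSym _).hasTemperateGrowth]
  congr 2
  ext η
  simp only [Pi.mul_apply]
  rcases le_total (2 ^ n) (2 * Real.pi * ‖η‖) with h1 | h1
  · rw [hχ.dSym_eq_zero_of_le h1, mul_zero]
  · rw [hχ.sSym_eq_one, one_mul]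
    have : (2 : ℝ) ^ (n + 1) ≤ 2 ^ m := pow_le_pow_right₀ (by norm_num) h
    rw [pow_succ] at this
    linarith

/-- `D (n + 2)` begins at `|ξ| = 2^n`, where `S n` ends. -/
theorem D_S_of_lt {m n : ℕ} (h : n + 2 ≤ m) (u : VField) : hχ.D m (hχ.S n u) = 0 := by
  rw [S, D, Mul_Mul (hχ.dSym _).hasTemperateGrowth (hχ.sSym _).hasTemperateGrowth]
  rw [← Mul_zero_symbol u]
  congr 2
  ext η
  simp only [Pi.mul_apply, Pi.zero_apply]
  rcases le_total (2 ^ n) (2 * Real.pi * ‖η‖) with h1 | h1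
  · rw [hχ.sSym_eq_zero h1, mul_zero]
  · obtain ⟨k, rfl⟩ : ∃ k, m = k + 1 := ⟨m - 1, by omega⟩
    rw [hχ.dSym_eq_zero_of_ge, zero_mul]
    have : (2 : ℝ) ^ (n + 1) ≤ 2 ^ k := pow_le_pow_right₀ (by norm_num) (by omega)
    rw [pow_succ] at this
    linarith

theorem D_S_comm (m n : ℕ) (u : VField) : hχ.D m (hχ.S n u) = hχ.S n (hχ.D m u) :=
  Mul_comm (hχ.dSym _).hasTemperateGrowth (hχ.sSym _).hasTemperateGrowth u

theorem tendsto_smulLeftCLM_sSym {E : Type*} [NormedAddCommGroup E] [NormedSpace ℂ E]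
    (ψ : 𝓢(R3, E)) :
    Tendsto (fun n => SchwartzMap.smulLeftCLM E (hχ.sSym n : R3 → ℂ) ψ) atTop (𝓝 ψ) := by
  refine tendsto_smulLeftCLM_dil hχ.lowSym (r := 1 / (4 * Real.pi)) (by positivity) (fun η h => ?_) ψ
  have : hχ.lowSym = hχ.sSym 0 := hχ.sSym_zero.symm
  rw [this]
  apply hχ.sSym_eq_one
  rw [le_div_iff₀ (by positivity)] at h
  norm_num
  linarith

/-- `S_n u → u` weakly. -/
theorem tendsto_S_apply (u : VField) (φ : 𝓢(R3, ℂ)) :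
    Tendsto (fun n => hχ.S n u φ) atTop (𝓝 (u φ)) := by
  have h1 := hχ.tendsto_smulLeftCLM_sSym (𝓕⁻ φ)
  have h2 := ((FourierTransform.fourierCLM ℂ 𝓢(R3, ℂ)).continuous.tendsto (𝓕⁻ φ)).comp h1
  have h3 := (u.continuous.tendsto _).comp h2
  rwa [fourierCLM_apply, fourier_fourierInv_eq] at h3

theorem tendsto_sum_D_apply (u : VField) (φ : 𝓢(R3, ℂ)) :
    Tendsto (fun n => (∑ i ∈ Finset.range n, hχ.D i u) φ) atTop (𝓝 (u φ)) := by
  rw [← tendsto_add_atTop_iff_nat 1]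
  simpa only [sum_D] using hχ.tendsto_S_apply u φ

end IsLPCutoff

/-! ### Spectral localisation of products -/

instance : ENNReal.HolderTriple 3 3 (3 / 2) := ⟨by
  rw [ENNReal.inv_div (by simp) (by simp), ENNReal.div_eq_inv_mul, mul_comm, two_mul]⟩

theorem exists_lpENorm_Mul_le {p : ℝ≥0∞} (hp : 1 ≤ p) (hp' : p ≠ ⊤) (a : 𝓢(R3, ℂ)) :
    ∃ C : ℝ≥0, ∀ u : VField, lpENorm p (Mul a u) ≤ C * lpENorm p u := by
  obtain ⟨C, hC⟩ := exists_lpENorm_Mul_dil_le hp le_rfl hp' a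
  refine ⟨C, fun u => ?_⟩
  have h := hC 1 one_pos u
  have h1 : (dil 1 one_pos a : R3 → ℂ) = a := by ext η; simp [dil_apply]
  simpa [h1] using h

/-- Density of Schwartz fields in `L^p`. -/
theorem exists_tendsto_lpENorm_ofSchwartz_sub {p : ℝ≥0∞} (hp : 1 ≤ p) (hp' : p ≠ ⊤) {u : VField}
    (hu : lpENorm p u < ⊤) : ∃ ψ : ℕ → 𝓢(R3, C3),
      Tendsto (fun n => lpENorm p (ofSchwartz (ψ n) - u)) atTop (𝓝 0) := by
  have : Fact (1 ≤ p) := ⟨hp⟩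
  obtain ⟨f, rfl⟩ := exists_emb_eq hu
  obtain ⟨g, hg, hgf⟩ := mem_closure_iff_seq_limit.1
    ((SchwartzMap.denseRange_toLpCLM (E := R3) (F := C3) (μ := volume) hp') f)
  choose ψ hψ using hg
  refine ⟨ψ, ?_⟩
  have hemb : ∀ n, emb p (g n) = ofSchwartz (ψ n) := fun n => by
    rw [← hψ n]
    exact Lp.toTemperedDistribution_toLp_eq (ψ n)
  rw [tendsto_iff_edist_tendsto_0] at hgf
  refine hgf.congr fun n => ?_
  rw [edist_eq_enorm_sub, ← lpENorm_emb, map_sub, hemb]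

/-- The transform of a product is a convolution, supported in the sum of the two balls of radius
`r`: if `‖η‖ ≥ 2r`, one of `t` and `η + t` has norm at least `r`. -/
theorem fourierMultiplier_pairing_eq_zero (B : C3 →L[ℂ] C3 →L[ℂ] C3) (f g : 𝓢(R3, C3)) {r : ℝ}
    (hf : ∀ η, r ≤ ‖η‖ → (𝓕 f : 𝓢(R3, C3)) η = 0) (hg : ∀ η, r ≤ ‖η‖ → (𝓕 g : 𝓢(R3, C3)) η = 0)
    {b : R3 → ℂ} (hb : b.HasTemperateGrowth) (hb0 : ∀ η, ‖η‖ < 2 * r → b η = 0) :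
    SchwartzMap.fourierMultiplierCLM C3 b (SchwartzMap.pairing B f g) = 0 := by
  have hneg : ∀ (h : 𝓢(R3, C3)) (η : R3), (𝓕⁻ h : 𝓢(R3, C3)) η = (𝓕 h : 𝓢(R3, C3)) (-η) := by
    intro h η
    rw [SchwartzMap.fourierInv_coe, SchwartzMap.fourier_coe, Real.fourierInv_eq_fourier_neg]
  have key : SchwartzMap.pairing B f g = 𝓕 (SchwartzMap.convolution B (𝓕⁻ f) (𝓕⁻ g)) := by
    rw [SchwartzMap.fourier_convolution, FourierTransform.fourier_fourierInv_eq,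
      FourierTransform.fourier_fourierInv_eq]
  have h0 : SchwartzMap.smulLeftCLM C3 b (𝓕 (SchwartzMap.pairing B f g)) = 0 := by
    ext1 η
    rw [SchwartzMap.smulLeftCLM_apply_apply hb, ← neg_neg η, ← hneg, key,
      FourierTransform.fourierInv_fourier_eq, SchwartzMap.convolution_apply, convolution_def]
    by_cases h : ‖η‖ < 2 * r
    · rw [neg_neg, hb0 η h, zero_smul]; rfl
    · have : ∀ t, B ((𝓕⁻ f : 𝓢(R3, C3)) t) ((𝓕⁻ g : 𝓢(R3, C3)) (-η - t)) = 0 := by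
        intro t
        rcases le_or_gt r ‖t‖ with ht | ht
        · rw [hneg f, hf _ (by rwa [norm_neg]), map_zero]; rfl
        · rw [hneg g, hg, map_zero]
          have := norm_sub_norm_le η (-t)
          rw [norm_neg] at this
          rw [show -(-η - t) = η - -t by abel]
          linarith
      simp [this]
  rw [SchwartzMap.fourierMultiplierCLM_apply, h0]
  exact map_zero (FourierTransform.fourierInvCLM ℂ 𝓢(R3, C3))

/-- Approximation by Schwartz fields with the same localisation of the frequencies. -/
theorem exists_tendsto_toLp_of_Mul_eq {p : ℝ≥0∞} [hp : Fact (1 ≤ p)] (hp' : p ≠ ⊤) {a : 𝓢(R3, ℂ)}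
    (f : Lp C3 p (volume : Measure R3)) (hf : Mul a (emb p f) = emb p f) :
    ∃ φ : ℕ → 𝓢(R3, C3), Tendsto (fun n => (φ n).toLp p volume) atTop (𝓝 f) ∧
      ∀ n η, a η = 0 → (𝓕 (φ n) : 𝓢(R3, C3)) η = 0 := by
  obtain ⟨C, hC⟩ := exists_lpENorm_Mul_le hp.out hp' a
  obtain ⟨ψ, hψ⟩ := exists_tendsto_lpENorm_ofSchwartz_sub hp.out hp'
    ((isLpFun_emb f).lpENorm_lt_top hp.out)
  -- Applying `Mul a` to arbitrary Schwartz approximants localises them. Convergence survives,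
  -- because `Mul a` is bounded on `L^p` and fixes the limit.
  refine ⟨fun n => SchwartzMap.fourierMultiplierCLM C3 a (ψ n), ?_, fun n η h => ?_⟩
  · rw [tendsto_iff_edist_tendsto_0]
    have h2 : Tendsto (fun n => C * lpENorm p (ofSchwartz (ψ n) - emb p f)) atTop (𝓝 0) := by
      simpa using ENNReal.Tendsto.const_mul hψ (Or.inr ENNReal.coe_ne_top)
    refine tendsto_of_tendsto_of_tendsto_of_le_of_le tendsto_const_nhds h2 (fun _ => zero_le)
      fun n => ?_
    rw [edist_eq_enorm_sub, ← lpENorm_emb, map_sub]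
    refine le_trans (le_of_eq ?_) (hC _)
    rw [map_sub, hf, Mul_ofSchwartz a.hasTemperateGrowth]
    congr 2
    exact Lp.toTemperedDistribution_toLp_eq _
  · beta_reduce
    rw [SchwartzMap.fourierMultiplierCLM_apply, FourierTransform.fourier_fourierInv_eq,
      SchwartzMap.smulLeftCLM_apply_apply a.hasTemperateGrowth, h, zero_smul]

theorem emb_holder_toLp {p q r : ℝ≥0∞} [ENNReal.HolderTriple p q r] [Fact (1 ≤ p)]
    [Fact (1 ≤ q)] [Fact (1 ≤ r)] (B : C3 →L[ℂ] C3 →L[ℂ] C3) (φ ψ : 𝓢(R3, C3)) :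
    emb r (B.holder r (φ.toLp p volume) (ψ.toLp q volume)) =
      ofSchwartz (SchwartzMap.pairing B φ ψ) := by
  ext1 θ
  rw [emb_apply, (isLpFun_ofSchwartz r _).2]
  refine integral_congr_ae ?_
  filter_upwards [B.coeFn_holder (r := r) (φ.toLp p volume) (ψ.toLp q volume),
    φ.coeFn_toLp p volume, ψ.coeFn_toLp q volume] with x h1 h2 h3
  rw [h1, h2, h3, SchwartzMap.pairing_apply_apply]

theorem eq_of_tendsto_of_forall_eq {X Y : Type*} [TopologicalSpace X] [TopologicalSpace Y]
    [T2Space Y] {T : X → Y} (hT : Continuous T) {x : ℕ → X} {a : X} (h : Tendsto x atTop (𝓝 a))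
    {z : Y} (hz : ∀ n, T (x n) = z) : T a = z :=
  tendsto_nhds_unique ((hT.tendsto a).comp h) (tendsto_const_nhds.congr fun n => (hz n).symm)

theorem continuous_Mul_emb {p : ℝ≥0∞} [Fact (1 ≤ p)] (b : R3 → ℂ) :
    Continuous fun F : Lp C3 p (volume : Measure R3) => Mul b (emb p F) :=
  (Mul b).continuous.comp (emb p).continuous

/-- The product of two fields with frequencies in the ball of radius `R` has frequencies in
the ball of radius `2 R`. -/
theorem Mul_holder_eq_zero {p q r : ℝ≥0∞} [ENNReal.HolderTriple p q r] [Fact (1 ≤ p)]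
    [Fact (1 ≤ q)] [Fact (1 ≤ r)] (hp : p ≠ ⊤) (hq : q ≠ ⊤) (B : C3 →L[ℂ] C3 →L[ℂ] C3)
    {a : 𝓢(R3, ℂ)} {R : ℝ}
    (ha : ∀ η, R ≤ ‖η‖ → a η = 0) (f : Lp C3 p (volume : Measure R3)) (g : Lp C3 q (volume : Measure R3))
    (hf : Mul a (emb p f) = emb p f) (hg : Mul a (emb q g) = emb q g)
    {b : R3 → ℂ} (hb : b.HasTemperateGrowth) (hb0 : ∀ η, ‖η‖ < 2 * R → b η = 0) :
    Mul b (emb r (B.holder r f g)) = 0 := by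
  obtain ⟨φ, hφ, hφ0⟩ := exists_tendsto_toLp_of_Mul_eq hp f hf
  obtain ⟨ψ, hψ, hψ0⟩ := exists_tendsto_toLp_of_Mul_eq hq g hg
  have h1 : Tendsto (fun n => B.holderL volume p q r ((φ n).toLp p volume) ((ψ n).toLp q volume))
      atTop (𝓝 (B.holderL volume p q r f g)) := by
    generalize B.holderL (volume : Measure R3) p q r = T
    have h := (T.continuous₂.tendsto (f, g)).comp (hφ.prodMk_nhds hψ)
    exact h
  have h2 : Mul b (emb r (B.holderL volume p q r f g)) = 0 :=
    eq_of_tendsto_of_forall_eq (T := fun F : Lp C3 r (volume : Measure R3) => Mul b (emb r F))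
      (continuous_Mul_emb b) h1 (z := 0) fun n => by
        rw [ContinuousLinearMap.holderL_apply_apply, emb_holder_toLp, Mul_ofSchwartz hb,
          fourierMultiplier_pairing_eq_zero B _ _ (fun η h => hφ0 n η (ha η h))
            (fun η h => hψ0 n η (ha η h)) hb hb0]
        exact map_zero (SchwartzMap.toTemperedDistributionCLM R3 C3 volume)
  exact h2

/-! ### Fourier transforms of `L¹ ∩ L²` functions -/

section FourierL2

variable {E : Type*} [NormedAddCommGroup E] [InnerProductSpace ℂ E] [CompleteSpace E]

/-- Plancherel's theorem for `L¹ ∩ L²` functions. -/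
theorem eLpNorm_fourier_two {m : R3 → E} (h1 : MemLp m 1 volume) (h2 : MemLp m 2 volume) :
    MemLp (𝓕 m) 2 volume ∧ eLpNorm (𝓕 m) 2 volume = eLpNorm m 2 volume := by
  have hint : Integrable m volume := memLp_one_iff_integrable.1 h1
  have hcont : Continuous (𝓕 m) := VectorFourier.fourierIntegral_continuous
    Real.continuous_fourierChar (by exact continuous_inner) hint
  set g : Lp E 2 (volume : Measure R3) := 𝓕 (h2.toLp m) with hg
  -- The integral transform and the `L²` transform agree because both are transposes of the
  -- transform of Schwartz functions.
  have key : (𝓕 m) =ᵐ[volume] g := by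
    refine ae_eq_of_forall_integral_smul_eq hcont.locallyIntegrable
      ((Lp.memLp g).locallyIntegrable (by norm_num)) fun φ => ?_
    have e1 := congrArg (fun u : 𝓢'(R3, E) => u φ)
      (Lp.fourier_toTemperedDistribution_eq (h2.toLp m))
    simp only [TemperedDistribution.fourier_apply, Lp.toTemperedDistribution_apply] at e1
    rw [← hg] at e1
    rw [← e1]
    have e2 : ∫ x, (𝓕 φ : 𝓢(R3, ℂ)) x • (h2.toLp m) x = ∫ x, (𝓕 (φ : R3 → ℂ)) x • m x := by
      refine integral_congr_ae ?_
      filter_upwards [h2.coeFn_toLp] with x hx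
      rw [hx, SchwartzMap.fourier_coe]
    rw [e2]
    have e3 := VectorFourier.integral_fourierIntegral_smul_eq_flip (L := innerₗ R3)
      (μ := volume) (ν := volume) (f := φ) (g := m) Real.continuous_fourierChar continuous_inner
      φ.integrable hint
    rw [flip_innerₗ] at e3
    exact e3.symm
  refine ⟨(memLp_congr_ae key).2 (Lp.memLp g), ?_⟩
  rw [eLpNorm_congr_ae key, ← eLpNorm_congr_ae h2.coeFn_toLp, ← Lp.enorm_def, ← Lp.enorm_def, hg,
    ← ofReal_norm, Lp.norm_fourier_eq, ofReal_norm]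

/-- `L¹ ∩ L²` functions have Fourier transforms in `L^q` for `2 ≤ q < ∞`. -/
theorem eLpNorm_fourier_le {q : ℝ≥0∞} (hq2 : 2 ≤ q) (hq : q ≠ ⊤) {m : R3 → E}
    (h1 : MemLp m 1 volume) (h2 : MemLp m 2 volume) :
    MemLp (𝓕 m) q volume ∧
      eLpNorm (𝓕 m) q volume ≤ eLpNorm m 1 volume + eLpNorm m 2 volume := by
  have hint : Integrable m volume := memLp_one_iff_integrable.1 h1
  have hcont : Continuous (𝓕 m) := VectorFourier.fourierIntegral_continuous
    Real.continuous_fourierChar (by exact continuous_inner) hint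
  have hsup : ∀ x, ‖𝓕 m x‖ₑ ≤ eLpNorm m 1 volume := fun x => by
    rw [eLpNorm_one_eq_lintegral_enorm, Real.fourier_eq]
    refine (enorm_integral_le_lintegral_enorm _).trans (lintegral_mono fun y => ?_)
    rw [← ofReal_norm, Circle.norm_smul, ofReal_norm]
  obtain ⟨-, h3⟩ := eLpNorm_fourier_two h1 h2
  -- Interpolation between the sup bound by `‖m‖₁` and Plancherel. The product `‖m‖₁^{1-θ} ‖m‖₂^θ`
  -- with `θ = 2/q` is then bounded coarsely by the sum.
  have h4 := eLpNorm_le_of_enorm_le (p := 2) (by norm_num) hq2 hq h1.2.ne (Eventually.of_forall hsup)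
  rw [h3] at h4
  have hθ : 0 ≤ (2 : ℝ≥0∞).toReal / q.toReal := by positivity
  have hθ1 : (2 : ℝ≥0∞).toReal / q.toReal ≤ 1 :=
    div_le_one_of_le₀ (ENNReal.toReal_mono hq hq2) ENNReal.toReal_nonneg
  have h5 : eLpNorm (𝓕 m) q volume ≤ eLpNorm m 1 volume + eLpNorm m 2 volume := by
    refine h4.trans ?_
    generalize (2 : ℝ≥0∞).toReal / q.toReal = θ at hθ hθ1
    set a := eLpNorm m 1 volume
    set b := eLpNorm m 2 volume
    calc a ^ (1 - θ) * b ^ θ ≤ (a + b) ^ (1 - θ) * (a + b) ^ θ := by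
          gcongr
          · exact le_self_add
          · exact le_add_self
      _ = a + b := by rw [← ENNReal.rpow_add_of_nonneg _ _ (by linarith) hθ]; simp
  exact ⟨⟨hcont.aestronglyMeasurable, h5.trans_lt (ENNReal.add_lt_top.2 ⟨h1.2, h2.2⟩)⟩, h5⟩

end FourierL2

/-! ### Homogeneous multipliers of order one -/

/-- Symbols of real, odd homogeneous multipliers of order one, smooth away from the origin. -/
structure IsDerivSymbol (σ : R3 → ℂ) : Prop where
  contDiffAt : ∀ η, η ≠ 0 → ContDiffAt ℝ ∞ σ η
  hom : ∀ t : ℝ, 0 < t → ∀ η, σ (t • η) = t * σ η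
  odd : ∀ η, σ (-η) = -σ η
  conj : ∀ η, starRingEnd ℂ (σ η) = σ (-η)

namespace IsDerivSymbol

variable {σ : R3 → ℂ} (hσ : IsDerivSymbol σ)

include hσ in
theorem zero : σ 0 = 0 := by
  have h := hσ.odd 0
  rw [neg_zero] at h
  exact self_eq_neg.1 h

-- By homogeneity only the unit sphere matters; it is compact and `σ` is continuous on it.
include hσ in
theorem exists_bound : ∃ A : ℝ≥0, ∀ η, ‖σ η‖ ≤ A * ‖η‖ := by
  have hc : ContinuousOn σ (Metric.sphere 0 1) := fun η hη =>
    (hσ.contDiffAt η (by rintro rfl; simp at hη)).continuousAt.continuousWithinAt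
  obtain ⟨A, hA⟩ := (isCompact_sphere (0 : R3) 1).exists_bound_of_continuousOn hc
  refine ⟨A.toNNReal, fun η => ?_⟩
  rcases eq_or_ne η 0 with rfl | h
  · simp [hσ.zero]
  have hn : 0 < ‖η‖ := norm_pos_iff.2 h
  have h1 := hA (‖η‖⁻¹ • η) (by simp [norm_smul, hn.ne'])
  rw [hσ.hom _ (by positivity), norm_mul, Complex.norm_real, norm_inv, norm_norm,
    inv_mul_le_iff₀ hn] at h1
  rw [mul_comm] at h1
  exact h1.trans (by gcongr; exact Real.le_coe_toNNReal A)

include hσ in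
theorem measurable : Measurable σ := by
  refine measurable_of_continuousOn_compl_singleton 0 fun η hη => ?_
  exact (hσ.contDiffAt η hη).continuousAt.continuousWithinAt

end IsDerivSymbol

/-- The `L¹` and `L²` norms are continuous on Schwartz space, so this bound gives continuity at
zero, hence everywhere by linearity. -/
theorem continuous_of_enorm_le {V : Type*} [NormedAddCommGroup V] [NormedSpace ℂ V]
    (T : 𝓢(R3, ℂ) →ₗ[ℂ] V) {L : 𝓢(R3, ℂ) →L[ℂ] 𝓢(R3, ℂ)} {A : ℝ≥0}
    (h : ∀ φ, ‖T φ‖ₑ ≤ A * (eLpNorm (L φ) 1 volume + eLpNorm (L φ) 2 volume)) : Continuous T := by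
  refine continuous_of_continuousAt_zero T ?_
  rw [ContinuousAt, map_zero, tendsto_zero_iff_enorm_tendsto_zero]
  have hr : ∀ r : ℝ≥0∞, [Fact (1 ≤ r)] →
      Tendsto (fun φ : 𝓢(R3, ℂ) => eLpNorm (L φ) r (volume : Measure R3)) (𝓝 0) (𝓝 0) := by
    intro r _
    have h1 : Continuous fun φ : 𝓢(R3, ℂ) => ‖SchwartzMap.toLpCLM ℂ ℂ r volume (L φ)‖ₑ :=
      continuous_enorm.comp ((SchwartzMap.toLpCLM ℂ ℂ r volume).continuous.comp L.continuous)
    have h2 := h1.tendsto 0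
    rw [map_zero, map_zero, enorm_zero] at h2
    refine h2.congr fun φ => ?_
    rw [Lp.enorm_def]
    exact eLpNorm_congr_ae ((L φ).coeFn_toLp r volume)
  have h3 := ENNReal.Tendsto.const_mul ((hr 1).add (hr 2)) (Or.inr (ENNReal.coe_ne_top (r := A)))
  rw [add_zero, mul_zero] at h3
  exact tendsto_of_tendsto_of_tendsto_of_le_of_le tendsto_const_nhds h3 (fun _ => zero_le) h

/-- The weight `1 + ‖η‖²` as a map of Schwartz functions. -/
def weightCLM : 𝓢(R3, ℂ) →L[ℂ] 𝓢(R3, ℂ) :=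
  SchwartzMap.smulLeftCLM ℂ (fun η : R3 => ((1 + ‖η‖ ^ 2 : ℝ) : ℂ))

theorem weightCLM_apply (φ : 𝓢(R3, ℂ)) (η : R3) :
    weightCLM φ η = ((1 + ‖η‖ ^ 2 : ℝ) : ℂ) * φ η := by
  rw [weightCLM, SchwartzMap.smulLeftCLM_apply_apply, smul_eq_mul]
  have : (fun η : R3 => ((1 + ‖η‖ ^ 2 : ℝ) : ℂ)).HasTemperateGrowth := by fun_prop
  exact this

namespace IsDerivSymbol

variable {σ : R3 → ℂ} (hσ : IsDerivSymbol σ)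

-- The weight `1 + ‖η‖²` majorises `‖η‖` and, unlike it, is smooth, so that the majorant is again a
-- Schwartz function.
include hσ in
theorem exists_eLpNorm_mul_le : ∃ A : ℝ≥0, ∀ (r : ℝ≥0∞) (φ : 𝓢(R3, ℂ)),
    MemLp (fun η => σ η * φ η) r volume ∧
      eLpNorm (fun η => σ η * φ η) r volume ≤ A * eLpNorm (weightCLM φ) r volume := by
  obtain ⟨A, hA⟩ := hσ.exists_bound
  have hb : ∀ (φ : 𝓢(R3, ℂ)) η, ‖σ η * φ η‖ ≤ A * ‖weightCLM φ η‖ := fun φ η => by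
    rw [weightCLM_apply, norm_mul, norm_mul, ← mul_assoc, Complex.norm_real,
      Real.norm_of_nonneg (by positivity)]
    gcongr
    refine (hA η).trans ?_
    gcongr
    nlinarith [sq_nonneg (‖η‖ - 1), sq_nonneg ‖η‖]
  refine ⟨A, fun r φ => ?_⟩
  have hm : AEStronglyMeasurable (fun η => σ η * φ η) volume :=
    (hσ.measurable.mul φ.continuous.measurable).aestronglyMeasurable
  refine ⟨MemLp.of_le_mul ((weightCLM φ).memLp r volume) hm (Eventually.of_forall (hb φ)), ?_⟩
  have h := eLpNorm_le_nnreal_smul_eLpNorm_of_ae_le_mul (c := A) (p := r) (μ := volume)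
    (f := fun η => σ η * φ η) (g := weightCLM φ) (Eventually.of_forall (hb φ))
  simpa [ENNReal.smul_def] using h

-- This replaces Calderón–Zygmund theory. The product `σ φ` need not be smooth at the origin, so its
-- transform need not be Schwartz, but it lies in `L^q` and can be paired with `L^p` fields for the
-- conjugate `p`.
include hσ in
theorem memLp_fourier {q : ℝ≥0∞} (hq2 : 2 ≤ q) (hq : q ≠ ⊤) (φ : 𝓢(R3, ℂ)) :
    MemLp (𝓕 fun η => σ η * φ η) q volume := by
  obtain ⟨A, hA⟩ := hσ.exists_eLpNorm_mul_le
  exact (eLpNorm_fourier_le hq2 hq (hA 1 φ).1 (hA 2 φ).1).1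

/-- `φ ↦ 𝓕 (σ φ)` as a linear map from Schwartz functions to `L^q`. -/
def fourierMulₗ (q : ℝ≥0∞) (hq2 : 2 ≤ q) (hq : q ≠ ⊤) :
    𝓢(R3, ℂ) →ₗ[ℂ] Lp ℂ q (volume : Measure R3) where
  toFun φ := (hσ.memLp_fourier hq2 hq φ).toLp
  map_add' φ ψ := by
    obtain ⟨A, hA⟩ := hσ.exists_eLpNorm_mul_le
    rw [← MemLp.toLp_add]
    refine MemLp.toLp_congr _ _ (Eventually.of_forall fun x => ?_)
    have h : (fun η => σ η * (φ + ψ) η) = (fun η => σ η * φ η) + fun η => σ η * ψ η := by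
      ext η; simp [mul_add]
    beta_reduce
    rw [h]
    exact congrFun (VectorFourier.fourierIntegral_add Real.continuous_fourierChar
      (by exact continuous_inner) (memLp_one_iff_integrable.1 (hA 1 φ).1)
      (memLp_one_iff_integrable.1 (hA 1 ψ).1)) x
  map_smul' c φ := by
    rw [RingHom.id_apply, ← MemLp.toLp_const_smul]
    refine MemLp.toLp_congr _ _ (Eventually.of_forall fun x => ?_)
    have h : (fun η => σ η * (c • φ) η) = c • fun η => σ η * φ η := by
      ext η; simp [mul_left_comm]
    beta_reduce
    rw [h]
    exact congrFun (VectorFourier.fourierIntegral_const_smul _ _ _ _ c) x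

/-- `φ ↦ 𝓕 (σ φ)` as a map from Schwartz functions to `L^q`. -/
def fourierMulCLM (q : ℝ≥0∞) [Fact (1 ≤ q)] (hq2 : 2 ≤ q) (hq : q ≠ ⊤) :
    𝓢(R3, ℂ) →L[ℂ] Lp ℂ q (volume : Measure R3) :=
  ⟨hσ.fourierMulₗ q hq2 hq, by
    obtain ⟨A, hA⟩ := hσ.exists_eLpNorm_mul_le
    refine continuous_of_enorm_le (L := weightCLM) (A := A) _ fun φ => ?_
    have h := (eLpNorm_fourier_le hq2 hq (hA 1 φ).1 (hA 2 φ).1).2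
    refine (le_of_eq (Lp.enorm_toLp (hσ.memLp_fourier hq2 hq φ))).trans (h.trans ?_)
    rw [mul_add]
    gcongr
    · exact (hA 1 φ).2
    · exact (hA 2 φ).2⟩

theorem coeFn_fourierMulCLM (q : ℝ≥0∞) [Fact (1 ≤ q)] (hq2 : 2 ≤ q) (hq : q ≠ ⊤) (φ : 𝓢(R3, ℂ)) :
    hσ.fourierMulCLM q hq2 hq φ =ᵐ[volume] 𝓕 fun η => σ η * φ η :=
  (hσ.memLp_fourier hq2 hq φ).coeFn_toLp

section

variable {p q : ℝ≥0∞} [Fact (1 ≤ p)] [Fact (1 ≤ q)] [ENNReal.HolderConjugate p q]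

/-- The homogeneous multiplier with symbol `σ` on `L^p`, `1 < p ≤ 2`. -/
def hmul (hq2 : 2 ≤ q) (hq : q ≠ ⊤) : Lp C3 p (volume : Measure R3) →ₗ[ℂ] VField where
  toFun f := ContinuousLinearMap.toPointwiseConvergenceCLM _ _ _ _ <|
    (ContinuousLinearMap.lsmul ℂ ℂ).flip.lpPairing volume p q f ∘L
      hσ.fourierMulCLM q hq2 hq ∘L FourierTransform.fourierInvCLM ℂ 𝓢(R3, ℂ)
  map_add' f g := by
    ext1 φ
    simp
    rfl
  map_smul' c f := by
    ext1 φ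
    simp

/-- The multiplier is moved onto the test function, where it acts as `𝓕 σ 𝓕⁻`, the same convention
as for smooth symbols. This makes `Mul_hmul` a comparison of integrands. -/
theorem hmul_apply (hq2 : 2 ≤ q) (hq : q ≠ ⊤) (f : Lp C3 p (volume : Measure R3)) (φ : 𝓢(R3, ℂ)) :
    hσ.hmul hq2 hq f φ = ∫ x, (𝓕 fun η => σ η * (𝓕⁻ φ : 𝓢(R3, ℂ)) η) x • f x := by
  have h : hσ.hmul hq2 hq f φ = (ContinuousLinearMap.lsmul ℂ ℂ).flip.lpPairing volume p q f
    (hσ.fourierMulCLM q hq2 hq (𝓕⁻ φ)) := rfl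
  rw [h, ContinuousLinearMap.lpPairing_eq_integral]
  refine integral_congr_ae ?_
  filter_upwards [hσ.coeFn_fourierMulCLM q hq2 hq (𝓕⁻ φ)] with x hx
  simp [hx]

theorem Mul_hmul_apply (hq2 : 2 ≤ q) (hq : q ≠ ⊤) (f : Lp C3 p (volume : Measure R3))
    {b : R3 → ℂ} (hb : b.HasTemperateGrowth) (φ : 𝓢(R3, ℂ)) :
    Mul b (hσ.hmul hq2 hq f) φ = ∫ x, (𝓕 fun η => σ η * b η * (𝓕⁻ φ : 𝓢(R3, ℂ)) η) x • f x := by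
  rw [TemperedDistribution.fourierMultiplierCLM_apply_apply, hmul_apply,
    FourierTransform.fourierInv_fourier_eq]
  simp only [SchwartzMap.smulLeftCLM_apply_apply hb, smul_eq_mul, mul_assoc]

/-- Away from the origin the homogeneous multiplier is an ordinary one. -/
theorem Mul_hmul (hq2 : 2 ≤ q) (hq : q ≠ ⊤) (f : Lp C3 p (volume : Measure R3))
    {b c : R3 → ℂ} (hb : b.HasTemperateGrowth) (hc : c.HasTemperateGrowth)
    (h : ∀ η, c η = σ η * b η) : Mul b (hσ.hmul hq2 hq f) = Mul c (emb p f) := by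
  ext1 φ
  rw [hσ.Mul_hmul_apply hq2 hq f hb, TemperedDistribution.fourierMultiplierCLM_apply_apply,
    emb_apply]
  refine integral_congr_ae (Eventually.of_forall fun x => ?_)
  beta_reduce
  rw [SchwartzMap.fourier_coe]
  refine congrArg (fun F : R3 → ℂ => (𝓕 F) x • f x) (funext fun η => ?_)
  rw [SchwartzMap.smulLeftCLM_apply_apply hc, h, smul_eq_mul]

end

end IsDerivSymbol

theorem enorm_integral_smul_le {p q : ℝ≥0∞} [ENNReal.HolderConjugate p q] {m : R3 → ℂ}
    {f : R3 → C3} (hm : AEStronglyMeasurable m volume) (hf : AEStronglyMeasurable f volume) :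
    ‖∫ x, m x • f x‖ₑ ≤ eLpNorm m q volume * eLpNorm f p volume := by
  have hqp : ENNReal.HolderTriple q p 1 := ENNReal.HolderTriple.symm
  refine (enorm_integral_le_lintegral_enorm _).trans ?_
  rw [← eLpNorm_one_eq_lintegral_enorm]
  exact eLpNorm_smul_le_mul_eLpNorm (p := q) (q := p) (r := 1) (φ := m) hf hm

namespace IsDerivSymbol

variable {σ : R3 → ℂ} (hσ : IsDerivSymbol σ)

-- As `a` vanishes near the origin, the possible singularity of `σ` there is cut out.
include hσ in
theorem exists_symbol_mul {a : 𝓢(R3, ℂ)} (hc : HasCompactSupport a) {r : ℝ} (hr : 0 < r)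
    (ha : ∀ η, ‖η‖ < r → a η = 0) : ∃ c : 𝓢(R3, ℂ), ∀ η, c η = σ η * a η := by
  have h1 : HasCompactSupport fun η => σ η * a η := hc.mul_left
  have h2 : ContDiff ℝ ∞ fun η => σ η * a η := by
    rw [contDiff_iff_contDiffAt]
    intro η
    rcases eq_or_ne η 0 with rfl | h
    · have : (fun η => σ η * a η) =ᶠ[𝓝 0] fun _ => 0 := by
        filter_upwards [Metric.ball_mem_nhds 0 hr] with η hη
        rw [ha η (by simpa using hη), mul_zero]
      exact contDiffAt_const.congr_of_eventuallyEq this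
    · exact (hσ.contDiffAt η h).mul (a.smooth ⊤).contDiffAt
  exact ⟨h1.toSchwartzMap h2, fun η => rfl⟩

section

variable {p q : ℝ≥0∞} [Fact (1 ≤ p)] [Fact (1 ≤ q)] [ENNReal.HolderConjugate p q]
variable (hq2 : 2 ≤ q) (hq : q ≠ ⊤)

/-- Homogeneity of degree one turns `σ(η) a(l⁻¹ η)` into `l (σ a)(l⁻¹ η)`. The factor `l` is the
cost of one derivative at frequency `l`. -/
theorem Mul_dil_hmul (f : Lp C3 p (volume : Measure R3)) {a c : 𝓢(R3, ℂ)}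
    (h : ∀ η, c η = σ η * a η) {l : ℝ} (hl : 0 < l) :
    Mul (dil l hl a) (hσ.hmul hq2 hq f) = (l : ℂ) • Mul (dil l hl c) (emb p f) := by
  rw [← Mul_smul_symbol (dil l hl c).hasTemperateGrowth]
  refine hσ.Mul_hmul hq2 hq f (dil l hl a).hasTemperateGrowth
    ((Function.HasTemperateGrowth.const (l : ℂ)).mul (dil l hl c).hasTemperateGrowth) fun η => ?_
  rw [Pi.smul_apply, dil_apply, dil_apply, h, hσ.hom _ (by positivity), smul_eq_mul]
  have : (l : ℂ) ≠ 0 := by exact_mod_cast hl.ne'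
  push_cast
  field_simp

/-- Blocks of homogeneous multipliers. -/
theorem exists_lpENorm_Mul_dil_hmul_le {r : ℝ≥0∞} (hr : 1 ≤ r) (hr' : r ≠ ⊤) {a : 𝓢(R3, ℂ)}
    (hc : HasCompactSupport a) {ρ : ℝ} (hρ : 0 < ρ) (ha : ∀ η, ‖η‖ < ρ → a η = 0) :
    ∃ C : ℝ≥0, ∀ (l : ℝ) (hl : 0 < l) (f : Lp C3 p (volume : Measure R3)),
      lpENorm r (Mul (dil l hl a) (hσ.hmul hq2 hq f)) ≤
        C * ENNReal.ofReal l * lpENorm r (emb p f) := by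
  obtain ⟨c, hcσ⟩ := hσ.exists_symbol_mul hc hρ ha
  obtain ⟨C, hC⟩ := exists_lpENorm_Mul_dil_le hr le_rfl hr' c
  refine ⟨C, fun l hl f => ?_⟩
  rw [hσ.Mul_dil_hmul hq2 hq f hcσ hl]
  refine (lpENorm_smul_le _ _ _).trans ?_
  have h := hC l hl (emb p f)
  simp only [sub_self, mul_zero, Real.rpow_zero, ENNReal.ofReal_one, mul_one] at h
  have h2 : ‖(l : ℂ)‖ₑ = ENNReal.ofReal l := by
    rw [← ofReal_norm, Complex.norm_real, Real.norm_of_nonneg hl.le]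
  rw [h2]
  calc _ ≤ ENNReal.ofReal l * (C * lpENorm r (emb p f)) := by gcongr
    _ = _ := by ring

/-- Low frequencies of homogeneous multipliers disappear. -/
theorem tendsto_Mul_dil_hmul (f : Lp C3 p (volume : Measure R3)) (a : 𝓢(R3, ℂ)) (φ : 𝓢(R3, ℂ)) :
    Tendsto (fun n : ℕ => Mul (dil ((1 / 2 : ℝ) ^ n) (by positivity) a) (hσ.hmul hq2 hq f) φ) atTop
      (𝓝 0) := by
  obtain ⟨A, hA⟩ := hσ.exists_bound
  set M : ℝ≥0 := A * (SchwartzMap.seminorm ℝ 1 0 a).toNNReal with hM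
  set ψ : 𝓢(R3, ℂ) := 𝓕⁻ φ with hψ
  -- With `η = 2^{-n} ξ` the symbol equals `2^{-n} σ(ξ) a(ξ)`, and `σ(ξ) a(ξ)` is bounded by `A sup
  -- ‖ξ‖ ‖a(ξ)‖ ≤ M`.
  have hb : ∀ (n : ℕ) η, ‖σ η * dil ((1 / 2 : ℝ) ^ n) (by positivity) a η * ψ η‖ ≤
      ((1 / 2) ^ n * M : ℝ≥0) * ‖ψ η‖ := by
    intro n η
    have hp : (0 : ℝ) < (1 / 2) ^ n := by positivity
    rw [norm_mul]
    gcongr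
    rw [dil_apply]
    set ξ := ((1 / 2 : ℝ) ^ n)⁻¹ • η with hξ
    have h1 : η = ((1 / 2 : ℝ) ^ n) • ξ := by rw [hξ, smul_inv_smul₀ hp.ne']
    rw [h1, hσ.hom _ hp, norm_mul, norm_mul, Complex.norm_real, Real.norm_of_nonneg hp.le, mul_assoc]
    push_cast
    gcongr
    calc ‖σ ξ‖ * ‖a ξ‖ ≤ A * ‖ξ‖ * ‖a ξ‖ := by gcongr; exact hA ξ
      _ = A * (‖ξ‖ * ‖a ξ‖) := by ring
      _ ≤ M := by
        rw [hM]
        push_cast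
        gcongr
        refine le_trans ?_ (Real.le_coe_toNNReal _)
        simpa using SchwartzMap.norm_pow_mul_le_seminorm ℝ a 1 ξ
  have hmeas : ∀ n : ℕ, AEStronglyMeasurable
      (fun η => σ η * dil ((1 / 2 : ℝ) ^ n) (by positivity) a η * ψ η) volume := fun n =>
    ((hσ.measurable.mul (dil ((1 / 2 : ℝ) ^ n) (by positivity) a).continuous.measurable).mul
      ψ.continuous.measurable).aestronglyMeasurable
  have hmem : ∀ (n : ℕ) (s : ℝ≥0∞), MemLp
      (fun η => σ η * dil ((1 / 2 : ℝ) ^ n) (by positivity) a η * ψ η) s volume := fun n s =>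
    MemLp.of_le_mul (ψ.memLp s volume) (hmeas n) (Eventually.of_forall (hb n))
  have hle : ∀ (n : ℕ) (s : ℝ≥0∞), eLpNorm
      (fun η => σ η * dil ((1 / 2 : ℝ) ^ n) (by positivity) a η * ψ η) s volume ≤
      ((1 / 2) ^ n * M : ℝ≥0) * eLpNorm ψ s volume := fun n s => by
    have h := eLpNorm_le_nnreal_smul_eLpNorm_of_ae_le_mul (p := s) (μ := volume)
      (Eventually.of_forall (hb n))
    simpa [ENNReal.smul_def] using h
  set K : ℝ≥0∞ := (eLpNorm ψ 1 volume + eLpNorm ψ 2 volume) * eLpNorm f p volume with hK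
  have hKt : K ≠ ⊤ := ENNReal.mul_ne_top (ENNReal.add_ne_top.2 ⟨(ψ.memLp 1 volume).2.ne,
    (ψ.memLp 2 volume).2.ne⟩) (Lp.memLp f).2.ne
  have hbound : ∀ n : ℕ, ‖Mul (dil ((1 / 2 : ℝ) ^ n) (by positivity) a) (hσ.hmul hq2 hq f) φ‖ₑ ≤
      ((1 / 2 : ℝ≥0) ^ n : ℝ≥0) * (M * K) := by
    intro n
    rw [hσ.Mul_hmul_apply hq2 hq f (SchwartzMap.hasTemperateGrowth _)]
    have h1 := eLpNorm_fourier_le hq2 hq (hmem n 1) (hmem n 2)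
    refine (enorm_integral_smul_le (p := p) (q := q) h1.1.1 (Lp.memLp f).1).trans ?_
    calc _ ≤ (((1 / 2) ^ n * M : ℝ≥0) * eLpNorm ψ 1 volume +
          ((1 / 2) ^ n * M : ℝ≥0) * eLpNorm ψ 2 volume) * eLpNorm f p volume := by
          gcongr
          exact h1.2.trans (add_le_add (hle n 1) (hle n 2))
      _ = _ := by
          rw [hK]
          push_cast
          ring
  rw [tendsto_zero_iff_enorm_tendsto_zero]
  have hlim : Tendsto (fun n : ℕ => (((1 / 2 : ℝ≥0) ^ n : ℝ≥0) : ℝ≥0∞) * (M * K)) atTop (𝓝 0) := by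
    have h0 : Tendsto (fun n : ℕ => (((1 / 2 : ℝ≥0) ^ n : ℝ≥0) : ℝ≥0∞)) atTop (𝓝 0) := by
      rw [← ENNReal.coe_zero, ENNReal.tendsto_coe]
      exact tendsto_pow_atTop_nhds_zero_of_lt_one (by positivity) (by
        rw [div_lt_one (by norm_num)]; norm_num)
    simpa using ENNReal.Tendsto.mul_const h0
      (Or.inr (ENNReal.mul_ne_top (ENNReal.coe_ne_top (r := M)) hKt))
  exact tendsto_of_tendsto_of_tendsto_of_le_of_le tendsto_const_nhds hlim (fun _ => zero_le) hbound

end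

end IsDerivSymbol

/-! ### Homogeneous multipliers on Littlewood-Paley blocks -/

theorem hasCompactSupport_dil {a : 𝓢(R3, ℂ)} (ha : HasCompactSupport a) {l : ℝ} (hl : 0 < l) :
    HasCompactSupport (dil l hl a) := by
  have h : (dil l hl a : R3 → ℂ) = a ∘ Homeomorph.smulOfNeZero l⁻¹ (by positivity) := by
    ext η; simp [dil_apply]
  rw [h]
  exact ha.comp_homeomorph _

namespace IsLPCutoff

variable {χ : R3 → ℝ} (hχ : IsLPCutoff χ)

theorem hasCompactSupport_annSym : HasCompactSupport hχ.annSym :=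
  (hasCompactSupport_dil hχ.hasCompactSupport_lowSym two_pos).sub hχ.hasCompactSupport_lowSym

theorem annSym_eq_zero {η : R3} (h : ‖η‖ < 1 / (4 * Real.pi)) : hχ.annSym η = 0 := by
  have h1 : hχ.annSym η = hχ.dSym 1 η := by
    simp [dSym, dil_apply]
  rw [h1, hχ.dSym_eq_zero_of_ge]
  rw [lt_div_iff₀ (by positivity)] at h
  norm_num
  linarith

/-- Homogeneous multipliers of order one on Littlewood-Paley blocks. -/
theorem exists_lpENorm_D_hmul_le {σ : R3 → ℂ} (hσ : IsDerivSymbol σ) {p q : ℝ≥0∞} [Fact (1 ≤ p)]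
    [Fact (1 ≤ q)] [ENNReal.HolderConjugate p q] (hq2 : 2 ≤ q) (hq : q ≠ ⊤)
    {r : ℝ≥0∞} (hr : 1 ≤ r) (hr' : r ≠ ⊤) :
    ∃ C : ℝ≥0, ∀ (n : ℕ) (f : Lp C3 p (volume : Measure R3)),
      lpENorm r (hχ.D n (hσ.hmul hq2 hq f)) ≤ C * 2 ^ n * lpENorm r (emb p f) := by
  have : Fact (1 ≤ r) := ⟨hr⟩
  obtain ⟨C, hC⟩ := hσ.exists_lpENorm_Mul_dil_hmul_le (p := p) hq2 hq hr hr'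
    hχ.hasCompactSupport_annSym (by positivity) (fun η => hχ.annSym_eq_zero)
  refine ⟨C, fun n f => ?_⟩
  cases n with
  | succ n =>
    refine (hC (2 ^ n) (by positivity) f).trans ?_
    gcongr
    rw [ENNReal.ofReal_pow (by norm_num), pow_succ]
    simp only [ENNReal.ofReal_ofNat]
    exact le_mul_of_one_le_right (zero_le) (by norm_num)
  | zero =>
    -- The low block reaches the origin, where `σ` may be singular. It is cut into annuli at
    -- frequencies `2^{-n}`: each costs only `2^{-n}`, so the norms are summable, and the remaining
    -- ball contributes nothing in the weak limit.
    set U : ℕ → VField := fun n =>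
      Mul (dil ((1 / 2 : ℝ) ^ (n + 1)) (by positivity) hχ.annSym) (hσ.hmul hq2 hq f) with hU
    have hsum : ∀ n, ∑ i ∈ Finset.range n, U i = hχ.D 0 (hσ.hmul hq2 hq f) -
        Mul (dil ((1 / 2 : ℝ) ^ n) (by positivity) hχ.lowSym) (hσ.hmul hq2 hq f) := by
      intro n
      induction n with
      | zero =>
        have : (dil ((1 / 2 : ℝ) ^ 0) (by positivity) hχ.lowSym : R3 → ℂ) = hχ.dSym 0 := by
          ext η; simp [dil_apply, dSym]
        rw [Finset.sum_range_zero, this, D, sub_self]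
      | succ n ih =>
        have h : (dil ((1 / 2 : ℝ) ^ (n + 1)) (by positivity) hχ.annSym : R3 → ℂ) =
            dil ((1 / 2 : ℝ) ^ n) (by positivity) hχ.lowSym -
            dil ((1 / 2 : ℝ) ^ (n + 1)) (by positivity) hχ.lowSym := by
          ext η
          simp only [dil_apply, annSym, sub_apply, Pi.sub_apply, smul_smul]
          congr 3
          rw [pow_succ]
          field_simp
        rw [Finset.sum_range_succ, ih, hU]
        beta_reduce
        rw [h, Mul_sub_symbol (SchwartzMap.hasTemperateGrowth _)
          (SchwartzMap.hasTemperateGrowth _)]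
        abel
    have hweak : ∀ φ : 𝓢(R3, ℂ), Tendsto (fun n => (∑ i ∈ Finset.range n, U i) φ) atTop
        (𝓝 (hχ.D 0 (hσ.hmul hq2 hq f) φ)) := by
      intro φ
      have h1 := (hσ.tendsto_Mul_dil_hmul hq2 hq f hχ.lowSym φ).const_sub
        (hχ.D 0 (hσ.hmul hq2 hq f) φ)
      rw [sub_zero] at h1
      refine h1.congr fun n => ?_
      rw [hsum]
      rfl
    refine (lpENorm_le_tsum hweak).trans ?_
    calc ∑' i, lpENorm r (U i) ≤ ∑' i : ℕ, (2⁻¹ : ℝ≥0∞) ^ (i + 1) * (C * lpENorm r (emb p f)) := by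
          refine ENNReal.tsum_le_tsum fun i => (hC _ _ f).trans (le_of_eq ?_)
          rw [ENNReal.ofReal_pow (by norm_num), one_div, ENNReal.ofReal_inv_of_pos (by norm_num)]
          simp only [ENNReal.ofReal_ofNat]
          ring
      _ = _ := by
          rw [ENNReal.tsum_mul_right]
          simp only [pow_succ]
          rw [ENNReal.tsum_mul_right, ENNReal.tsum_geometric_two, ENNReal.mul_inv_cancel (by norm_num)
            (by norm_num)]
          simp

end IsLPCutoff

/-! ### Sequences in `ℓ²` -/

/-- The norm of `ℓ²`. -/
def lTwo (e : ℕ → ℝ≥0∞) : ℝ≥0∞ := (∑' n, e n ^ (2 : ℝ)) ^ (1 / 2 : ℝ)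

theorem lTwo_mono {a b : ℕ → ℝ≥0∞} (h : ∀ n, a n ≤ b n) : lTwo a ≤ lTwo b := by
  unfold lTwo
  gcongr with n
  exact h n

theorem lTwo_const_mul (c : ℝ≥0∞) (e : ℕ → ℝ≥0∞) : lTwo (fun n => c * e n) = c * lTwo e := by
  unfold lTwo
  simp_rw [ENNReal.mul_rpow_of_nonneg _ _ (by norm_num : (0 : ℝ) ≤ 2)]
  rw [ENNReal.tsum_mul_left, ENNReal.mul_rpow_of_nonneg _ _ (by norm_num), ← ENNReal.rpow_mul]
  norm_num

theorem lTwo_rpow_two (e : ℕ → ℝ≥0∞) : lTwo e ^ (2 : ℝ) = ∑' n, e n ^ (2 : ℝ) := by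
  rw [lTwo, ← ENNReal.rpow_mul]
  norm_num

theorem le_lTwo (e : ℕ → ℝ≥0∞) (n : ℕ) : e n ≤ lTwo e := by
  rw [← ENNReal.rpow_le_rpow_iff (by norm_num : (0 : ℝ) < 2), lTwo_rpow_two]
  exact ENNReal.le_tsum n

theorem lTwo_le_zero_add (e : ℕ → ℝ≥0∞) : lTwo e ≤ e 0 + lTwo fun n => e (n + 1) := by
  unfold lTwo
  rw [tsum_eq_zero_add' ENNReal.summable]
  refine (ENNReal.rpow_add_le_add_rpow _ _ (by norm_num) (by norm_num)).trans (le_of_eq ?_)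
  rw [← ENNReal.rpow_mul]
  norm_num

theorem lTwo_succ_le (e : ℕ → ℝ≥0∞) : (lTwo fun n => e (n + 1)) ≤ lTwo e := by
  exact ENNReal.rpow_le_rpow (ENNReal.tsum_comp_le_tsum_of_injective (add_left_injective 1)
    fun n => e n ^ (2 : ℝ)) (by norm_num)

theorem lTwo_add_le (a b : ℕ → ℝ≥0∞) : lTwo (fun n => a n + b n) ≤ lTwo a + lTwo b := by
  unfold lTwo
  have h := ENNReal.lintegral_Lp_add_le (μ := Measure.count) (f := a) (g := b) (p := 2)
    (by measurability) (by measurability) (by norm_num)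
  simpa only [lintegral_count, Pi.add_apply] using h

theorem tsum_mul_le_lTwo (a b : ℕ → ℝ≥0∞) : ∑' n, a n * b n ≤ lTwo a * lTwo b := by
  unfold lTwo
  have h := ENNReal.lintegral_mul_le_Lp_mul_Lq (μ := Measure.count) (f := a) (g := b) (p := 2)
    (q := 2) (by rw [Real.holderConjugate_iff]; norm_num) (by measurability) (by measurability)
  simpa only [lintegral_count, Pi.mul_apply] using h

/-- The sum of a geometric series over all distances from a point. -/
theorem tsum_pow_dist_le (θ : ℝ≥0∞) (m : ℕ) : ∑' n, θ ^ Nat.dist m n ≤ 2 * (1 - θ)⁻¹ := by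
  have h : ∀ n, θ ^ Nat.dist m n ≤
      (if n ≤ m then θ ^ (m - n) else 0) + (if m ≤ n then θ ^ (n - m) else 0) := fun n => by
    rcases le_total n m with h | h
    · rw [Nat.dist_eq_sub_of_le_right h, if_pos h]; exact le_self_add
    · rw [Nat.dist_eq_sub_of_le h, if_pos h]; exact le_add_self
  refine (ENNReal.tsum_le_tsum h).trans ?_
  rw [ENNReal.tsum_add, two_mul, ← ENNReal.tsum_geometric]
  refine add_le_add ?_ ?_
  · have h1 : ∑' n, (if n ≤ m then θ ^ (m - n) else 0) =
        ∑ n ∈ Finset.range (m + 1), θ ^ (m - n) := by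
      rw [tsum_eq_sum (s := Finset.range (m + 1))]
      · refine Finset.sum_congr rfl fun n hn => ?_
        rw [if_pos (by simpa [Nat.lt_succ_iff] using hn)]
      · intro n hn
        rw [if_neg (by simpa [Nat.lt_succ_iff] using hn)]
    rw [h1]
    have h2 := Finset.sum_range_reflect (fun n => θ ^ n) (m + 1)
    simp only [Nat.add_sub_cancel] at h2
    rw [h2]
    exact ENNReal.sum_le_tsum _
  · have h1 : ∀ n, n ∉ Set.range (fun k => k + m) → (if m ≤ n then θ ^ (n - m) else 0) = 0 := by
      intro n hn
      rw [if_neg]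
      intro h
      exact hn ⟨n - m, Nat.sub_add_cancel h⟩
    have h2 := (add_left_injective m).tsum_eq (f := fun n => if m ≤ n then θ ^ (n - m) else 0)
      (fun n hn => by
        by_contra hc
        exact hn (h1 n hc))
    rw [← h2]
    simp

/-- Convolution with a geometric kernel is bounded on `ℓ²`. -/
theorem lTwo_le_of_le_tsum_dist {θ : ℝ≥0∞} {c : ℝ≥0∞} {a e : ℕ → ℝ≥0∞}
    (h : ∀ m, a m ≤ c * ∑' n, θ ^ Nat.dist m n * e n) :
    lTwo a ≤ c * (2 * (1 - θ)⁻¹) * lTwo e := by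
  refine (lTwo_mono h).trans ?_
  rw [lTwo_const_mul, mul_assoc]
  gcongr
  set A := 2 * (1 - θ)⁻¹
  rw [← ENNReal.rpow_le_rpow_iff (by norm_num : (0 : ℝ) < 2), lTwo_rpow_two,
    ENNReal.mul_rpow_of_nonneg _ _ (by norm_num), lTwo_rpow_two]
  -- Schur's test: one square root of the kernel goes to each factor of Cauchy–Schwarz. The row sums
  -- are bounded here by `A`, the column sums after exchanging the summations.
  have h1 : ∀ m, (∑' n, θ ^ Nat.dist m n * e n) ^ (2 : ℝ) ≤
      A * ∑' n, θ ^ Nat.dist m n * e n ^ (2 : ℝ) := by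
    intro m
    have h2 := tsum_mul_le_lTwo (fun n => (θ ^ Nat.dist m n) ^ (1 / 2 : ℝ))
      (fun n => (θ ^ Nat.dist m n) ^ (1 / 2 : ℝ) * e n)
    have h3 : ∀ x : ℝ≥0∞, x ^ (1 / 2 : ℝ) * x ^ (1 / 2 : ℝ) = x := fun x => by
      rw [← ENNReal.rpow_add_of_nonneg _ _ (by norm_num) (by norm_num)]
      norm_num
    have h4 : ∀ x : ℝ≥0∞, (x ^ (1 / 2 : ℝ)) ^ (2 : ℝ) = x := fun x => by
      rw [← ENNReal.rpow_mul]
      norm_num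
    simp_rw [← mul_assoc, h3] at h2
    calc _ ≤ (lTwo _ * lTwo _) ^ (2 : ℝ) := by gcongr
      _ = (∑' n, θ ^ Nat.dist m n) * ∑' n, θ ^ Nat.dist m n * e n ^ (2 : ℝ) := by
        rw [ENNReal.mul_rpow_of_nonneg _ _ (by norm_num), lTwo_rpow_two, lTwo_rpow_two]
        simp_rw [ENNReal.mul_rpow_of_nonneg _ _ (by norm_num : (0 : ℝ) ≤ 2), h4]
      _ ≤ _ := by
        gcongr
        exact tsum_pow_dist_le θ m
  calc _ ≤ ∑' m, A * ∑' n, θ ^ Nat.dist m n * e n ^ (2 : ℝ) := ENNReal.tsum_le_tsum h1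
    _ = A * ∑' n, (∑' m, θ ^ Nat.dist n m) * e n ^ (2 : ℝ) := by
      rw [ENNReal.tsum_mul_left, ENNReal.tsum_comm]
      simp_rw [ENNReal.tsum_mul_right, Nat.dist_comm]
    _ ≤ A * ∑' n, A * e n ^ (2 : ℝ) := by
      gcongr with n
      exact tsum_pow_dist_le θ n
    _ = _ := by
      rw [ENNReal.tsum_mul_left, ← mul_assoc, ENNReal.rpow_two, sq]

/-- The row `m = 0` of the geometric convolution. -/
theorem tsum_pow_mul_le_lTwo (θ : ℝ≥0∞) (e : ℕ → ℝ≥0∞) :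
    ∑' n, θ ^ n * e n ≤ 2 * (1 - θ)⁻¹ * lTwo e := by
  have h := lTwo_le_of_le_tsum_dist (θ := θ) (c := 1) (e := e)
    (a := fun m => ∑' n, θ ^ Nat.dist m n * e n) (fun m => by rw [one_mul])
  have h2 := (le_lTwo _ 0).trans h
  simpa [Nat.dist] using h2

/-! ### Littlewood-Paley description of Besov norms -/

theorem ofReal_two_rpow (x : ℝ) : ENNReal.ofReal ((2 : ℝ) ^ x) = (2 : ℝ≥0∞) ^ x := by
  rw [← ENNReal.ofReal_rpow_of_pos two_pos, ENNReal.ofReal_ofNat]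

theorem two_rpow_add (x y : ℝ) : (2 : ℝ≥0∞) ^ (x + y) = 2 ^ x * 2 ^ y :=
  ENNReal.rpow_add _ _ (by norm_num) (by norm_num)

theorem two_rpow_ne_top (x : ℝ) : (2 : ℝ≥0∞) ^ x ≠ ⊤ :=
  ofReal_two_rpow x ▸ ENNReal.ofReal_ne_top

theorem two_rpow_natCast_mul (n : ℕ) (x : ℝ) : (2 : ℝ≥0∞) ^ ((n : ℝ) * x) = (2 ^ x) ^ n := by
  rw [mul_comm, ENNReal.rpow_mul, ENNReal.rpow_natCast]

namespace IsLPCutoff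

variable {χ : R3 → ℝ} (hχ : IsLPCutoff χ)

/-- The weighted norms of the Littlewood-Paley blocks. -/
def coef (s : ℝ) (p : ℝ≥0∞) (u : VField) (n : ℕ) : ℝ≥0∞ :=
  (2 : ℝ≥0∞) ^ ((n : ℝ) * s) * lpENorm p (hχ.D n u)

theorem coef_succ (s : ℝ) (p : ℝ≥0∞) (u : VField) (n : ℕ) : hχ.coef s p u (n + 1) =
    2 ^ s * (ENNReal.ofReal ((2 : ℝ) ^ ((n : ℝ) * s)) * lpENorm p (block χ n u)) := by
  rw [coef, block_eq hχ, ofReal_two_rpow, ← mul_assoc, ← two_rpow_add]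
  congr 2
  push_cast
  ring

theorem coef_zero (s : ℝ) (p : ℝ≥0∞) (u : VField) :
    hχ.coef s p u 0 = lpENorm p (lowBlock χ u) := by
  rw [coef, lowBlock_eq hχ]
  simp

/-- Since `D (n + 1) = Δ_n`, the renumbered weights differ from those of the Besov norm by `2^s`,
except for the low block. With `besovENorm_le` the two norms are equivalent, and the estimates can
be carried out for `lTwo (coef ..)`. -/
theorem lTwo_coef_le (s : ℝ) (p : ℝ≥0∞) (u : VField) :
    lTwo (hχ.coef s p u) ≤ (1 + 2 ^ s) * besovENorm χ s p 2 u := by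
  refine (lTwo_le_zero_add _).trans ?_
  simp_rw [coef_succ, coef_zero, lTwo_const_mul]
  rw [besovENorm, add_mul, one_mul]
  exact add_le_add le_self_add (mul_le_mul_right le_add_self _)

theorem besovENorm_le (s : ℝ) (p : ℝ≥0∞) (u : VField) :
    besovENorm χ s p 2 u ≤ (1 + 2 ^ (-s)) * lTwo (hχ.coef s p u) := by
  have h := lTwo_succ_le (hχ.coef s p u)
  simp_rw [coef_succ, lTwo_const_mul] at h
  rw [besovENorm, add_mul, one_mul]
  refine add_le_add ?_ ?_
  · rw [← hχ.coef_zero s]; exact le_lTwo _ 0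
  · refine le_trans (le_of_eq ?_) (mul_le_mul_right h _)
    rw [← mul_assoc, ← two_rpow_add, neg_add_cancel, ENNReal.rpow_zero, one_mul]
    rfl

end IsLPCutoff

theorem two_rpow_neg_lt_one {s : ℝ} (hs : 0 < s) : (2 : ℝ≥0∞) ^ (-s) < 1 :=
  ENNReal.rpow_lt_one_of_one_lt_of_neg (by norm_num) (by linarith)

theorem one_sub_inv_ne_top {θ : ℝ≥0∞} (h : θ < 1) : 2 * (1 - θ)⁻¹ ≠ ⊤ :=
  ENNReal.mul_ne_top (by norm_num) (ENNReal.inv_ne_top.2 (tsub_pos_of_lt h).ne')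

theorem holderTriple_of_toReal {p q r : ℝ≥0∞} (hp : p ≠ 0) (hq : q ≠ 0) (hr : r ≠ 0)
    (h : p.toReal⁻¹ + q.toReal⁻¹ = r.toReal⁻¹) : ENNReal.HolderTriple p q r := by
  refine ⟨?_⟩
  rw [← ENNReal.toReal_eq_toReal_iff' (by simp [hp, hq]) (by simpa using hr),
    ENNReal.toReal_add (by simpa using hp) (by simpa using hq)]
  simpa using h

instance : ENNReal.HolderTriple 9 3 (9 / 4) :=
  holderTriple_of_toReal (by simp) (by simp) (by simp) (by norm_num)

theorem IsLpFun.sum {p : ℝ≥0∞} (hp : 1 ≤ p) {u : ℕ → VField} {f : ℕ → R3 → C3}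
    (h : ∀ i, IsLpFun p (u i) (f i)) (s : Finset ℕ) :
    IsLpFun p (∑ i ∈ s, u i) (∑ i ∈ s, f i) := by
  classical
  induction s using Finset.induction_on with
  | empty =>
    refine ⟨by simp, fun φ => ?_⟩
    simp
  | insert a s ha ih =>
    rw [Finset.sum_insert ha, Finset.sum_insert ha]
    exact (h a).add hp ih

/-- From `|∑ f_i|² ≤ ∑∑ |f_i| |f_k|`. Expanding the square allows different Lebesgue exponents on
the two factors of each pair. -/
theorem eLpNorm_sum_rpow_two_le {p : ℝ≥0∞} (hp : 1 ≤ p) (f : ℕ → R3 → C3)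
    (hf : ∀ i, AEStronglyMeasurable (f i) volume) (s : Finset ℕ) :
    eLpNorm (∑ i ∈ s, f i) (p * 2) volume ^ (2 : ℝ) ≤
      ∑ i ∈ s, ∑ k ∈ s, eLpNorm (fun x => ‖f i x‖ • ‖f k x‖) p volume := by
  have h1 := eLpNorm_norm_rpow (p := p) (μ := volume) (∑ i ∈ s, f i) (q := 2) (by norm_num)
  rw [ENNReal.ofReal_ofNat] at h1
  rw [← h1]
  have hm : ∀ i k, AEStronglyMeasurable (fun x => ‖f i x‖ • ‖f k x‖) volume := fun i k =>
    (hf i).norm.smul (hf k).norm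
  calc _ ≤ eLpNorm (∑ i ∈ s, ∑ k ∈ s, fun x => ‖f i x‖ • ‖f k x‖) p volume := by
        refine eLpNorm_mono_real fun x => ?_
        rw [Real.norm_of_nonneg (by positivity), Real.rpow_two, Finset.sum_apply, sq]
        simp only [Finset.sum_apply, smul_eq_mul]
        rw [← Finset.sum_mul_sum]
        have := norm_sum_le s fun i => f i x
        gcongr
    _ ≤ ∑ i ∈ s, eLpNorm (∑ k ∈ s, fun x => ‖f i x‖ • ‖f k x‖) p volume :=
        eLpNorm_sum_le (fun i _ => Finset.aestronglyMeasurable_sum _ fun k _ => hm i k) hp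
    _ ≤ _ := Finset.sum_le_sum fun i _ => eLpNorm_sum_le (fun k _ => hm i k) hp

/-! ### Bernstein inequalities and embeddings of Besov spaces -/

namespace IsLPCutoff

variable {χ : R3 → ℝ} (hχ : IsLPCutoff χ)

theorem exists_lpENorm_S_le {p q : ℝ≥0∞} (hp : 1 ≤ p) (hpq : p ≤ q) (hq : q ≠ ⊤) {x : ℝ}
    (hx : 3 * (1 / p.toReal - 1 / q.toReal) = x) : ∃ C : ℝ≥0, ∀ n u,
      lpENorm q (hχ.S n u) ≤ C * 2 ^ ((n : ℝ) * x) * lpENorm p u := by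
  obtain ⟨C, hC⟩ := exists_lpENorm_Mul_dil_le hp hpq hq hχ.lowSym
  refine ⟨C, fun n u => (hC (2 ^ n) (by positivity) u).trans (le_of_eq ?_)⟩
  rw [hx, ← Real.rpow_natCast, ← Real.rpow_mul (by norm_num), ofReal_two_rpow]

theorem exists_lpENorm_S_le_self {p : ℝ≥0∞} (hp : 1 ≤ p) (hp' : p ≠ ⊤) : ∃ C : ℝ≥0, ∀ n u,
      lpENorm p (hχ.S n u) ≤ C * lpENorm p u := by
  obtain ⟨C, hC⟩ := hχ.exists_lpENorm_S_le hp le_rfl hp' (x := 0) (by simp)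
  exact ⟨C, fun n u => by simpa using hC n u⟩

theorem exists_lpENorm_D_le_self {p : ℝ≥0∞} (hp : 1 ≤ p) (hp' : p ≠ ⊤) : ∃ C : ℝ≥0, ∀ n u,
      lpENorm p (hχ.D n u) ≤ C * lpENorm p u := by
  obtain ⟨C, hC⟩ := hχ.exists_lpENorm_S_le_self hp hp'
  have hD : ∀ n u, hχ.D (n + 1) u = hχ.S (n + 1) u - hχ.S n u := fun n u => by
    rw [← sum_D, ← sum_D, Finset.sum_range_succ _ (n + 1)]
    abel
  refine ⟨2 * C, fun n u => ?_⟩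
  cases n with
  | zero =>
    have : hχ.D 0 u = hχ.S 0 u := by rw [← sum_D]; simp
    rw [this]
    refine (hC 0 u).trans ?_
    gcongr
    exact le_mul_of_one_le_left zero_le (by norm_num)
  | succ n =>
    rw [hD]
    refine (lpENorm_sub_le hp _ _).trans ((add_le_add (hC _ _) (hC _ _)).trans (le_of_eq ?_))
    push_cast
    ring

/-- Bernstein's inequality for Littlewood-Paley blocks. -/
theorem exists_lpENorm_D_le {p q : ℝ≥0∞} (hp : 1 ≤ p) (hpq : p ≤ q) (hq : q ≠ ⊤) {x : ℝ}
    (hx : 3 * (1 / p.toReal - 1 / q.toReal) = x) : ∃ C : ℝ≥0, ∀ n u,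
      lpENorm q (hχ.D n u) ≤ C * 2 ^ ((n : ℝ) * x) * lpENorm p (hχ.D n u) := by
  obtain ⟨C, hC⟩ := hχ.exists_lpENorm_S_le hp hpq hq hx
  refine ⟨C * ((2 : ℝ≥0∞) ^ x).toNNReal, fun n u => ?_⟩
  -- `S (n + 1)` leaves `D n u` unchanged, so its Bernstein bound applies. The shift from `n + 1` to
  -- `n` accounts for the factor `2^x` in the constant.
  have h := hC (n + 1) (hχ.D n u)
  rw [hχ.S_D n.lt_succ_self] at h
  refine h.trans (le_of_eq ?_)
  push_cast
  rw [ENNReal.coe_toNNReal (two_rpow_ne_top x), add_mul, two_rpow_add, one_mul]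
  ring

theorem exists_coef_le {p q : ℝ≥0∞} (hp : 1 ≤ p) (hpq : p ≤ q) (hq : q ≠ ⊤) {s t : ℝ}
    (hx : 3 * (1 / p.toReal - 1 / q.toReal) = s - t) : ∃ C : ℝ≥0, ∀ u n,
      hχ.coef t q u n ≤ C * hχ.coef s p u n := by
  obtain ⟨C, hC⟩ := hχ.exists_lpENorm_D_le hp hpq hq hx
  refine ⟨C, fun u n => ?_⟩
  calc hχ.coef t q u n ≤ 2 ^ ((n : ℝ) * t) *
        (C * 2 ^ ((n : ℝ) * (s - t)) * lpENorm p (hχ.D n u)) := by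
        rw [coef]; gcongr; exact hC n u
    _ = C * ((2 ^ ((n : ℝ) * t) * 2 ^ ((n : ℝ) * (s - t))) * lpENorm p (hχ.D n u)) := by ring
    _ = _ := by
        rw [← two_rpow_add, coef]
        congr 4
        ring

/-- Embeddings of Besov spaces. -/
theorem exists_lTwo_coef_le {p q : ℝ≥0∞} (hp : 1 ≤ p) (hpq : p ≤ q) (hq : q ≠ ⊤) {s t : ℝ}
    (hx : 3 * (1 / p.toReal - 1 / q.toReal) = s - t) : ∃ C : ℝ≥0, ∀ u,
      lTwo (hχ.coef t q u) ≤ C * lTwo (hχ.coef s p u) := by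
  obtain ⟨C, hC⟩ := hχ.exists_coef_le hp hpq hq hx
  exact ⟨C, fun u => by rw [← lTwo_const_mul]; exact lTwo_mono (hC u)⟩

theorem lpENorm_D_eq (s : ℝ) (p : ℝ≥0∞) (u : VField) (n : ℕ) :
    lpENorm p (hχ.D n u) = 2 ^ (-((n : ℝ) * s)) * hχ.coef s p u n := by
  rw [coef, ← mul_assoc, ← two_rpow_add, neg_add_cancel, ENNReal.rpow_zero, one_mul]

theorem lpENorm_D_lt_top {s : ℝ} {p : ℝ≥0∞} {u : VField} (h : lTwo (hχ.coef s p u) < ⊤) (n : ℕ) :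
    lpENorm p (hχ.D n u) < ⊤ := by
  rw [hχ.lpENorm_D_eq s]
  exact ENNReal.mul_lt_top (two_rpow_ne_top _).lt_top ((le_lTwo _ n).trans_lt h)

/-- Besov spaces of positive order consist of `L^p` functions. -/
theorem exists_lpENorm_le_lTwo {s : ℝ} (hs : 0 < s) {p : ℝ≥0∞} (hp : 1 ≤ p) :
    ∃ C : ℝ≥0, ∀ u, lpENorm p u ≤ C * lTwo (hχ.coef s p u) := by
  have : Fact (1 ≤ p) := ⟨hp⟩
  have hθ := one_sub_inv_ne_top (two_rpow_neg_lt_one hs)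
  refine ⟨(2 * (1 - (2 : ℝ≥0∞) ^ (-s))⁻¹).toNNReal, fun u => ?_⟩
  rw [ENNReal.coe_toNNReal hθ]
  refine (lpENorm_le_tsum (hχ.tendsto_sum_D_apply u)).trans ?_
  refine le_trans (le_of_eq ?_) (tsum_pow_mul_le_lTwo _ _)
  refine tsum_congr fun n => ?_
  rw [hχ.lpENorm_D_eq s, ← two_rpow_natCast_mul]
  congr 2
  ring

/-- The critical embedding of `B^{1/3}_{3,2}` in `L^{9/2}`, uniformly in the cut-off. Bernstein
leaves no decay for a single block in `L^{9/2}`, so the triangle inequality would require `ℓ¹`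
coefficients. In the expanded square the lower block is put in `L⁹` and the higher one in `L³`; each
pair then gains `2^{-|i-k|/3}`, and the geometric convolution bound closes the estimate in `ℓ²`. -/
theorem exists_lpENorm_S_le_lTwo : ∃ C : ℝ≥0, ∀ u, lTwo (hχ.coef (1 / 3) 3 u) < ⊤ → ∀ n,
    lpENorm (9 / 2) (hχ.S n u) ≤ C * lTwo (hχ.coef (1 / 3) 3 u) := by
  obtain ⟨C, hC⟩ := hχ.exists_lpENorm_D_le (p := 3) (q := 9) (x := 2 / 3) (by norm_num)
    (by norm_num) (by simp) (by norm_num)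
  set θ : ℝ≥0∞ := 2 ^ (-(1 / 3) : ℝ) with hθ
  have hθt := one_sub_inv_ne_top (two_rpow_neg_lt_one (s := 1 / 3) (by norm_num))
  rw [← hθ] at hθt
  have hKt : (C * (2 * (1 - θ)⁻¹)) ^ (1 / 2 : ℝ) ≠ ⊤ :=
    ENNReal.rpow_ne_top_of_nonneg (by norm_num) (ENNReal.mul_ne_top ENNReal.coe_ne_top hθt)
  refine ⟨((C * (2 * (1 - θ)⁻¹)) ^ (1 / 2 : ℝ)).toNNReal, fun u hu n => ?_⟩
  rw [ENNReal.coe_toNNReal hKt]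
  set c := hχ.coef (1 / 3) 3 u with hc
  choose f hf using fun i => exists_isLpFun (hχ.lpENorm_D_lt_top hu i)
  have hf9 : ∀ i, IsLpFun 9 (hχ.D i u) (f i) := fun i => by
    have h9 : lpENorm 9 (hχ.D i u) < ⊤ := (hC i u).trans_lt (ENNReal.mul_lt_top
      (ENNReal.mul_lt_top ENNReal.coe_lt_top (two_rpow_ne_top _).lt_top) (hχ.lpENorm_D_lt_top hu i))
    obtain ⟨g, hg⟩ := exists_isLpFun h9
    have := (hf i).ae_eq (by norm_num) (by norm_num) hg
    exact ⟨(memLp_congr_ae this).2 hg.1, (hf i).2⟩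
  have hpair : ∀ i k, i ≤ k → eLpNorm (fun x => ‖f i x‖ • ‖f k x‖) (9 / 4) volume ≤
      C * (θ ^ Nat.dist i k * (c i * c k)) := by
    intro i k hik
    refine (eLpNorm_smul_le_mul_eLpNorm (p := 9) (q := 3) (r := 9 / 4) (φ := fun x => ‖f i x‖)
      (f := fun x => ‖f k x‖) (hf k).1.1.norm (hf i).1.1.norm).trans ?_
    rw [eLpNorm_norm, eLpNorm_norm, ← lpENorm_eq_eLpNorm (by norm_num) (hf9 i),
      ← lpENorm_eq_eLpNorm (by norm_num) (hf k)]
    calc _ ≤ (C * 2 ^ ((i : ℝ) * (2 / 3)) * lpENorm 3 (hχ.D i u)) * lpENorm 3 (hχ.D k u) := by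
          gcongr; exact hC i u
      _ = _ := by
          rw [hχ.lpENorm_D_eq (1 / 3) 3 u i, hχ.lpENorm_D_eq (1 / 3) 3 u k, ← hc,
            Nat.dist_eq_sub_of_le hik, hθ, ← two_rpow_natCast_mul]
          -- Bernstein from `L³` to `L⁹` costs `2i/3`, the coefficients give `-i/3 - k/3`: in total
          -- `-(k - i)/3`.
          have : (2 : ℝ≥0∞) ^ (((k - i : ℕ) : ℝ) * -(1 / 3)) = 2 ^ ((i : ℝ) * (2 / 3)) *
              2 ^ (-((i : ℝ) * (1 / 3))) * 2 ^ (-((k : ℝ) * (1 / 3))) := by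
            rw [← two_rpow_add, ← two_rpow_add]
            congr 1
            push_cast [Nat.cast_sub hik]
            ring
          rw [this]
          ring
  have hpair' : ∀ i k, eLpNorm (fun x => ‖f i x‖ • ‖f k x‖) (9 / 4) volume ≤
      C * (θ ^ Nat.dist i k * (c i * c k)) := by
    intro i k
    rcases le_total i k with h | h
    · exact hpair i k h
    · have := hpair k i h
      simp only [smul_eq_mul] at this ⊢
      simp_rw [mul_comm ‖f i _‖]
      rwa [Nat.dist_comm, mul_comm (c i)]
  have hS : IsLpFun 3 (hχ.S n u) (∑ i ∈ Finset.range (n + 1), f i) := by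
    rw [← sum_D]
    exact IsLpFun.sum (by norm_num) hf _
  have h94 : (1 : ℝ≥0∞) ≤ 9 / 4 := by
    rw [ENNReal.le_div_iff_mul_le (by simp) (by simp)]; norm_num
  have h92 : (1 : ℝ≥0∞) ≤ 9 / 2 := by
    rw [ENNReal.le_div_iff_mul_le (by simp) (by simp)]; norm_num
  have e92 : (9 / 4 : ℝ≥0∞) * 2 = 9 / 2 := by
    rw [← ENNReal.toReal_eq_toReal_iff' (ENNReal.mul_ne_top (ENNReal.div_ne_top (by simp) (by simp))
      (by simp)) (ENNReal.div_ne_top (by simp) (by simp))]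
    norm_num
  have hsum : ∑ i ∈ Finset.range (n + 1), ∑ k ∈ Finset.range (n + 1),
      eLpNorm (fun x => ‖f i x‖ • ‖f k x‖) (9 / 4) volume ≤
      C * (2 * (1 - θ)⁻¹) * lTwo c ^ (2 : ℝ) := by
    calc _ ≤ ∑ i ∈ Finset.range (n + 1), ∑' k, C * (θ ^ Nat.dist i k * (c i * c k)) :=
          Finset.sum_le_sum fun i _ => (Finset.sum_le_sum fun k _ => hpair' i k).trans
            (ENNReal.sum_le_tsum _)
      _ ≤ ∑' i, ∑' k, C * (θ ^ Nat.dist i k * (c i * c k)) := ENNReal.sum_le_tsum _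
      _ = ∑' i, c i * (C * ∑' k, θ ^ Nat.dist i k * c k) := by
          refine tsum_congr fun i => ?_
          rw [← ENNReal.tsum_mul_left, ← ENNReal.tsum_mul_left]
          exact tsum_congr fun k => by ring
      _ ≤ lTwo c * lTwo fun i => C * ∑' k, θ ^ Nat.dist i k * c k := tsum_mul_le_lTwo _ _
      _ ≤ lTwo c * (C * (2 * (1 - θ)⁻¹) * lTwo c) := by
          gcongr
          exact lTwo_le_of_le_tsum_dist fun m => le_rfl
      _ = _ := by rw [ENNReal.rpow_two]; ring
  have hmain : eLpNorm (∑ i ∈ Finset.range (n + 1), f i) (9 / 2) volume ≤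
      (C * (2 * (1 - θ)⁻¹)) ^ (1 / 2 : ℝ) * lTwo c := by
    rw [← ENNReal.rpow_le_rpow_iff (by norm_num : (0 : ℝ) < 2),
      ENNReal.mul_rpow_of_nonneg _ _ (by norm_num), ← ENNReal.rpow_mul,
      show (1 / 2 * 2 : ℝ) = 1 by norm_num, ENNReal.rpow_one, ← e92]
    exact (eLpNorm_sum_rpow_two_le h94 f (fun i => (hf i).1.1) _).trans hsum
  have hS' : IsLpFun (9 / 2) (hχ.S n u) (∑ i ∈ Finset.range (n + 1), f i) :=
    ⟨⟨hS.1.1, hmain.trans_lt (ENNReal.mul_lt_top hKt.lt_top hu)⟩, hS.2⟩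
  rw [lpENorm_eq_eLpNorm h92 hS']
  exact hmain

end IsLPCutoff

/-! ### The symbols and the products in the advective term -/

/-- The real part of the symbol of `∂_j ℙ_{kl}`, up to `2 π i`. -/
def advReal (j k l : Fin 3) (η : R3) : ℝ :=
  η j * ((if k = l then 1 else 0) - η k * η l / ‖η‖ ^ 2)

/-- The symbol of `∂_j ℙ_{kl}`. -/
def advSym (j k l : Fin 3) (η : R3) : ℂ := (2 * Real.pi * Complex.I) * (advReal j k l η : ℂ)

theorem advReal_neg (j k l : Fin 3) (η : R3) : advReal j k l (-η) = -advReal j k l η := by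
  simp [advReal]

theorem advReal_smul (j k l : Fin 3) {t : ℝ} (ht : 0 < t) (η : R3) :
    advReal j k l (t • η) = t * advReal j k l η := by
  simp only [advReal, PiLp.smul_apply, smul_eq_mul, norm_smul, Real.norm_of_nonneg ht.le]
  have : t * η k * (t * η l) / (t * ‖η‖) ^ 2 = η k * η l / ‖η‖ ^ 2 := by
    rw [show t * η k * (t * η l) = t ^ 2 * (η k * η l) by ring, mul_pow,
      mul_div_mul_left _ _ (by positivity)]
  rw [this]
  ring

theorem isDerivSymbol_advSym (j k l : Fin 3) : IsDerivSymbol (advSym j k l) where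
  contDiffAt η hη := by
    have hc : ∀ i : Fin 3, ContDiffAt ℝ ∞ (fun η : R3 => η i) η := fun i => by fun_prop
    have hn : ContDiffAt ℝ ∞ (fun η : R3 => ‖η‖ ^ 2) η := (contDiff_norm_sq ℝ).contDiffAt
    have h1 : ContDiffAt ℝ ∞ (advReal j k l) η :=
      (hc j).mul (contDiffAt_const.sub (((hc k).mul (hc l)).div hn (by positivity)))
    exact contDiffAt_const.mul (Complex.ofRealCLM.contDiff.contDiffAt.comp η h1)
  hom t ht η := by
    rw [advSym, advSym, advReal_smul j k l ht]
    push_cast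
    ring
  odd η := by
    rw [advSym, advSym, advReal_neg]
    push_cast
    ring
  conj η := by
    rw [advSym, advSym, advReal_neg]
    simp only [map_mul, Complex.conj_I, Complex.conj_ofReal, map_ofNat]
    push_cast
    ring

/-- The bilinear map `(x, y) ↦ x_j y_k e_l` on `ℂ³`. -/
def bil (j k l : Fin 3) : C3 →L[ℂ] C3 →L[ℂ] C3 :=
  (((ContinuousLinearMap.lsmul ℂ ℂ).flip (EuclideanSpace.single l (1 : ℂ))).postcomp C3).comp
    ((ContinuousLinearMap.mul ℂ ℂ).bilinearComp (EuclideanSpace.proj j : C3 →L[ℂ] ℂ)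
    (EuclideanSpace.proj k : C3 →L[ℂ] ℂ))

theorem bil_apply (j k l : Fin 3) (x y : C3) :
    bil j k l x y = (x j * y k) • EuclideanSpace.single l (1 : ℂ) := by
  simp [bil]

/-- The product is formed once, in the exponents in which the fields are given, and may then be
measured in any other Hölder triple containing the factors. Here `3, 3, 3/2` serves to define it,
and `9/5` and `18/11` are among the exponents used to estimate it. -/
theorem lpENorm_emb_holder_le {p₀ q₀ r₀ p q r : ℝ≥0∞} [ENNReal.HolderTriple p₀ q₀ r₀]
    [ENNReal.HolderTriple p q r] [hp₀ : Fact (1 ≤ p₀)] [hq₀ : Fact (1 ≤ q₀)] [hr₀ : Fact (1 ≤ r₀)]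
    (hp : 1 ≤ p) (hq : 1 ≤ q) (hr : 1 ≤ r) (B : C3 →L[ℂ] C3 →L[ℂ] C3)
    (f : Lp C3 p₀ (volume : Measure R3)) (g : Lp C3 q₀ (volume : Measure R3))
    (hf : lpENorm p (emb p₀ f) < ⊤) (hg : lpENorm q (emb q₀ g) < ⊤) :
    lpENorm r (emb r₀ (B.holder r₀ f g)) ≤
      ‖B‖ₑ * (lpENorm p (emb p₀ f) * lpENorm q (emb q₀ g)) := by
  obtain ⟨f', hf'⟩ := exists_isLpFun hf
  obtain ⟨g', hg'⟩ := exists_isLpFun hg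
  have e1 := (isLpFun_emb f).ae_eq hp₀.out hp hf'
  have e2 := (isLpFun_emb g).ae_eq hq₀.out hq hg'
  have e3 : B.holder r₀ f g =ᵐ[volume] fun x => B (f' x) (g' x) := by
    filter_upwards [B.coeFn_holder (r := r₀) f g, e1, e2] with x h h1 h2
    rw [h, h1, h2]
  have hB : IsLpFun r (emb r₀ (B.holder r₀ f g)) fun x => B (f' x) (g' x) := by
    refine ⟨B.memLp_of_bilin r hf'.1 hg'.1, fun φ => ?_⟩
    rw [emb_apply]
    refine integral_congr_ae ?_
    filter_upwards [e3] with x hx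
    rw [hx]
  rw [lpENorm_eq_eLpNorm hr hB, lpENorm_eq_eLpNorm hp hf', lpENorm_eq_eLpNorm hq hg', ← mul_assoc]
  exact eLpNorm_le_eLpNorm_mul_eLpNorm_of_nnnorm hf'.1.1 hg'.1.1 (B · ·) ‖B‖₊
    (Eventually.of_forall fun _ => B.le_opNorm₂ _ _)

/-! ### Multipliers on `L^p` -/

section MulLp

variable {p : ℝ≥0∞} [hp : Fact (1 ≤ p)] (hp' : p ≠ ⊤)

include hp' in
theorem exists_emb_eq_Mul (a : 𝓢(R3, ℂ)) (f : Lp C3 p (volume : Measure R3)) :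
    ∃ g : Lp C3 p (volume : Measure R3), emb p g = Mul a (emb p f) := by
  obtain ⟨C, hC⟩ := exists_lpENorm_Mul_le hp.out hp' a
  exact exists_emb_eq ((hC _).trans_lt (ENNReal.mul_lt_top ENNReal.coe_lt_top
    ((isLpFun_emb f).lpENorm_lt_top hp.out)))

/-- Fourier multipliers with Schwartz symbols as operators on `L^p`. -/
def mulLp (a : 𝓢(R3, ℂ)) : Lp C3 p (volume : Measure R3) →ₗ[ℂ] Lp C3 p (volume : Measure R3) where
  toFun f := (exists_emb_eq_Mul hp' a f).choose
  map_add' f g := by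
    apply emb_injective
    refine (exists_emb_eq_Mul hp' a (f + g)).choose_spec.trans ?_
    rw [map_add, map_add, map_add]
    exact (congrArg₂ (· + ·) (exists_emb_eq_Mul hp' a f).choose_spec
      (exists_emb_eq_Mul hp' a g).choose_spec).symm
  map_smul' c f := by
    apply emb_injective
    refine (exists_emb_eq_Mul hp' a (c • f)).choose_spec.trans ?_
    rw [map_smul, map_smul, map_smul]
    exact (congrArg (c • ·) (exists_emb_eq_Mul hp' a f).choose_spec).symm

theorem emb_mulLp (a : 𝓢(R3, ℂ)) (f : Lp C3 p (volume : Measure R3)) :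
    emb p (mulLp hp' a f) = Mul a (emb p f) :=
  (exists_emb_eq_Mul hp' a f).choose_spec

end MulLp

/-- Needed to apply the multiplier term by term to a series converging in `L^p`. -/
theorem IsDerivSymbol.continuous_hmul_apply {σ : R3 → ℂ} (hσ : IsDerivSymbol σ) {p q : ℝ≥0∞}
    [Fact (1 ≤ p)] [Fact (1 ≤ q)] [ENNReal.HolderConjugate p q] (hq2 : 2 ≤ q) (hq : q ≠ ⊤)
    (φ : 𝓢(R3, ℂ)) :
    Continuous fun f : Lp C3 p (volume : Measure R3) => hσ.hmul hq2 hq f φ :=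
  (((ContinuousLinearMap.lsmul ℂ ℂ (E := C3)).flip.lpPairing volume p q).flip
    (hσ.fourierMulCLM q hq2 hq (𝓕⁻ φ))).continuous

theorem IsDerivSymbol.continuous_Mul_hmul_apply {σ : R3 → ℂ} (hσ : IsDerivSymbol σ) {p q : ℝ≥0∞}
    [Fact (1 ≤ p)] [Fact (1 ≤ q)] [ENNReal.HolderConjugate p q] (hq2 : 2 ≤ q) (hq : q ≠ ⊤)
    (a : R3 → ℂ) (φ : 𝓢(R3, ℂ)) :
    Continuous fun f : Lp C3 p (volume : Measure R3) => Mul a (hσ.hmul hq2 hq f) φ :=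
  hσ.continuous_hmul_apply hq2 hq (𝓕 (SchwartzMap.smulLeftCLM ℂ a (𝓕⁻ φ)))

namespace IsLPCutoff

variable {χ : R3 → ℝ} (hχ : IsLPCutoff χ)

/-- Products of fields with frequencies below `2 ^ (n + 1)` have no blocks from `n + 4` on. -/
theorem D_hmul_holder_eq_zero {σ : R3 → ℂ} (hσ : IsDerivSymbol σ) {p q p' q' : ℝ≥0∞}
    [Fact (1 ≤ p)] [Fact (1 ≤ q)] [Fact (1 ≤ p')] [Fact (1 ≤ q')] [ENNReal.HolderConjugate p q]
    [ENNReal.HolderTriple p' q' p] (hp' : p' ≠ ⊤) (hq' : q' ≠ ⊤)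
    (hq2 : 2 ≤ q) (hq : q ≠ ⊤) (B : C3 →L[ℂ] C3 →L[ℂ] C3)
    (f : Lp C3 p' (volume : Measure R3)) (g : Lp C3 q' (volume : Measure R3)) {n : ℕ}
    (hf : hχ.S (n + 1) (emb p' f) = emb p' f) (hg : hχ.S (n + 1) (emb q' g) = emb q' g)
    {m : ℕ} (hm : n + 4 ≤ m) : hχ.D m (hσ.hmul hq2 hq (B.holder p f g)) = 0 := by
  obtain ⟨m, rfl⟩ : ∃ i, m = i + 1 := ⟨m - 1, by omega⟩
  have h2 : (2 : ℝ) ^ (n + 3) ≤ 2 ^ m := pow_le_pow_right₀ (by norm_num) (by omega)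
  have e1 : (2 : ℝ) ^ (n + 3) = 8 * 2 ^ n := by rw [pow_add]; norm_num; ring
  have e2 : (2 : ℝ) ^ (n + 1) = 2 * 2 ^ n := by rw [pow_succ]; ring
  have hn : (0 : ℝ) < 2 ^ n := by positivity
  have hpi := Real.pi_pos
  -- The radius `|ξ| = 2^{n+1}` in the variable `η = ξ / 2π`. The product lives in `|ξ| ≤ 2^{n+2}`,
  -- while `D m` with `m ≥ n + 4` vanishes below `2^m / 4 ≥ 2^{n+2}`.
  set R : ℝ := 2 ^ (n + 1) / (2 * Real.pi) with hR
  have hd : ∀ η : R3, ‖η‖ < 2 * R → hχ.dSym (m + 1) η = 0 := fun η h => by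
    refine hχ.dSym_eq_zero_of_ge ?_
    have : 2 * Real.pi * ‖η‖ ≤ 2 * Real.pi * (2 * R) := by gcongr
    rw [hR] at this
    have e3 : 2 * Real.pi * (2 * (2 ^ (n + 1) / (2 * Real.pi))) = 2 * 2 ^ (n + 1) := by field_simp
    rw [e3, e2] at this
    rw [e1] at h2
    linarith
  obtain ⟨c, hc⟩ := hσ.exists_symbol_mul (a := hχ.dSym (m + 1))
    (hasCompactSupport_dil hχ.hasCompactSupport_annSym (l := 2 ^ m) (by positivity)) (r := 2 * R) (by positivity) hd
  rw [D, hσ.Mul_hmul hq2 hq _ (hχ.dSym _).hasTemperateGrowth c.hasTemperateGrowth hc]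
  refine Mul_holder_eq_zero hp' hq' B (a := hχ.sSym (n + 1)) (R := R) (fun η h => ?_) f g hf hg
    c.hasTemperateGrowth fun η h => by rw [hc, hd η h, mul_zero]
  apply hχ.sSym_eq_zero
  rw [hR, div_le_iff₀ (by positivity)] at h
  linarith

/-- Paraproduct estimate: sums of pieces with frequencies below `2 ^ n`. -/
theorem exists_lTwo_coef_hmul_le {σ : R3 → ℂ} (hσ : IsDerivSymbol σ) {p q : ℝ≥0∞}
    [Fact (1 ≤ p)] [Fact (1 ≤ q)] [ENNReal.HolderConjugate p q] (hq2 : 2 ≤ q) (hq : q ≠ ⊤)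
    {r : ℝ≥0∞} (hr : 1 ≤ r) (hr' : r ≠ ⊤) {s : ℝ} (hs : 0 < s) :
    ∃ K : ℝ≥0, ∀ (F : ℕ → Lp C3 p (volume : Measure R3)) (G : Lp C3 p (volume : Measure R3)),
      Tendsto (fun n => ∑ i ∈ Finset.range n, F i) atTop (𝓝 G) →
      (∀ n m, n + 4 ≤ m → hχ.D m (hσ.hmul hq2 hq (F n)) = 0) →
      lTwo (hχ.coef (s - 1) r (hσ.hmul hq2 hq G)) ≤
        K * lTwo fun n => 2 ^ ((n : ℝ) * s) * lpENorm r (emb p (F n)) := by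
  have : Fact (1 ≤ r) := ⟨hr⟩
  obtain ⟨C, hC⟩ := hχ.exists_lpENorm_D_hmul_le hσ (p := p) hq2 hq hr hr'
  set θ : ℝ≥0∞ := 2 ^ (-s) with hθ
  have hθt := one_sub_inv_ne_top (two_rpow_neg_lt_one hs)
  rw [← hθ] at hθt
  have hKt : C * 2 ^ (6 * s) * (2 * (1 - θ)⁻¹) ≠ ⊤ :=
    ENNReal.mul_ne_top (ENNReal.mul_ne_top ENNReal.coe_ne_top (two_rpow_ne_top _)) hθt
  refine ⟨(C * 2 ^ (6 * s) * (2 * (1 - θ)⁻¹)).toNNReal, fun F G hweak hzero => ?_⟩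
  rw [ENNReal.coe_toNNReal hKt]
  -- The weight `2^{m(s-1)}` and the cost `2^m` of the derivative give `2^{ms}`. Compared with
  -- `2^{ns}` this decays like `2^{-(n-m)s}` for `n ≥ m`, because `s > 0`; only three indices `n <
  -- m` contribute.
  refine lTwo_le_of_le_tsum_dist fun m => ?_
  have hw : ∀ φ : 𝓢(R3, ℂ), Tendsto (fun n => (∑ i ∈ Finset.range n,
      hχ.D m (hσ.hmul hq2 hq (F i))) φ) atTop (𝓝 (hχ.D m (hσ.hmul hq2 hq G) φ)) := by
    intro φ
    refine ((hσ.continuous_Mul_hmul_apply hq2 hq (hχ.dSym m) φ).tendsto G |>.comp hweak).congr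
      fun n => ?_
    rw [Function.comp_apply, map_sum]
    exact congrArg (fun T : VField => T φ) (map_sum (hχ.D m) _ _)
  calc hχ.coef (s - 1) r (hσ.hmul hq2 hq G) m
      ≤ 2 ^ ((m : ℝ) * (s - 1)) * ∑' n, lpENorm r (hχ.D m (hσ.hmul hq2 hq (F n))) := by
        rw [coef]
        gcongr
        exact lpENorm_le_tsum hw
    _ = ∑' n, 2 ^ ((m : ℝ) * (s - 1)) * lpENorm r (hχ.D m (hσ.hmul hq2 hq (F n))) := by
        rw [ENNReal.tsum_mul_left]
    _ ≤ ∑' n, C * 2 ^ (6 * s) *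
          (θ ^ Nat.dist m n * (2 ^ ((n : ℝ) * s) * lpENorm r (emb p (F n)))) := by
        refine ENNReal.tsum_le_tsum fun n => ?_
        rcases le_or_gt (n + 4) m with h | h
        · rw [hzero n m h, lpENorm_zero, mul_zero]
          exact zero_le
        calc _ ≤ 2 ^ ((m : ℝ) * (s - 1)) * (C * 2 ^ m * lpENorm r (emb p (F n))) := by
              gcongr; exact hC m (F n)
          _ = C * (2 ^ ((m : ℝ) * s)) * lpENorm r (emb p (F n)) := by
              have : (2 : ℝ≥0∞) ^ ((m : ℝ) * s) = 2 ^ ((m : ℝ) * (s - 1)) * 2 ^ m := by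
                rw [← ENNReal.rpow_natCast, ← two_rpow_add]
                congr 1
                ring
              rw [this]
              ring
          _ ≤ C * (2 ^ (6 * s) * θ ^ Nat.dist m n * 2 ^ ((n : ℝ) * s)) * lpENorm r (emb p (F n)) := by
              gcongr
              rw [hθ, ← two_rpow_natCast_mul, ← two_rpow_add, ← two_rpow_add]
              refine ENNReal.rpow_le_rpow_of_exponent_le (by norm_num) ?_
              rcases le_total m n with h1 | h1
              · rw [Nat.dist_eq_sub_of_le h1]
                push_cast [Nat.cast_sub h1]
                nlinarith
              -- Here the exponent grows instead: `(m - n)s = 2(m - n)s - (m - n)s` with `m - n ≤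
              -- 3`, which is where `2^{6s}` comes from.
              · rw [Nat.dist_eq_sub_of_le_right h1]
                push_cast [Nat.cast_sub h1]
                have : (m : ℝ) ≤ n + 3 := by exact_mod_cast (by omega : m ≤ n + 3)
                nlinarith
          _ = _ := by ring
    _ = _ := by rw [ENNReal.tsum_mul_left]

end IsLPCutoff

theorem lTwo_sum_le {ι : Type*} (s : Finset ι) (a : ι → ℕ → ℝ≥0∞) :
    lTwo (fun n => ∑ i ∈ s, a i n) ≤ ∑ i ∈ s, lTwo (a i) := by
  classical
  induction s using Finset.induction_on with
  | empty => simp [lTwo]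
  | insert i s hi ih =>
    simp_rw [Finset.sum_insert hi]
    exact (lTwo_add_le _ _).trans (add_le_add le_rfl ih)

/-! ### Diagonal part and paraproducts of a product -/

namespace IsLPCutoff

variable {χ : R3 → ℝ} (hχ : IsLPCutoff χ)

theorem lTwo_coef_sum_le {s : ℝ} {p : ℝ≥0∞} (hp : 1 ≤ p) {ι : Type*} (t : Finset ι)
    (u : ι → VField) :
    lTwo (hχ.coef s p (∑ i ∈ t, u i)) ≤ ∑ i ∈ t, lTwo (hχ.coef s p (u i)) := by
  refine (lTwo_mono fun n => ?_).trans (lTwo_sum_le _ _)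
  simp only [coef]
  rw [← Finset.mul_sum, map_sum]
  gcongr
  exact lpENorm_sum_le hp _ _

section

variable {p r : ℝ≥0∞} [hp : Fact (1 ≤ p)] [hr : Fact (1 ≤ r)] [ENNReal.HolderTriple p p r]
variable (hp' : p ≠ ⊤)

/-- The blocks as operators on `L^p`. -/
def dL (n : ℕ) : Lp C3 p (volume : Measure R3) →ₗ[ℂ] Lp C3 p (volume : Measure R3) :=
  mulLp hp' (hχ.dSym n)

theorem emb_dL (n : ℕ) (f : Lp C3 p (volume : Measure R3)) :
    emb p (hχ.dL hp' n f) = hχ.D n (emb p f) := emb_mulLp hp' _ _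

theorem S_emb_dL (n : ℕ) (f : Lp C3 p (volume : Measure R3)) :
    hχ.S (n + 1) (emb p (hχ.dL hp' n f)) = emb p (hχ.dL hp' n f) := by
  rw [emb_dL, hχ.S_D n.lt_succ_self]

theorem S_emb_sum_dL {k n : ℕ} (h : k ≤ n + 1) (f : Lp C3 p (volume : Measure R3)) :
    hχ.S (n + 1) (emb p (∑ i ∈ Finset.range k, hχ.dL hp' i f)) =
      emb p (∑ i ∈ Finset.range k, hχ.dL hp' i f) := by
  rw [map_sum, map_sum]
  refine Finset.sum_congr rfl fun i hi => ?_
  rw [emb_dL, hχ.S_D (by have := Finset.mem_range.1 hi; omega)]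

/-- The fields with absolutely convergent Littlewood-Paley decomposition in `L^p`. -/
def absSum : Submodule ℂ (Lp C3 p (volume : Measure R3)) where
  carrier := {f | Summable fun n => ‖hχ.dL hp' n f‖}
  zero_mem' := by
    simp only [Set.mem_ofPred_eq, map_zero, norm_zero]
    exact summable_zero
  add_mem' {f g} hf hg := by
    refine Summable.of_nonneg_of_le (fun _ => norm_nonneg _) (fun n => ?_) (hf.add hg)
    rw [map_add]
    exact norm_add_le _ _
  smul_mem' c f hf := by
    refine (hf.mul_left ‖c‖).congr fun n => ?_
    rw [map_smul, norm_smul]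

theorem hasSum_dL {f : Lp C3 p (volume : Measure R3)} (hf : f ∈ hχ.absSum hp') :
    HasSum (fun n => hχ.dL hp' n f) f := by
  have h1 : Summable fun n => hχ.dL hp' n f := Summable.of_norm hf
  have h2 : ∑' n, hχ.dL hp' n f = f := by
    apply emb_injective
    ext1 φ
    have h3 := h1.hasSum.tendsto_sum_nat
    have hc : Continuous fun f : Lp C3 p (volume : Measure R3) => emb p f φ :=
      (PointwiseConvergenceCLM.evalCLM (RingHom.id ℂ) C3 φ).continuous.comp (emb p).continuous
    refine tendsto_nhds_unique ((hc.tendsto _).comp h3) ?_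
    refine (hχ.tendsto_sum_D_apply (emb p f) φ).congr fun n => ?_
    rw [Function.comp_apply, map_sum]
    simp only [emb_dL]
  have h3 := h1.hasSum
  rwa [h2] at h3

/-- For positive order, Cauchy–Schwarz against `2^{-ns}` turns `ℓ²` coefficients into summable
norms. -/
theorem mem_absSum_of_lTwo {s : ℝ} (hs : 0 < s) {f : Lp C3 p (volume : Measure R3)}
    (hf : lTwo (hχ.coef s p (emb p f)) < ⊤) : f ∈ hχ.absSum hp' := by
  have h : ∑' n, ‖hχ.dL hp' n f‖ₑ ≤ _ := (tsum_congr fun n => ?_).trans_le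
    (tsum_pow_mul_le_lTwo ((2 : ℝ≥0∞) ^ (-s)) (hχ.coef s p (emb p f)))
  · have h2 := h.trans_lt (ENNReal.mul_lt_top
      (one_sub_inv_ne_top (two_rpow_neg_lt_one hs)).lt_top hf)
    have h3 : Summable fun n => ‖hχ.dL hp' n f‖₊ := by
      rw [← ENNReal.tsum_coe_ne_top_iff_summable]
      exact h2.ne
    exact (NNReal.summable_coe.2 h3 :)
  · rw [← lpENorm_emb, emb_dL, hχ.lpENorm_D_eq s, ← two_rpow_natCast_mul]
    congr 2
    ring

theorem summable_diag (B : C3 →L[ℂ] C3 →L[ℂ] C3) {f g : Lp C3 p (volume : Measure R3)}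
    (hf : f ∈ hχ.absSum hp') (hg : g ∈ hχ.absSum hp') :
    Summable fun n => B.holder r (hχ.dL hp' n f) (hχ.dL hp' n g) := by
  have h1 : Summable fun n => ‖B‖ * (‖hχ.dL hp' n f‖ * ∑' k, ‖hχ.dL hp' k g‖) :=
    (hf.mul_right _).mul_left _
  refine Summable.of_norm_bounded h1 fun n => ?_
  refine (B.norm_holder_apply_apply_le _ _).trans ?_
  rw [mul_assoc]
  gcongr
  exact hg.le_tsum n fun _ _ => norm_nonneg _

/-- The diagonal part `∑ B(D_n f, D_n g)` of a product. -/
def diag (B : C3 →L[ℂ] C3 →L[ℂ] C3) :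
    hχ.absSum hp' →ₗ[ℂ] hχ.absSum hp' →ₗ[ℂ] Lp C3 r (volume : Measure R3) :=
  LinearMap.mk₂ ℂ (fun f g => ∑' n, B.holder r (hχ.dL hp' n f) (hχ.dL hp' n g))
    (fun f f' g => by
      refine Eq.trans (tsum_congr fun n => ?_)
        ((hχ.summable_diag hp' B f.2 g.2).tsum_add (hχ.summable_diag hp' B f'.2 g.2))
      rw [Submodule.coe_add, map_add, B.holder_add_left])
    (fun c f g => by
      refine Eq.trans (tsum_congr fun n => ?_) ((hχ.summable_diag hp' B f.2 g.2).tsum_const_smul c)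
      rw [Submodule.coe_smul, map_smul, B.holder_smul_left])
    (fun f g g' => by
      refine Eq.trans (tsum_congr fun n => ?_)
        ((hχ.summable_diag hp' B f.2 g.2).tsum_add (hχ.summable_diag hp' B f.2 g'.2))
      rw [Submodule.coe_add, map_add, B.holder_add_right])
    (fun c f g => by
      refine Eq.trans (tsum_congr fun n => ?_) ((hχ.summable_diag hp' B f.2 g.2).tsum_const_smul c)
      rw [Submodule.coe_smul, map_smul, B.holder_smul_right])

theorem tendsto_diag (B : C3 →L[ℂ] C3 →L[ℂ] C3) (f g : hχ.absSum hp') :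
    Tendsto (fun N => ∑ n ∈ Finset.range N,
      B.holder r (hχ.dL hp' n (f : Lp C3 p volume)) (hχ.dL hp' n (g : Lp C3 p volume))) atTop
      (𝓝 (hχ.diag hp' B f g)) :=
  (hχ.summable_diag hp' B f.2 g.2).hasSum.tendsto_sum_nat

theorem tendsto_holder_sum_dL (B : C3 →L[ℂ] C3 →L[ℂ] C3) (f g : hχ.absSum hp') :
    Tendsto (fun N => B.holder r (∑ n ∈ Finset.range N, hχ.dL hp' n (f : Lp C3 p volume))
      (∑ n ∈ Finset.range N, hχ.dL hp' n (g : Lp C3 p volume))) atTop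
      (𝓝 (B.holder r (f : Lp C3 p volume) (g : Lp C3 p volume))) := by
  have hc : Continuous fun z : Lp C3 p (volume : Measure R3) × Lp C3 p (volume : Measure R3) =>
      B.holderL volume p p r z.1 z.2 := (B.holderL volume p p r).continuous₂
  have h := (hc.tendsto (f, g)).comp ((hχ.hasSum_dL hp' f.2).tendsto_sum_nat.prodMk_nhds
    (hχ.hasSum_dL hp' g.2).tendsto_sum_nat)
  exact h

/-- Summation by parts for products. -/
theorem holder_sum_dL (B : C3 →L[ℂ] C3 →L[ℂ] C3) (f g : Lp C3 p (volume : Measure R3)) (N : ℕ) :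
    B.holder r (∑ n ∈ Finset.range N, hχ.dL hp' n f) (∑ n ∈ Finset.range N, hχ.dL hp' n g) =
      ∑ n ∈ Finset.range N, (B.holder r (hχ.dL hp' n f) (∑ i ∈ Finset.range (n + 1), hχ.dL hp' i g) +
        B.holder r (∑ i ∈ Finset.range n, hχ.dL hp' i f) (hχ.dL hp' n g)) := by
  induction N with
  | zero =>
    simp only [Finset.range_zero, Finset.sum_empty]
    have := B.holder_smul_left (r := r) (0 : ℂ) (0 : Lp C3 p (volume : Measure R3))
      (0 : Lp C3 p (volume : Measure R3))
    rwa [zero_smul, zero_smul] at this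
  | succ N ih =>
    rw [Finset.sum_range_succ (fun n => _ + _), ← ih, Finset.sum_range_succ _ N, B.holder_add_left,
      Finset.sum_range_succ _ N, B.holder_add_right, B.holder_add_right]
    abel

end

end IsLPCutoff

namespace IsLPCutoff

variable {χ : R3 → ℝ} (hχ : IsLPCutoff χ)

section

variable {p r q : ℝ≥0∞} [hp : Fact (1 ≤ p)] [hr : Fact (1 ≤ r)] [hq : Fact (1 ≤ q)]
  [ENNReal.HolderTriple p p r] [ENNReal.HolderConjugate r q]
variable (hp' : p ≠ ⊤) (hq2 : 2 ≤ q) (hq' : q ≠ ⊤)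

/-- The diagonal part of the advective term. -/
theorem exists_lTwo_coef_hmul_diag_le {σ : R3 → ℂ} (hσ : IsDerivSymbol σ)
    (B : C3 →L[ℂ] C3 →L[ℂ] C3) (hr' : r ≠ ⊤) {s : ℝ} (hs : 0 < s) :
    ∃ K : ℝ≥0, ∀ f g : hχ.absSum hp', lTwo (hχ.coef s p (emb p (f : Lp C3 p volume))) < ⊤ →
      lTwo (hχ.coef s p (emb p (g : Lp C3 p volume))) < ⊤ →
      lTwo (hχ.coef (2 * s - 1) r (hσ.hmul (p := r) hq2 hq' (hχ.diag hp' B f g))) ≤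
        K * (lTwo (hχ.coef s p (emb p (f : Lp C3 p volume))) *
          lTwo (hχ.coef s p (emb p (g : Lp C3 p volume)))) := by
  obtain ⟨K, hK⟩ := hχ.exists_lTwo_coef_hmul_le hσ (p := r) hq2 hq' hr.out hr'
    (s := 2 * s) (by positivity)
  refine ⟨K * ‖B‖₊, fun f g hf hg => ?_⟩
  set u := emb p (f : Lp C3 p volume) with hu
  set v := emb p (g : Lp C3 p volume) with hv
  refine (hK _ _ (hχ.tendsto_diag hp' B f g) fun n m hm =>
    hχ.D_hmul_holder_eq_zero hσ hp' hp' hq2 hq' B _ _ (hχ.S_emb_dL hp' n _)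
      (hχ.S_emb_dL hp' n _) hm).trans ?_
  push_cast
  rw [mul_assoc]
  gcongr
  -- Only one factor has to be summed in `ℓ²`; the other enters through its supremum.
  rw [mul_comm (lTwo _), ← mul_assoc, ← lTwo_const_mul]
  refine lTwo_mono fun n => ?_
  have h := lpENorm_emb_holder_le (p := p) (q := p) (r := r) (r₀ := r) hp.out hp.out hr.out B
    (hχ.dL hp' n (f : Lp C3 p volume)) (hχ.dL hp' n (g : Lp C3 p volume))
    ((isLpFun_emb _).lpENorm_lt_top hp.out) ((isLpFun_emb _).lpENorm_lt_top hp.out)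
  rw [emb_dL, emb_dL, hχ.lpENorm_D_eq s, hχ.lpENorm_D_eq s, ← hu, ← hv] at h
  calc _ ≤ 2 ^ ((n : ℝ) * (2 * s)) * (‖B‖ₑ * (2 ^ (-((n : ℝ) * s)) * hχ.coef s p u n *
        (2 ^ (-((n : ℝ) * s)) * hχ.coef s p v n))) := by gcongr
    _ = (2 ^ ((n : ℝ) * (2 * s)) * 2 ^ (-((n : ℝ) * s)) * 2 ^ (-((n : ℝ) * s))) *
        (‖B‖ₑ * (hχ.coef s p u n * hχ.coef s p v n)) := by ring
    _ = ‖B‖ₑ * hχ.coef s p v n * hχ.coef s p u n := by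
        rw [← two_rpow_add, ← two_rpow_add]
        have : (n : ℝ) * (2 * s) + -((n : ℝ) * s) + -((n : ℝ) * s) = 0 := by ring
        rw [this, ENNReal.rpow_zero]
        ring
    _ ≤ _ := by
        gcongr
        · exact le_rfl
        · exact le_lTwo _ n

/-- Estimate of paraproducts of fields with low frequencies bounded in `L^b`. -/
theorem exists_lTwo_coef_hmul_para_le {σ : R3 → ℂ} (hσ : IsDerivSymbol σ)
    (B : C3 →L[ℂ] C3 →L[ℂ] C3) {a b t : ℝ≥0∞} (ha : 1 ≤ a) (hb : 1 ≤ b) (ht : 1 ≤ t)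
    (ht' : t ≠ ⊤) [ENNReal.HolderTriple a b t] {s : ℝ} (hs : 0 < s) :
    ∃ K : ℝ≥0, ∀ (κ : ℕ → ℕ), (∀ n, κ n ≤ n + 1) → ∀ (f g : Lp C3 p (volume : Measure R3))
      (G : Lp C3 r (volume : Measure R3)) (M N : ℝ≥0∞), M < ⊤ → N < ⊤ →
      lTwo (hχ.coef s a (emb p f)) < ⊤ → lTwo (hχ.coef s a (emb p g)) < ⊤ →
      (∀ n, lpENorm b (∑ i ∈ Finset.range n, hχ.D i (emb p f)) ≤ M) →
      (∀ n, lpENorm b (∑ i ∈ Finset.range n, hχ.D i (emb p g)) ≤ N) →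
      Tendsto (fun N => ∑ n ∈ Finset.range N,
        (B.holder r (hχ.dL hp' n f) (∑ i ∈ Finset.range (κ n), hχ.dL hp' i g) +
          B.holder r (∑ i ∈ Finset.range n, hχ.dL hp' i f) (hχ.dL hp' n g))) atTop (𝓝 G) →
      lTwo (hχ.coef (s - 1) t (hσ.hmul hq2 hq' G)) ≤
        K * (lTwo (hχ.coef s a (emb p f)) * N + M * lTwo (hχ.coef s a (emb p g))) := by
  obtain ⟨K, hK⟩ := hχ.exists_lTwo_coef_hmul_le hσ (p := r) hq2 hq' ht ht' hs
  -- `κ n = n` omits the diagonal, as needed for `I`; `κ n = n + 1` includes it, as needed for the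
  -- trilinear form. Either way the factors have frequencies below `2^{n+1}`, which is all the
  -- localisation used.
  refine ⟨K * ‖B‖₊, fun κ hκ f g G M N hM hN hf hg hfM hgN hG => ?_⟩
  have hba : ENNReal.HolderTriple b a t := ENNReal.HolderTriple.symm
  refine (hK _ _ hG fun n m hm => ?_).trans ?_
  · rw [map_add, map_add, hχ.D_hmul_holder_eq_zero hσ hp' hp' hq2 hq' B _ _
      (hχ.S_emb_dL hp' n _) (hχ.S_emb_sum_dL hp' (hκ n) _) hm,
      hχ.D_hmul_holder_eq_zero hσ hp' hp' hq2 hq' B _ _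
      (hχ.S_emb_sum_dL hp' n.le_succ _) (hχ.S_emb_dL hp' n _) hm, add_zero]
  push_cast
  rw [mul_assoc]
  gcongr
  rw [mul_add, mul_comm _ N, ← mul_assoc, ← mul_assoc, ← lTwo_const_mul, ← lTwo_const_mul]
  refine (lTwo_mono fun n => ?_).trans (lTwo_add_le _ _)
  have hsum : ∀ (k : ℕ) (h : Lp C3 p (volume : Measure R3)),
      emb p (∑ i ∈ Finset.range k, hχ.dL hp' i h) = ∑ i ∈ Finset.range k, hχ.D i (emb p h) :=
    fun k h => by
      rw [map_sum]
      exact Finset.sum_congr rfl fun i _ => hχ.emb_dL hp' i h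
  have h1 := lpENorm_emb_holder_le (r₀ := r) ha hb ht B
    (hχ.dL hp' n f) (∑ i ∈ Finset.range (κ n), hχ.dL hp' i g)
    (by rw [emb_dL]; exact hχ.lpENorm_D_lt_top hf n)
    (by rw [hsum]; exact (hgN _).trans_lt hN)
  have h2 := lpENorm_emb_holder_le (r₀ := r) hb ha ht B
    (∑ i ∈ Finset.range n, hχ.dL hp' i f) (hχ.dL hp' n g)
    (by rw [hsum]; exact (hfM _).trans_lt hM)
    (by rw [emb_dL]; exact hχ.lpENorm_D_lt_top hg n)
  rw [emb_dL, hsum] at h1 h2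
  calc _ ≤ 2 ^ ((n : ℝ) * s) * (‖B‖ₑ * (lpENorm a (hχ.D n (emb p f)) * N) +
        ‖B‖ₑ * (M * lpENorm a (hχ.D n (emb p g)))) := by
        gcongr
        rw [map_add]
        refine (lpENorm_add_le ht _ _).trans (add_le_add (h1.trans ?_) (h2.trans ?_))
        · gcongr
          exact hgN _
        · gcongr
          exact hfM _
    _ = _ := by
        simp only [coef]
        rw [← enorm_eq_nnnorm]
        ring

end

theorem exists_lpENorm_sum_D_le_lTwo : ∃ C : ℝ≥0, ∀ u, lTwo (hχ.coef (1 / 3) 3 u) < ⊤ → ∀ n,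
    lpENorm (9 / 2) (∑ i ∈ Finset.range n, hχ.D i u) ≤ C * lTwo (hχ.coef (1 / 3) 3 u) := by
  obtain ⟨C, hC⟩ := hχ.exists_lpENorm_S_le_lTwo
  refine ⟨C, fun u hu n => ?_⟩
  cases n with
  | zero => simp [lpENorm_zero]
  | succ n => rw [sum_D]; exact hC u hu n

instance : ENNReal.HolderConjugate (3 / 2) 3 :=
  holderTriple_of_toReal (by simp) (by simp) (by simp) (by norm_num)

instance : ENNReal.HolderTriple 3 (9 / 2) (9 / 5) :=
  holderTriple_of_toReal (by simp) (by simp) (by simp) (by norm_num)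

instance : ENNReal.HolderTriple (18 / 7) (9 / 2) (18 / 11) :=
  holderTriple_of_toReal (by simp) (by simp) (by simp) (by norm_num)

end IsLPCutoff

/-! ### The advective term and the estimates of its parts -/

theorem two_le_three : (2 : ℝ≥0∞) ≤ 3 := by norm_num

theorem three_ne_top : (3 : ℝ≥0∞) ≠ ⊤ := by simp

/-- The triples of indices of the advective term. -/
abbrev Idx : Type := Fin 3 × Fin 3 × Fin 3

theorem isDerivSymbol_advSym' (x : Idx) : IsDerivSymbol (advSym x.1 x.2.1 x.2.2) :=
  isDerivSymbol_advSym _ _ _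

/-- The homogeneous multipliers in the advective term. -/
def advMul (x : Idx) : Lp C3 (3 / 2) (volume : Measure R3) →ₗ[ℂ] VField :=
  (isDerivSymbol_advSym' x).hmul (p := 3 / 2) (q := 3) two_le_three three_ne_top

/-- The product map belonging to a triple of indices. -/
def idxBil (x : Idx) : C3 →L[ℂ] C3 →L[ℂ] C3 := bil x.1 x.2.1 x.2.2

/-- The advective term `ℙ div (f ⊗ g)` as a distribution. -/
def advL : Lp C3 3 (volume : Measure R3) →ₗ[ℂ] Lp C3 3 (volume : Measure R3) →ₗ[ℂ] VField :=
  ∑ x : Idx, ((idxBil x).holderₗ volume 3 3 (3 / 2)).compr₂ (advMul x)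

theorem advL_apply (f g : Lp C3 3 (volume : Measure R3)) :
    advL f g = ∑ x : Idx, advMul x ((idxBil x).holder (3 / 2) f g) := by
  simp [advL]

namespace IsLPCutoff

variable {χ : R3 → ℝ} (hχ : IsLPCutoff χ)

/-- The diagonal part of the advective term. -/
def advDiag : hχ.absSum three_ne_top →ₗ[ℂ] hχ.absSum three_ne_top →ₗ[ℂ] VField :=
  ∑ x : Idx, (hχ.diag three_ne_top (r := 3 / 2) (idxBil x)).compr₂ (advMul x)

theorem advDiag_apply (f g : hχ.absSum three_ne_top) :
    hχ.advDiag f g = ∑ x : Idx, advMul x (hχ.diag three_ne_top (idxBil x) f g) := by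
  simp [advDiag]

theorem one_le_three_halves : (1 : ℝ≥0∞) ≤ 3 / 2 := Fact.out

theorem one_le_nine_halves : (1 : ℝ≥0∞) ≤ 9 / 2 := by
  rw [ENNReal.le_div_iff_mul_le (by simp) (by simp)]; norm_num

theorem one_le_eighteen_elevenths : (1 : ℝ≥0∞) ≤ 18 / 11 := by
  rw [ENNReal.le_div_iff_mul_le (by simp) (by simp)]; norm_num

/-- The bound for `C`: two factors of order `1/3` and one derivative leave `2/3 - 1`, in `L^{3/2}`.
-/
theorem exists_lTwo_coef_advDiag_le : ∃ K : ℝ≥0, ∀ f g : hχ.absSum three_ne_top,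
    lTwo (hχ.coef (1 / 3) 3 (emb 3 (f : Lp C3 3 volume))) < ⊤ →
    lTwo (hχ.coef (1 / 3) 3 (emb 3 (g : Lp C3 3 volume))) < ⊤ →
    lTwo (hχ.coef (-1 / 3) (3 / 2) (hχ.advDiag f g)) ≤
      K * (lTwo (hχ.coef (1 / 3) 3 (emb 3 (f : Lp C3 3 volume))) *
        lTwo (hχ.coef (1 / 3) 3 (emb 3 (g : Lp C3 3 volume)))) := by
  choose K hK using fun x : Idx => hχ.exists_lTwo_coef_hmul_diag_le (p := 3) (r := 3 / 2) (q := 3)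
    three_ne_top two_le_three three_ne_top (isDerivSymbol_advSym' x) (idxBil x)
    (ENNReal.div_ne_top (by simp) (by simp)) (s := 1 / 3) (by norm_num)
  refine ⟨∑ x, K x, fun f g hf hg => ?_⟩
  rw [advDiag_apply]
  refine (hχ.lTwo_coef_sum_le one_le_three_halves _ _).trans ?_
  push_cast
  rw [Finset.sum_mul]
  refine Finset.sum_le_sum fun x _ => ?_
  have h := hK x f g hf hg
  rwa [show (2 * (1 / 3) - 1 : ℝ) = -1 / 3 by norm_num] at h

theorem tendsto_offdiag {p r : ℝ≥0∞} [Fact (1 ≤ p)] [Fact (1 ≤ r)] [ENNReal.HolderTriple p p r]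
    (hp' : p ≠ ⊤) (B : C3 →L[ℂ] C3 →L[ℂ] C3) (f g : hχ.absSum hp') :
    Tendsto (fun N => ∑ n ∈ Finset.range N,
      (B.holder r (hχ.dL hp' n (f : Lp C3 p volume))
        (∑ i ∈ Finset.range n, hχ.dL hp' i (g : Lp C3 p volume)) +
      B.holder r (∑ i ∈ Finset.range n, hχ.dL hp' i (f : Lp C3 p volume))
        (hχ.dL hp' n (g : Lp C3 p volume)))) atTop
      (𝓝 (B.holder r (f : Lp C3 p volume) (g : Lp C3 p volume) - hχ.diag hp' B f g)) := by
  refine ((hχ.tendsto_holder_sum_dL hp' B f g).sub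
    (hχ.tendsto_diag hp' B f g)).congr fun N => ?_
  rw [holder_sum_dL, ← Finset.sum_sub_distrib]
  refine Finset.sum_congr rfl fun n _ => ?_
  rw [Finset.sum_range_succ, ContinuousLinearMap.holder_add_right]
  abel

/-- The bound for `I`: blocks in `L³` and low frequencies in `L^{9/2}` give `1/3 + 2/9 = 5/9`, and
the order is `1/3 - 1`. -/
theorem exists_lTwo_coef_advL_sub_advDiag_le : ∃ K : ℝ≥0, ∀ f g : hχ.absSum three_ne_top,
    lTwo (hχ.coef (1 / 3) 3 (emb 3 (f : Lp C3 3 volume))) < ⊤ →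
    lTwo (hχ.coef (1 / 3) 3 (emb 3 (g : Lp C3 3 volume))) < ⊤ →
    lTwo (hχ.coef (-2 / 3) (9 / 5) (advL (f : Lp C3 3 volume) g - hχ.advDiag f g)) ≤
      K * (lTwo (hχ.coef (1 / 3) 3 (emb 3 (f : Lp C3 3 volume))) *
        lTwo (hχ.coef (1 / 3) 3 (emb 3 (g : Lp C3 3 volume)))) := by
  obtain ⟨C, hC⟩ := hχ.exists_lpENorm_sum_D_le_lTwo
  choose K hK using fun x : Idx => hχ.exists_lTwo_coef_hmul_para_le (p := 3) (r := 3 / 2) (q := 3)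
    three_ne_top two_le_three three_ne_top (isDerivSymbol_advSym' x) (idxBil x) (a := 3)
    (b := 9 / 2) (t := 9 / 5) (by norm_num) one_le_nine_halves Fact.out
    (ENNReal.div_ne_top (by simp) (by simp)) (s := 1 / 3) (by norm_num)
  refine ⟨∑ x, K x * (2 * C), fun f g hf hg => ?_⟩
  rw [advDiag_apply, advL_apply, ← Finset.sum_sub_distrib]
  refine (hχ.lTwo_coef_sum_le Fact.out _ _).trans ?_
  push_cast
  rw [Finset.sum_mul]
  refine Finset.sum_le_sum fun x _ => ?_
  rw [← map_sub]
  have hlim := hχ.tendsto_offdiag three_ne_top (r := 3 / 2) (idxBil x) f g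
  have h := hK x (fun n => n) (fun n => n.le_succ) f g _ _ _
    (ENNReal.mul_lt_top (ENNReal.coe_lt_top (r := C)) hf)
    (ENNReal.mul_lt_top (ENNReal.coe_lt_top (r := C)) hg) hf hg (hC _ hf) (hC _ hg) hlim
  rw [show (1 / 3 - 1 : ℝ) = -2 / 3 by norm_num] at h
  refine h.trans (le_of_eq ?_)
  ring

/-- The diagonal need not be separated here; it is absorbed in one paraproduct. Blocks in `L^{18/7}`
and low frequencies in `L^{9/2}` give `7/18 + 4/18 = 11/18`, the exponent conjugate to `18/7`, and
the order is `1/2 - 1`. The low frequencies are controlled through `B^{1/2}_{18/7,2} ⊂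
B^{1/3}_{3,2}`, as `3(7/18 - 1/3) = 1/2 - 1/3`. -/
theorem exists_lTwo_coef_advL_le : ∃ K : ℝ≥0, ∀ f g : Lp C3 3 (volume : Measure R3),
    lTwo (hχ.coef (1 / 2) (18 / 7) (emb 3 f)) < ⊤ →
    lTwo (hχ.coef (1 / 2) (18 / 7) (emb 3 g)) < ⊤ →
    lTwo (hχ.coef (-1 / 2) (18 / 11) (advL f g)) ≤
      K * (lTwo (hχ.coef (1 / 2) (18 / 7) (emb 3 f)) *
        lTwo (hχ.coef (1 / 2) (18 / 7) (emb 3 g))) := by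
  obtain ⟨C, hC⟩ := hχ.exists_lpENorm_sum_D_le_lTwo
  obtain ⟨E, hE⟩ := hχ.exists_lTwo_coef_le (p := 18 / 7) (q := 3) (s := 1 / 2) (t := 1 / 3)
    Fact.out (by rw [ENNReal.div_le_iff_le_mul (by simp) (by simp)]; norm_num) three_ne_top
    (by norm_num)
  choose K hK using fun x : Idx => hχ.exists_lTwo_coef_hmul_para_le (p := 3) (r := 3 / 2) (q := 3)
    three_ne_top two_le_three three_ne_top (isDerivSymbol_advSym' x) (idxBil x) (a := 18 / 7)
    (b := 9 / 2) (t := 18 / 11) Fact.out one_le_nine_halves one_le_eighteen_elevenths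
    (ENNReal.div_ne_top (by simp) (by simp)) (s := 1 / 2) (by norm_num)
  refine ⟨∑ x, K x * (2 * (C * E)), fun f g hf hg => ?_⟩
  have hM : ∀ f : Lp C3 3 (volume : Measure R3), lTwo (hχ.coef (1 / 2) (18 / 7) (emb 3 f)) < ⊤ →
      lTwo (hχ.coef (1 / 3) 3 (emb 3 f)) < ⊤ ∧
      ∀ n, lpENorm (9 / 2) (∑ i ∈ Finset.range n, hχ.D i (emb 3 f)) ≤
        C * (E * lTwo (hχ.coef (1 / 2) (18 / 7) (emb 3 f))) := fun f hf => by
    have h3 : lTwo (hχ.coef (1 / 3) 3 (emb 3 f)) < ⊤ :=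
      (hE _).trans_lt (ENNReal.mul_lt_top ENNReal.coe_lt_top hf)
    refine ⟨h3, fun n => (hC _ h3 n).trans ?_⟩
    gcongr
    exact hE _
  rw [advL_apply]
  refine (hχ.lTwo_coef_sum_le one_le_eighteen_elevenths _ _).trans ?_
  push_cast
  rw [Finset.sum_mul]
  refine Finset.sum_le_sum fun x _ => ?_
  have hlim := hχ.tendsto_holder_sum_dL three_ne_top (r := 3 / 2) (idxBil x)
    ⟨f, hχ.mem_absSum_of_lTwo three_ne_top (by norm_num) (hM f hf).1⟩
    ⟨g, hχ.mem_absSum_of_lTwo three_ne_top (by norm_num) (hM g hg).1⟩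
  simp_rw [holder_sum_dL] at hlim
  have h := hK x (fun n => n + 1) (fun n => le_rfl) f g _ _ _
    (ENNReal.mul_lt_top (ENNReal.coe_lt_top (r := C)) (ENNReal.mul_lt_top
      (ENNReal.coe_lt_top (r := E)) hf)) (ENNReal.mul_lt_top (ENNReal.coe_lt_top (r := C))
      (ENNReal.mul_lt_top (ENNReal.coe_lt_top (r := E)) hg)) hf hg (hM f hf).2 (hM g hg).2 hlim
  rw [show (1 / 2 - 1 : ℝ) = -1 / 2 by norm_num] at h
  refine h.trans (le_of_eq ?_)
  ring

end IsLPCutoff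

/-! ### The bilinear maps on Besov spaces -/

/-- The functions representing the elements of a space of `L^p` fields. -/
def lpRep (p : ℝ≥0∞) [Fact (1 ≤ p)] (Y : Submodule ℂ VField) (hY : ∀ u ∈ Y, lpENorm p u < ⊤) :
    Y →ₗ[ℂ] Lp C3 p (volume : Measure R3) where
  toFun u := (exists_emb_eq (hY u u.2)).choose
  map_add' u v := by
    apply emb_injective
    rw [map_add, (exists_emb_eq (hY u u.2)).choose_spec, (exists_emb_eq (hY v v.2)).choose_spec]
    exact (exists_emb_eq (hY _ (u + v).2)).choose_spec
  map_smul' c u := by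
    apply emb_injective
    rw [RingHom.id_apply, map_smul, (exists_emb_eq (hY u u.2)).choose_spec]
    exact (exists_emb_eq (hY _ (c • u).2)).choose_spec

theorem emb_lpRep {p : ℝ≥0∞} [Fact (1 ≤ p)] {Y : Submodule ℂ VField}
    (hY : ∀ u ∈ Y, lpENorm p u < ⊤) (u : Y) : emb p (lpRep p Y hY u) = u :=
  (exists_emb_eq (hY u u.2)).choose_spec

/-- A bilinear map with values in a subspace. -/
def codRestrict₂ {Y : Type*} [AddCommGroup Y] [Module ℂ Y] (Z : Submodule ℂ VField)
    (B : Y →ₗ[ℂ] Y →ₗ[ℂ] VField) (h : ∀ u v, B u v ∈ Z) : Y →ₗ[ℂ] Y →ₗ[ℂ] Z :=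
  LinearMap.mk₂ ℂ (fun u v => ⟨B u v, h u v⟩)
    (fun u u' v => Subtype.ext (B.map_add₂ u u' v)) (fun c u v => Subtype.ext (B.map_smul₂ c u v))
    (fun u v v' => Subtype.ext ((B u).map_add v v')) (fun c u v => Subtype.ext ((B u).map_smul c v))

theorem coe_codRestrict₂ {Y : Type*} [AddCommGroup Y] [Module ℂ Y] (Z : Submodule ℂ VField)
    (B : Y →ₗ[ℂ] Y →ₗ[ℂ] VField) (h : ∀ u v, B u v ∈ Z) (u v : Y) :
    (codRestrict₂ Z B h u v : VField) = B u v := rfl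

namespace IsLPCutoff

variable {χ : R3 → ℝ} (hχ : IsLPCutoff χ)

theorem besovENorm_lt_top_iff_lTwo {s : ℝ} {p : ℝ≥0∞} {u : VField} :
    besovENorm χ s p 2 u < ⊤ ↔ lTwo (hχ.coef s p u) < ⊤ :=
  ⟨fun h => (hχ.lTwo_coef_le s p u).trans_lt (ENNReal.mul_lt_top
    (ENNReal.add_lt_top.2 ⟨ENNReal.one_lt_top, (two_rpow_ne_top _).lt_top⟩) h),
  fun h => (hχ.besovENorm_le s p u).trans_lt (ENNReal.mul_lt_top
    (ENNReal.add_lt_top.2 ⟨ENNReal.one_lt_top, (two_rpow_ne_top _).lt_top⟩) h)⟩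

theorem lTwo_coef_lt_top {s : ℝ} {p : ℝ≥0∞} [Fact (1 ≤ p)] (u : besov χ s p 2) :
    lTwo (hχ.coef s p u) < ⊤ :=
  hχ.besovENorm_lt_top_iff_lTwo.1 u.2

theorem exists_lTwo_coef_le_besovENorm (s : ℝ) (p : ℝ≥0∞) : ∃ K : ℝ≥0, ∀ u,
    lTwo (hχ.coef s p u) ≤ K * besovENorm χ s p 2 u := by
  refine ⟨(1 + (2 : ℝ≥0∞) ^ s).toNNReal, fun u => ?_⟩
  rw [ENNReal.coe_toNNReal (ENNReal.add_ne_top.2 ⟨ENNReal.one_ne_top, two_rpow_ne_top _⟩)]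
  exact hχ.lTwo_coef_le s p u

theorem exists_besovENorm_le_lTwo_coef (s : ℝ) (p : ℝ≥0∞) : ∃ K : ℝ≥0, ∀ u,
    besovENorm χ s p 2 u ≤ K * lTwo (hχ.coef s p u) := by
  refine ⟨(1 + (2 : ℝ≥0∞) ^ (-s)).toNNReal, fun u => ?_⟩
  rw [ENNReal.coe_toNNReal (ENNReal.add_ne_top.2 ⟨ENNReal.one_ne_top, two_rpow_ne_top _⟩)]
  exact hχ.besovENorm_le s p u

include hχ in
theorem lpENorm_lt_top_of_mem_besov {s : ℝ} (hs : 0 < s) {p : ℝ≥0∞} [Fact (1 ≤ p)] (u : VField)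
    (hu : u ∈ besov χ s p 2) : lpENorm p u < ⊤ := by
  obtain ⟨C, hC⟩ := hχ.exists_lpENorm_le_lTwo hs (p := p) Fact.out
  exact (hC u).trans_lt (ENNReal.mul_lt_top ENNReal.coe_lt_top
    (hχ.besovENorm_lt_top_iff_lTwo.1 hu))

theorem exists_lTwo_coef_third_le : ∃ C : ℝ≥0, ∀ u,
    lTwo (hχ.coef (1 / 3) 3 u) ≤ C * lTwo (hχ.coef (1 / 2) (18 / 7) u) :=
  hχ.exists_lTwo_coef_le (p := 18 / 7) (q := 3) (s := 1 / 2) (t := 1 / 3)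
    Fact.out (by rw [ENNReal.div_le_iff_le_mul (by simp) (by simp)]; norm_num) three_ne_top
    (by norm_num)

theorem exists_lpENorm_three_le : ∃ C : ℝ≥0, ∀ u,
    lpENorm 3 u ≤ C * lTwo (hχ.coef (1 / 2) (18 / 7) u) := by
  obtain ⟨C, hC⟩ := hχ.exists_lTwo_coef_third_le
  obtain ⟨E, hE⟩ := hχ.exists_lpENorm_le_lTwo (s := 1 / 3) (by norm_num) (p := 3) Fact.out
  refine ⟨E * C, fun u => (hE u).trans ?_⟩
  push_cast
  rw [mul_assoc]
  gcongr
  exact hC u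

include hχ in
theorem lpENorm_three_lt_top (u : VField) (hu : u ∈ besov χ (1 / 2) (18 / 7) 2) :
    lpENorm 3 u < ⊤ := by
  obtain ⟨C, hC⟩ := hχ.exists_lpENorm_three_le
  exact (hC u).trans_lt (ENNReal.mul_lt_top ENNReal.coe_lt_top
    (hχ.besovENorm_lt_top_iff_lTwo.1 hu))

/-- Fields in `B^{1/3}_{3,2}` as `L³` functions with an absolutely convergent decomposition. -/
def absRep : besov χ (1 / 3) 3 2 →ₗ[ℂ] hχ.absSum three_ne_top :=
  (lpRep 3 _ (hχ.lpENorm_lt_top_of_mem_besov (by norm_num))).codRestrict _ fun u =>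
    hχ.mem_absSum_of_lTwo three_ne_top (s := 1 / 3) (by norm_num) (by
      rw [emb_lpRep]
      exact hχ.lTwo_coef_lt_top u)

theorem emb_absRep (u : besov χ (1 / 3) 3 2) :
    emb 3 (hχ.absRep u : Lp C3 3 (volume : Measure R3)) = u :=
  emb_lpRep (hχ.lpENorm_lt_top_of_mem_besov (by norm_num)) u

/-- The diagonal part of the advective term. -/
def diagField : besov χ (1 / 3) 3 2 →ₗ[ℂ] besov χ (1 / 3) 3 2 →ₗ[ℂ] VField :=
  hχ.advDiag.compl₁₂ hχ.absRep hχ.absRep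

theorem diagField_apply (u v : besov χ (1 / 3) 3 2) :
    hχ.diagField u v = hχ.advDiag (hχ.absRep u) (hχ.absRep v) := rfl

/-- The advective term on `B^{1/3}_{3,2}`. -/
def advField : besov χ (1 / 3) 3 2 →ₗ[ℂ] besov χ (1 / 3) 3 2 →ₗ[ℂ] VField :=
  advL.compl₁₂ ((hχ.absSum three_ne_top).subtype ∘ₗ hχ.absRep)
    ((hχ.absSum three_ne_top).subtype ∘ₗ hχ.absRep)

theorem advField_apply (u v : besov χ (1 / 3) 3 2) :
    hχ.advField u v = advL (hχ.absRep u : Lp C3 3 (volume : Measure R3)) (hχ.absRep v) := rfl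

theorem exists_besovENorm_diagField_le : ∃ K : ℝ≥0, ∀ u v : besov χ (1 / 3) 3 2,
    besovENorm χ (-1 / 3) (3 / 2) 2 (hχ.diagField u v) ≤
      K * besovENorm χ (1 / 3) 3 2 u * besovENorm χ (1 / 3) 3 2 v := by
  obtain ⟨A, hA⟩ := hχ.exists_lTwo_coef_le_besovENorm (1 / 3) 3
  obtain ⟨E, hE⟩ := hχ.exists_besovENorm_le_lTwo_coef (-1 / 3) (3 / 2)
  obtain ⟨K, hK⟩ := hχ.exists_lTwo_coef_advDiag_le
  refine ⟨E * K * A * A, fun u v => (hE _).trans ?_⟩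
  have h := hK (hχ.absRep u) (hχ.absRep v)
  rw [emb_absRep, emb_absRep] at h
  calc _ ≤ E * (K * (A * besovENorm χ (1 / 3) 3 2 u * (A * besovENorm χ (1 / 3) 3 2 v))) := by
        gcongr
        refine (h (hχ.lTwo_coef_lt_top u) (hχ.lTwo_coef_lt_top v)).trans ?_
        gcongr
        · exact hA _
        · exact hA _
    _ = _ := by push_cast; ring

theorem exists_besovENorm_advField_sub_diagField_le : ∃ K : ℝ≥0, ∀ u v : besov χ (1 / 3) 3 2,
    besovENorm χ (-2 / 3) (9 / 5) 2 ((hχ.advField - hχ.diagField) u v) ≤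
      K * besovENorm χ (1 / 3) 3 2 u * besovENorm χ (1 / 3) 3 2 v := by
  obtain ⟨A, hA⟩ := hχ.exists_lTwo_coef_le_besovENorm (1 / 3) 3
  obtain ⟨E, hE⟩ := hχ.exists_besovENorm_le_lTwo_coef (-2 / 3) (9 / 5)
  obtain ⟨K, hK⟩ := hχ.exists_lTwo_coef_advL_sub_advDiag_le
  refine ⟨E * K * A * A, fun u v => (hE _).trans ?_⟩
  have h := hK (hχ.absRep u) (hχ.absRep v)
  rw [emb_absRep, emb_absRep] at h
  calc _ ≤ E * (K * (A * besovENorm χ (1 / 3) 3 2 u * (A * besovENorm χ (1 / 3) 3 2 v))) := by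
        gcongr
        refine (h (hχ.lTwo_coef_lt_top u) (hχ.lTwo_coef_lt_top v)).trans ?_
        gcongr
        · exact hA _
        · exact hA _
    _ = _ := by push_cast; ring

theorem diagField_mem (u v : besov χ (1 / 3) 3 2) :
    hχ.diagField u v ∈ besov χ (-1 / 3) (3 / 2) 2 := by
  obtain ⟨K, hK⟩ := hχ.exists_besovENorm_diagField_le
  exact (hK u v).trans_lt (ENNReal.mul_lt_top (ENNReal.mul_lt_top ENNReal.coe_lt_top u.2) v.2)

theorem advField_sub_diagField_mem (u v : besov χ (1 / 3) 3 2) :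
    (hχ.advField - hχ.diagField) u v ∈ besov χ (-2 / 3) (9 / 5) 2 := by
  obtain ⟨K, hK⟩ := hχ.exists_besovENorm_advField_sub_diagField_le
  exact (hK u v).trans_lt (ENNReal.mul_lt_top (ENNReal.mul_lt_top ENNReal.coe_lt_top u.2) v.2)

end IsLPCutoff

/-! ### The Leray projection of Schwartz fields -/

/-- The symbol of the Leray projector. -/
def lerReal (k l : Fin 3) (η : R3) : ℝ := (if k = l then 1 else 0) - η k * η l / ‖η‖ ^ 2

theorem abs_coord_le (η : R3) (k : Fin 3) : |η k| ≤ ‖η‖ := by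
  simpa using PiLp.norm_apply_le η k

theorem abs_lerReal_le (k l : Fin 3) (η : R3) : |lerReal k l η| ≤ 2 := by
  have h1 : |η k * η l / ‖η‖ ^ 2| ≤ 1 := by
    rw [abs_div, abs_mul, abs_of_nonneg (sq_nonneg ‖η‖)]
    refine div_le_one_of_le₀ ?_ (sq_nonneg _)
    rw [sq]
    exact mul_le_mul (abs_coord_le η k) (abs_coord_le η l) (abs_nonneg _) (norm_nonneg _)
  have h2 : |(if k = l then 1 else 0 : ℝ)| ≤ 1 := by split_ifs <;> simp
  exact (abs_sub _ _).trans (by linarith)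

theorem measurable_lerReal (k l : Fin 3) : Measurable (lerReal k l) := by
  unfold lerReal
  fun_prop

theorem memLp_lerReal_mul (k l : Fin 3) (r : ℝ≥0∞) (φ : 𝓢(R3, ℂ)) :
    MemLp (fun η => (lerReal k l η : ℂ) * φ η) r volume := by
  refine MemLp.of_le_mul (c := 2) (φ.memLp r volume) ?_ (Eventually.of_forall fun η => ?_)
  · exact ((Complex.measurable_ofReal.comp (measurable_lerReal k l)).mul
      φ.continuous.measurable).aestronglyMeasurable
  · rw [norm_mul, Complex.norm_real]
    gcongr
    exact abs_lerReal_le k l η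

/-- The components of a Schwartz field. -/
def comp (k : Fin 3) : 𝓢(R3, C3) →L[ℂ] 𝓢(R3, ℂ) :=
  SchwartzMap.postcompCLM (EuclideanSpace.proj (𝕜 := ℂ) k)

theorem comp_apply (k : Fin 3) (w : 𝓢(R3, C3)) (x : R3) : comp k w x = w x k := rfl

theorem fourier_apply_coord (w : 𝓢(R3, C3)) (ξ : R3) (k : Fin 3) :
    (𝓕 (w : R3 → C3)) ξ k = (𝓕 (comp k w) : 𝓢(R3, ℂ)) ξ := by
  rw [SchwartzMap.fourier_coe, Real.fourier_eq, Real.fourier_eq]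
  have h := ContinuousLinearMap.integral_comp_comm (EuclideanSpace.proj k : C3 →L[ℂ] ℂ)
    ((Real.fourierIntegral_convergent_iff ξ).2 (w.integrable (μ := volume)))
  refine Eq.trans h.symm (integral_congr_ae (Eventually.of_forall fun x => ?_))
  simp [Circle.smul_def, comp_apply]

theorem fourierInv_apply_coord {m : R3 → C3} (hm : Integrable m) (x : R3) (k : Fin 3) :
    𝓕⁻ m x k = 𝓕⁻ (fun ξ => m ξ k) x := by
  rw [Real.fourierInv_eq, Real.fourierInv_eq]
  have h1 : Integrable (fun v => Real.fourierChar (inner ℝ v x) • m v) := by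
    have h := (Real.fourierIntegral_convergent_iff (-x)).2 hm
    simpa using h
  refine Eq.trans (ContinuousLinearMap.integral_comp_comm (EuclideanSpace.proj k : C3 →L[ℂ] ℂ)
    h1).symm (integral_congr_ae (Eventually.of_forall fun x => ?_))
  simp [Circle.smul_def]

theorem fourierInv_sum {ι : Type*} (s : Finset ι) {m : ι → R3 → ℂ} (hm : ∀ i, Integrable (m i))
    (x : R3) : 𝓕⁻ (fun ξ => ∑ i ∈ s, m i ξ) x = ∑ i ∈ s, 𝓕⁻ (m i) x := by
  simp_rw [Real.fourierInv_eq, Finset.smul_sum]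
  refine integral_finsetSum _ fun i _ => ?_
  have h := (Real.fourierIntegral_convergent_iff (-x)).2 (hm i)
  simpa using h

theorem leray_apply (w : 𝓢(R3, C3)) (x : R3) (k : Fin 3) :
    leray w x k = ∑ l, 𝓕⁻ (fun η => (lerReal k l η : ℂ) * (𝓕 (comp l w) : 𝓢(R3, ℂ)) η) x := by
  have hi : ∀ k l, Integrable fun η => (lerReal k l η : ℂ) * (𝓕 (comp l w) : 𝓢(R3, ℂ)) η :=
    fun k l => memLp_one_iff_integrable.1 (memLp_lerReal_mul k l 1 _)
  rw [← fourierInv_sum _ (hi k)]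
  set m : R3 → C3 := fun ξ : R3 => (𝓕 (w : R3 → C3)) ξ -
    ((∑ j : Fin 3, ((ξ j : ℝ) : ℂ) * (𝓕 (w : R3 → C3)) ξ j) / ((‖ξ‖ ^ 2 : ℝ) : ℂ)) • toC3 ξ with hm
  have hmk : ∀ ξ k, m ξ k = ∑ l, (lerReal k l ξ : ℂ) * (𝓕 (comp l w) : 𝓢(R3, ℂ)) ξ := by
    intro ξ k
    have h : m ξ k = (𝓕 (w : R3 → C3)) ξ k - ((∑ j : Fin 3, ((ξ j : ℝ) : ℂ) *
      (𝓕 (w : R3 → C3)) ξ j) / ((‖ξ‖ ^ 2 : ℝ) : ℂ)) * ((ξ k : ℝ) : ℂ) := rfl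
    rw [h]
    simp only [fourier_apply_coord, lerReal, Fin.sum_univ_three]
    fin_cases k <;> simp <;> ring
  -- Integrability of the vector symbol is what allows components to be taken inside the integral.
  have hmi : Integrable m := by
    have h : m = fun ξ => ∑ k, (∑ l, (lerReal k l ξ : ℂ) * (𝓕 (comp l w) : 𝓢(R3, ℂ)) ξ) •
        EuclideanSpace.single k (1 : ℂ) := by
      ext ξ i
      rw [hmk]
      simp [Finset.sum_apply, Pi.single_apply]
    rw [h]
    exact integrable_finsetSum _ fun k _ =>
      (integrable_finsetSum _ fun l _ => hi k l).smul_const _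
  refine (fourierInv_apply_coord hmi x k).trans ?_
  simp_rw [hmk]

/-- The derivative of an inverse Fourier transform. -/
theorem hasFDerivAt_fourierInv {m : R3 → ℂ} (hm : Integrable m)
    (hm' : Integrable fun ξ => ‖ξ‖ * ‖m ξ‖) (x : R3) :
    ∃ L : R3 →L[ℝ] ℂ, HasFDerivAt (𝓕⁻ m) L x ∧
      ∀ v, L v = 𝓕⁻ (fun ξ => (2 * Real.pi * Complex.I) * ((inner ℝ ξ v : ℝ) : ℂ) * m ξ) x := by
  have h1 : Integrable fun ξ => m (-ξ) := hm.comp_neg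
  have h2 : Integrable fun ξ => ‖ξ‖ * ‖m (-ξ)‖ := by simpa using hm'.comp_neg
  refine ⟨_, by
    rw [Real.fourierInv_eq_fourier_comp_neg]
    exact Real.hasFDerivAt_fourier h1 h2 x, fun v => ?_⟩
  have h3 : Integrable (VectorFourier.fourierSMulRight (innerSL ℝ) fun ξ => m (-ξ)) := by
    refine (h2.const_mul (2 * Real.pi * ‖innerSL ℝ (E := R3)‖)).mono' ?_
      (Eventually.of_forall fun ξ => ?_)
    · exact h1.1.fourierSMulRight
    · refine (VectorFourier.norm_fourierSMulRight_le _ _ _).trans (le_of_eq ?_)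
      ring
  rw [Real.fourier_continuousLinearMap_apply h3, Real.fourierInv_eq_fourier_comp_neg]
  refine congrArg (fun F : R3 → ℂ => 𝓕 F x) (funext fun ξ => ?_)
  have h4 : innerSL ℝ ξ v = inner ℝ ξ v := rfl
  simp [VectorFourier.fourierSMulRight_apply, h4]
  ring

theorem integrable_norm_mul_lerReal (k l : Fin 3) (φ : 𝓢(R3, ℂ)) :
    Integrable fun η => ‖η‖ * ‖(lerReal k l η : ℂ) * φ η‖ := by
  have h := (φ.integrable_pow_mul (volume : Measure R3) 1).const_mul 2
  refine h.mono' ?_ (Eventually.of_forall fun η => ?_)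
  · exact (continuous_norm.aestronglyMeasurable).mul (memLp_lerReal_mul k l 1 φ).1.norm
  · rw [norm_mul, norm_norm, norm_norm, norm_mul, Complex.norm_real, pow_one, ← mul_assoc,
      mul_comm ‖η‖, mul_assoc]
    gcongr
    exact abs_lerReal_le k l η

theorem hasFDerivAt_leray_apply (w : 𝓢(R3, C3)) (x : R3) (k : Fin 3) :
    ∃ L : R3 →L[ℝ] ℂ, HasFDerivAt (fun x => leray w x k) L x ∧ ∀ j, L (basisVec j) =
      ∑ l, 𝓕⁻ (fun η => advSym j k l η * (𝓕 (comp l w) : 𝓢(R3, ℂ)) η) x := by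
  choose L hL hL' using fun l => hasFDerivAt_fourierInv
    (memLp_one_iff_integrable.1 (memLp_lerReal_mul k l 1 (𝓕 (comp l w))))
    (integrable_norm_mul_lerReal k l (𝓕 (comp l w))) x
  refine ⟨∑ l, L l, ?_, fun j => ?_⟩
  · simp_rw [leray_apply]
    exact HasFDerivAt.fun_sum fun l _ => hL l
  · rw [sum_apply]
    refine Finset.sum_congr rfl fun l _ => (hL' l _).trans ?_
    refine congrArg (fun F : R3 → ℂ => 𝓕⁻ F x) (funext fun ξ => ?_)
    rw [advSym, advReal, basisVec, EuclideanSpace.inner_single_right, lerReal]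
    simp
    ring

theorem differentiable_leray (w : 𝓢(R3, C3)) : Differentiable ℝ (leray w) := fun x => by
  refine (differentiableAt_piLp 2).2 fun k => ?_
  obtain ⟨L, hL, -⟩ := hasFDerivAt_leray_apply w x k
  exact hL.differentiableAt

theorem fderiv_apply_coord {f : R3 → C3} {x : R3} (hf : DifferentiableAt ℝ f x) (v : R3)
    (k : Fin 3) : fderiv ℝ f x v k = fderiv ℝ (fun x => f x k) x v := by
  have h := (((EuclideanSpace.proj k : C3 →L[ℂ] ℂ).restrictScalars ℝ).hasFDerivAt).comp x
    hf.hasFDerivAt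
  exact (congrArg (fun L : R3 →L[ℝ] ℂ => L v) h.fderiv).symm

theorem partialD_leray (w : 𝓢(R3, C3)) (x : R3) (j k : Fin 3) : partialD j (leray w) x k =
    ∑ l, 𝓕⁻ (fun η => advSym j k l η * (𝓕 (comp l w) : 𝓢(R3, ℂ)) η) x := by
  obtain ⟨L, hL, hL'⟩ := hasFDerivAt_leray_apply w x k
  rw [partialD, fderiv_apply_coord (differentiable_leray w x), hL.fderiv, hL']

/-- The substitution `η ↦ -η` exchanges `𝓕` and `𝓕⁻`; oddness of `σ` produces the sign, which later
cancels the one in `advection`. -/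
theorem IsDerivSymbol.fourierInv_eq {σ : R3 → ℂ} (hσ : IsDerivSymbol σ) (φ : 𝓢(R3, ℂ)) (x : R3) :
    𝓕⁻ (fun η => σ η * (𝓕 φ : 𝓢(R3, ℂ)) η) x = -𝓕 (fun η => σ η * (𝓕⁻ φ : 𝓢(R3, ℂ)) η) x := by
  rw [Real.fourierInv_eq_fourier_comp_neg, Real.fourier_eq, Real.fourier_eq, ← integral_neg]
  refine integral_congr_ae (Eventually.of_forall fun η => ?_)
  beta_reduce
  rw [hσ.odd, SchwartzMap.fourier_coe, SchwartzMap.fourierInv_coe, Real.fourierInv_eq_fourier_neg,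
    neg_mul, smul_neg]

theorem partialD_leray_eq (w : 𝓢(R3, C3)) (x : R3) (j k : Fin 3) : partialD j (leray w) x k =
    -∑ l, 𝓕 (fun η => advSym j k l η * (𝓕⁻ (comp l w) : 𝓢(R3, ℂ)) η) x := by
  rw [partialD_leray, ← Finset.sum_neg_distrib]
  exact Finset.sum_congr rfl fun l _ => (isDerivSymbol_advSym j k l).fourierInv_eq _ _

/-- With exponent three this makes the integral defining `advection` converge for fields in `L³`. -/
theorem memLp_partialD_leray {q : ℝ≥0∞} (hq2 : 2 ≤ q) (hq : q ≠ ⊤) (w : 𝓢(R3, C3))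
    (j k : Fin 3) : MemLp (fun x => partialD j (leray w) x k) q volume := by
  simp_rw [partialD_leray_eq]
  exact (memLp_finsetSum _ fun l _ =>
    (isDerivSymbol_advSym j k l).memLp_fourier hq2 hq (𝓕⁻ (comp l w))).neg

theorem memLp_leray {q : ℝ≥0∞} (hq2 : 2 ≤ q) (hq : q ≠ ⊤) (w : 𝓢(R3, C3)) (k : Fin 3) :
    MemLp (fun x => leray w x k) q volume := by
  simp_rw [leray_apply, Real.fourierInv_eq_fourier_comp_neg]
  refine memLp_finsetSum _ fun l _ => ?_
  have h : ∀ r, MemLp (fun η => (lerReal k l (-η) : ℂ) * (𝓕 (comp l w) : 𝓢(R3, ℂ)) (-η)) r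
      (volume : Measure R3) := fun r =>
    (memLp_lerReal_mul k l r (𝓕 (comp l w))).comp_measurePreserving
      (Measure.measurePreserving_neg (volume : Measure R3))
  exact (eLpNorm_fourier_le hq2 hq (h 1) (h 2)).1

/-- The advective term as a distribution. -/
theorem pair_advL (F G : Lp C3 3 (volume : Measure R3)) (w : 𝓢(R3, C3)) :
    pair (advL F G) w = advection F G w := by
  have hFG : ∀ j k : Fin 3, MemLp (fun x => F x j * G x k) (3 / 2) volume := fun j k =>
    ((Lp.memLp G).continuousLinearMap_comp (EuclideanSpace.proj k : C3 →L[ℂ] ℂ)).mul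
      (((Lp.memLp F).continuousLinearMap_comp (EuclideanSpace.proj j : C3 →L[ℂ] ℂ)))
  set m : Fin 3 → Fin 3 → Fin 3 → R3 → ℂ := fun j k l =>
    𝓕 (fun η => advSym j k l η * (𝓕⁻ (comp l w) : 𝓢(R3, ℂ)) η) with hm
  have hmem : ∀ j k l, MemLp (m j k l) 3 volume := fun j k l =>
    (isDerivSymbol_advSym j k l).memLp_fourier two_le_three three_ne_top (𝓕⁻ (comp l w))
  have hint : ∀ j k l, Integrable fun x => F x j * G x k * m j k l x := fun j k l =>
    memLp_one_iff_integrable.1 ((hmem j k l).mul (hFG j k))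
  -- The product of a triple `(j,k,l)` points along `e_l`, so the pairing with `w` keeps only the
  -- component `w_l`.
  have h1 : ∀ (x : Idx) (l : Fin 3), advMul x ((idxBil x).holder (3 / 2) F G) (comp l w) l =
      if x.2.2 = l then ∫ y, F y x.1 * G y x.2.1 * m x.1 x.2.1 l y else 0 := fun x l => by
    have hi : Integrable (fun y => (𝓕 fun η => advSym x.1 x.2.1 x.2.2 η *
        (𝓕⁻ (comp l w) : 𝓢(R3, ℂ)) η) y • ((idxBil x).holder (3 / 2) F G) y) := by
      rw [← memLp_one_iff_integrable]
      exact (Lp.memLp _).smul ((isDerivSymbol_advSym' x).memLp_fourier two_le_three three_ne_top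
        (𝓕⁻ (comp l w)))
    rw [advMul, IsDerivSymbol.hmul_apply]
    refine (ContinuousLinearMap.integral_comp_comm (EuclideanSpace.proj l : C3 →L[ℂ] ℂ)
      hi).symm.trans ?_
    have h2 : (fun y => (EuclideanSpace.proj l : C3 →L[ℂ] ℂ) ((𝓕 fun η => advSym x.1 x.2.1 x.2.2 η *
        (𝓕⁻ (comp l w) : 𝓢(R3, ℂ)) η) y • ((idxBil x).holder (3 / 2) F G) y)) =ᵐ[volume]
        fun y => if x.2.2 = l then F y x.1 * G y x.2.1 * m x.1 x.2.1 l y else 0 := by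
      filter_upwards [(idxBil x).coeFn_holder (r := 3 / 2) F G] with y hy
      rw [hy, idxBil, bil_apply]
      split_ifs with h
      · subst h
        simp [hm]
        ring
      · simp [Ne.symm h]
    rw [integral_congr_ae h2]
    split_ifs with h
    · rfl
    · simp
  have h3 : ∀ x, ∑ j : Fin 3, ∑ k : Fin 3, F x j * G x k * partialD j (leray w) x k =
      -∑ j : Fin 3, ∑ k : Fin 3, ∑ l : Fin 3, F x j * G x k * m j k l x := fun x => by
    simp_rw [partialD_leray_eq, mul_neg, Finset.mul_sum, Finset.sum_neg_distrib]
    rfl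
  rw [advection, advL_apply]
  simp_rw [h3]
  rw [integral_neg, neg_neg, integral_finsetSum _ fun j _ => integrable_finsetSum _ fun k _ =>
    integrable_finsetSum _ fun l _ => hint j k l]
  have h4 : ∀ l : Fin 3, (∑ x : Idx, advMul x ((idxBil x).holder (3 / 2) F G)) (comp l w) l =
      ∑ x : Idx, advMul x ((idxBil x).holder (3 / 2) F G) (comp l w) l := fun l => by
    rw [sum_apply]
    simp
  rw [pair]
  refine (Finset.sum_congr rfl fun l _ => (h4 l).trans (Finset.sum_congr rfl fun x _ =>
    h1 x l)).trans ?_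
  rw [Finset.sum_comm]
  simp_rw [Finset.sum_ite_eq, Finset.mem_univ, if_true, Fintype.sum_prod_type]
  refine Finset.sum_congr rfl fun j _ => ?_
  rw [integral_finsetSum _ fun k _ => integrable_finsetSum _ fun l _ => hint j k l]
  refine Finset.sum_congr rfl fun k _ => ?_
  rw [integral_finsetSum _ fun l _ => hint j k l]

/-- For smooth fields with divergence-free `f`, `ℙ div (f ⊗ g) = ℙ (f · ∇) g`. -/
theorem advection_eq_integral_convect {f g : R3 → C3} (hf : ContDiff ℝ ∞ f) (hg : ContDiff ℝ ∞ g)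
    (hf3 : MemLp f 3 volume) (hg3 : MemLp g 3 volume) (hf' : MemLp (fderiv ℝ f) 3 volume)
    (hg' : MemLp (fderiv ℝ g) 3 volume) (hdiv : ∀ x, ∑ j : Fin 3, partialD j f x j = 0)
    (w : 𝓢(R3, C3)) : advection f g w = ∫ x, dot (convect f g x) (leray w x) := by
  have hdf : Differentiable ℝ f := hf.differentiable (by simp)
  have hdg : Differentiable ℝ g := hg.differentiable (by simp)
  have hc : ∀ {f : R3 → C3}, Differentiable ℝ f → ∀ k, Differentiable ℝ fun x => f x k :=
    fun h k x => ((((EuclideanSpace.proj k : C3 →L[ℂ] ℂ).restrictScalars ℝ).hasFDerivAt).comp x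
      (h x).hasFDerivAt).differentiableAt
  have hm : ∀ {f : R3 → C3}, MemLp f 3 volume → ∀ k, MemLp (fun x => f x k) 3 volume :=
    fun h k => h.continuousLinearMap_comp (EuclideanSpace.proj k : C3 →L[ℂ] ℂ)
  have hm' : ∀ {f : R3 → C3}, MemLp (fderiv ℝ f) 3 volume → ∀ j k,
      MemLp (fun x => partialD j f x k) 3 volume := fun h j k =>
    h.continuousLinearMap_comp (((EuclideanSpace.proj k : C3 →L[ℂ] ℂ).restrictScalars ℝ).comp
      (ContinuousLinearMap.apply ℝ C3 (basisVec j)))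
  have h32 : ∀ {a b : R3 → ℂ}, MemLp a 3 volume → MemLp b 3 volume →
      MemLp (fun x => a x * b x) (3 / 2) volume := fun ha hb => hb.mul ha
  have h1 : ∀ {a b : R3 → ℂ}, MemLp a (3 / 2) volume → MemLp b 3 volume →
      Integrable fun x => a x * b x := fun ha hb => memLp_one_iff_integrable.1 (hb.mul ha)
  have hl := memLp_leray two_le_three three_ne_top w
  have hl' := memLp_partialD_leray two_le_three three_ne_top w
  have hi1 : ∀ j k, Integrable fun x => f x j * g x k * partialD j (leray w) x k :=
    fun j k => h1 (h32 (hm hf3 j) (hm hg3 k)) (hl' j k)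
  have hi2 : ∀ j k, Integrable fun x => f x j * partialD j g x k * leray w x k :=
    fun j k => h1 (h32 (hm hf3 j) (hm' hg' j k)) (hl k)
  have hi3 : ∀ j k, Integrable fun x => partialD j f x j * g x k * leray w x k :=
    fun j k => h1 (h32 (hm' hf' j j) (hm hg3 k)) (hl k)
  have hi4 : ∀ j k, Integrable fun x => f x j * partialD j g x k * leray w x k +
      partialD j f x j * g x k * leray w x k := fun j k => (hi2 j k).add (hi3 j k)
  have hp : ∀ j k x, fderiv ℝ (fun x => f x j * g x k) x (basisVec j) =
      f x j * partialD j g x k + partialD j f x j * g x k := fun j k x => by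
    rw [fderiv_fun_mul (hc hdf j x) (hc hdg k x), partialD, partialD, fderiv_apply_coord (hdf x),
      fderiv_apply_coord (hdg x)]
    simp [mul_comm]
  -- Integration by parts; every product is integrable by Hölder with three factors in `L³`.
  have key : ∀ j k, ∫ x, f x j * g x k * partialD j (leray w) x k =
      -∫ x, (f x j * partialD j g x k * leray w x k + partialD j f x j * g x k * leray w x k) := by
    intro j k
    have e : ∀ x, partialD j (leray w) x k = fderiv ℝ (fun x => leray w x k) x (basisVec j) :=
      fun x => fderiv_apply_coord (differentiable_leray w x) _ k
    simp_rw [e]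
    rw [integral_mul_fderiv_eq_neg_fderiv_mul_of_integrable]
    · simp_rw [hp, add_mul]
    · simp_rw [hp, add_mul]
      exact (hi2 j k).add (hi3 j k)
    · simp_rw [← e]
      exact hi1 j k
    · exact h1 (h32 (hm hf3 j) (hm hg3 k)) (hl k)
    · exact fun x _ => (hc hdf j x).mul (hc hdg k x)
    · exact fun x _ => hc (differentiable_leray w) k x
  rw [advection, integral_finsetSum _ fun j _ => integrable_finsetSum _ fun k _ => hi1 j k]
  have e1 : ∀ j, ∫ x, ∑ k, f x j * g x k * partialD j (leray w) x k =
      -∫ x, ∑ k, (f x j * partialD j g x k * leray w x k +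
        partialD j f x j * g x k * leray w x k) := fun j => by
    rw [integral_finsetSum _ fun k _ => hi1 j k,
      integral_finsetSum _ fun k _ => hi4 j k, ← Finset.sum_neg_distrib]
    exact Finset.sum_congr rfl fun k _ => key j k
  rw [Finset.sum_congr rfl fun j _ => e1 j, Finset.sum_neg_distrib, neg_neg,
    ← integral_finsetSum _ fun j _ => integrable_finsetSum _ fun k _ => hi4 j k]
  refine integral_congr_ae (Eventually.of_forall fun x => ?_)
  -- The terms with derivatives of `f` add up to its divergence, which vanishes.
  have hd := hdiv x
  have e2 : ∑ j, ∑ k, (f x j * partialD j g x k * leray w x k +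
      partialD j f x j * g x k * leray w x k) =
      (∑ k, (∑ j, f x j * partialD j g x k) * leray w x k) +
        (∑ j, partialD j f x j) * ∑ k, g x k * leray w x k := by
    simp only [Fin.sum_univ_three]
    ring
  beta_reduce
  rw [e2, hd, zero_mul, add_zero, dot]
  simp [convect, Finset.sum_apply]

/-! ### Real fields -/

/-- Complex conjugation of test functions. -/
def conjS : 𝓢(R3, ℂ) →L[ℝ] 𝓢(R3, ℂ) :=
  SchwartzMap.postcompCLM (Complex.conjCLE : ℂ →L[ℝ] ℂ)

theorem conjS_apply (φ : 𝓢(R3, ℂ)) (x : R3) : conjS φ x = starRingEnd ℂ (φ x) := rfl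

/-- Real and imaginary parts of `φ` are real test functions. The resulting commutation with
conjugation is equivalent to being real, and it passes directly through Fourier multipliers. -/
theorem IsRealField.apply_conjS {u : VField} (hu : IsRealField u) (φ : 𝓢(R3, ℂ)) (k : Fin 3) :
    u (conjS φ) k = starRingEnd ℂ (u φ k) := by
  set a : 𝓢(R3, ℂ) := SchwartzMap.postcompCLM (Complex.ofRealCLM ∘L Complex.reCLM) φ with ha
  set b : 𝓢(R3, ℂ) := SchwartzMap.postcompCLM (Complex.ofRealCLM ∘L Complex.imCLM) φ with hb
  have ha' : ∀ x, a x = ((φ x).re : ℂ) := fun x => rfl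
  have hb' : ∀ x, b x = ((φ x).im : ℂ) := fun x => rfl
  have h1 : φ = a + Complex.I • b := by
    ext x
    rw [add_apply, smul_apply, ha', hb', smul_eq_mul, mul_comm, Complex.re_add_im]
  have h2 : conjS φ = a - Complex.I • b := by
    ext x
    rw [sub_apply, smul_apply, conjS_apply, ha', hb', smul_eq_mul]
    apply Complex.ext <;> simp
  have h3 := Complex.conj_eq_iff_im.2 (hu a (fun x => by simp [ha']) k)
  have h4 := Complex.conj_eq_iff_im.2 (hu b (fun x => by simp [hb']) k)
  rw [h2]
  conv_rhs => rw [h1]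
  rw [map_add, map_sub, map_smul]
  simp only [PiLp.add_apply, PiLp.sub_apply, PiLp.smul_apply, smul_eq_mul, map_add, map_mul, h3, h4,
    Complex.conj_I]
  ring

theorem isRealField_of_conjS {u : VField}
    (h : ∀ φ k, u (conjS φ) k = starRingEnd ℂ (u φ k)) : IsRealField u := fun φ hφ k => by
  have h1 : conjS φ = φ := by
    ext x
    exact Complex.conj_eq_iff_im.2 (hφ x)
  have h2 := h φ k
  rw [h1] at h2
  exact Complex.conj_eq_iff_im.1 h2.symm

theorem IsRealField.add {u v : VField} (hu : IsRealField u) (hv : IsRealField v) :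
    IsRealField (u + v) := fun φ hφ k => by
  have h : (u + v) φ k = u φ k + v φ k := rfl
  rw [h, Complex.add_im, hu φ hφ k, hv φ hφ k, add_zero]

theorem IsRealField.sub {u v : VField} (hu : IsRealField u) (hv : IsRealField v) :
    IsRealField (u - v) := fun φ hφ k => by
  have h : (u - v) φ k = u φ k - v φ k := rfl
  rw [h, Complex.sub_im, hu φ hφ k, hv φ hφ k, sub_zero]

theorem IsRealField.sum {ι : Type*} (s : Finset ι) {u : ι → VField}
    (hu : ∀ i ∈ s, IsRealField (u i)) : IsRealField (∑ i ∈ s, u i) := by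
  classical
  induction s using Finset.induction_on with
  | empty =>
    intro φ _ k
    have h : (0 : VField) φ k = 0 := rfl
    rw [Finset.sum_empty, h, Complex.zero_im]
  | insert i s hi ih =>
    rw [Finset.sum_insert hi]
    exact (hu i (Finset.mem_insert_self i s)).add
      (ih fun j hj => hu j (Finset.mem_insert_of_mem hj))

theorem isRealField_of_tendsto {u : ℕ → VField} {v : VField} (hu : ∀ n, IsRealField (u n))
    (h : ∀ φ, Tendsto (fun n => u n φ) atTop (𝓝 (v φ))) : IsRealField v := fun φ hφ k => by
  have hc : Continuous fun z : C3 => (z k).im := by fun_prop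
  refine tendsto_nhds_unique ((hc.tendsto _).comp (h φ)) ?_
  refine tendsto_const_nhds.congr fun n => ?_
  exact (hu n φ hφ k).symm

theorem fourier_conj (f : R3 → ℂ) (ξ : R3) :
    𝓕 (fun x => starRingEnd ℂ (f x)) ξ = starRingEnd ℂ (𝓕⁻ f ξ) := by
  rw [Real.fourier_eq, Real.fourierInv_eq, ← integral_conj]
  refine integral_congr_ae (Eventually.of_forall fun x => ?_)
  simp [Circle.smul_def, AddChar.map_neg_eq_inv]

/-- Hermitian symbols commute with conjugation: conjugating in space reflects and conjugates the
transform. -/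
theorem fourier_mul_conjS {σ : R3 → ℂ} (hσ : ∀ η, starRingEnd ℂ (σ η) = σ (-η)) (φ : 𝓢(R3, ℂ))
    (x : R3) : 𝓕 (fun η => σ η * (𝓕⁻ (conjS φ) : 𝓢(R3, ℂ)) η) x =
      starRingEnd ℂ (𝓕 (fun η => σ η * (𝓕⁻ φ : 𝓢(R3, ℂ)) η) x) := by
  have h1 : ∀ η, (𝓕⁻ (conjS φ) : 𝓢(R3, ℂ)) η = starRingEnd ℂ ((𝓕⁻ φ : 𝓢(R3, ℂ)) (-η)) := by
    intro η
    rw [SchwartzMap.fourierInv_coe, SchwartzMap.fourierInv_coe, Real.fourierInv_eq_fourier_neg,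
      ← fourier_conj]
    rfl
  have h2 : (fun η => σ η * (𝓕⁻ (conjS φ) : 𝓢(R3, ℂ)) η) = fun η =>
      starRingEnd ℂ (σ (-η) * (𝓕⁻ φ : 𝓢(R3, ℂ)) (-η)) := by
    ext η
    rw [h1, map_mul, hσ, neg_neg]
  rw [h2, fourier_conj, Real.fourierInv_eq_fourier_comp_neg]
  simp

theorem IsRealField.Mul {u : VField} (hu : IsRealField u) {a : R3 → ℂ} (ha : a.HasTemperateGrowth)
    (h : ∀ η, starRingEnd ℂ (a η) = a (-η)) : IsRealField (Mul a u) := by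
  refine isRealField_of_conjS fun φ k => ?_
  rw [TemperedDistribution.fourierMultiplierCLM_apply_apply,
    TemperedDistribution.fourierMultiplierCLM_apply_apply, ← hu.apply_conjS]
  refine congrArg (fun ψ : 𝓢(R3, ℂ) => u ψ k) (SchwartzMap.ext fun x => ?_)
  rw [conjS_apply, SchwartzMap.fourier_coe, SchwartzMap.fourier_coe]
  have h1 : ∀ ψ : 𝓢(R3, ℂ), (SchwartzMap.smulLeftCLM ℂ a ψ : R3 → ℂ) = fun η => a η * ψ η :=
    fun ψ => funext fun η => by rw [SchwartzMap.smulLeftCLM_apply_apply ha, smul_eq_mul]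
  rw [h1, h1]
  exact fourier_mul_conjS h φ x

theorem integral_smul_coord {g : R3 → ℂ} {f : R3 → C3} (h : Integrable fun x => g x • f x)
    (k : Fin 3) : (∫ x, g x • f x) k = ∫ x, g x * f x k :=
  (ContinuousLinearMap.integral_comp_comm (EuclideanSpace.proj k : C3 →L[ℂ] ℂ) h).symm

theorem integrable_schwartz_smul {p : ℝ≥0∞} (hp : 1 ≤ p) (φ : 𝓢(R3, ℂ)) {f : R3 → C3}
    (hf : MemLp f p volume) : Integrable fun x => φ x • f x := by
  have : ENNReal.HolderConjugate p (1 - p⁻¹)⁻¹ := ENNReal.HolderConjugate.inv_one_sub_inv' hp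
  rw [← memLp_one_iff_integrable]
  exact hf.smul (φ.memLp (1 - p⁻¹)⁻¹ volume)

/-- Real fields are represented by real functions. -/
theorem IsLpFun.ae_real {p : ℝ≥0∞} (hp : 1 ≤ p) {u : VField} {f : R3 → C3} (hf : IsLpFun p u f)
    (hu : IsRealField u) : ∀ᵐ x, ∀ k, (f x k).im = 0 := by
  rw [ae_all_iff]
  intro k
  have h1 : ∀ φ : 𝓢(R3, ℂ), u φ k = ∫ x, φ x * f x k := fun φ => by
    rw [hf.2 φ, integral_smul_coord (integrable_schwartz_smul hp φ hf.1)]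
  have hm : MemLp (fun x => f x k) p volume :=
    hf.1.continuousLinearMap_comp (EuclideanSpace.proj k : C3 →L[ℂ] ℂ)
  have hm' : MemLp (fun x => starRingEnd ℂ (f x k)) p volume :=
    hm.continuousLinearMap_comp (Complex.conjCLE : ℂ →L[ℝ] ℂ)
  have h2 := ae_eq_of_forall_integral_smul_eq (hm'.locallyIntegrable hp) (hm.locallyIntegrable hp) fun φ => by
    have h3 := hu.apply_conjS (conjS φ) k
    have h4 : conjS (conjS φ) = φ := by ext x; simp [conjS_apply]
    rw [h4, h1, h1, ← integral_conj] at h3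
    simp only [conjS_apply, map_mul, Complex.conj_conj] at h3
    simpa only [smul_eq_mul] using h3.symm
  filter_upwards [h2] with x hx
  exact Complex.conj_eq_iff_im.1 hx

theorem IsLpFun.isRealField {p : ℝ≥0∞} (hp : 1 ≤ p) {u : VField} {f : R3 → C3}
    (hf : IsLpFun p u f) (h : ∀ᵐ x, ∀ k, (f x k).im = 0) : IsRealField u := by
  refine isRealField_of_conjS fun φ k => ?_
  rw [hf.2, hf.2, integral_smul_coord (integrable_schwartz_smul hp _ hf.1),
    integral_smul_coord (integrable_schwartz_smul hp _ hf.1), ← integral_conj]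
  refine integral_congr_ae ?_
  filter_upwards [h] with x hx
  rw [conjS_apply, map_mul, Complex.conj_eq_iff_im.2 (hx k)]

theorem isRealField_emb_iff {p : ℝ≥0∞} [hp : Fact (1 ≤ p)] (f : Lp C3 p (volume : Measure R3)) :
    IsRealField (emb p f) ↔ ∀ᵐ x, ∀ k, (f x k).im = 0 :=
  ⟨(isLpFun_emb f).ae_real hp.out, (isLpFun_emb f).isRealField hp.out⟩

theorem isRealField_emb_holder {p q r : ℝ≥0∞} [Fact (1 ≤ p)] [Fact (1 ≤ q)] [Fact (1 ≤ r)]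
    [ENNReal.HolderTriple p q r] (x : Idx) {f : Lp C3 p (volume : Measure R3)}
    {g : Lp C3 q (volume : Measure R3)} (hf : IsRealField (emb p f)) (hg : IsRealField (emb q g)) :
    IsRealField (emb r ((idxBil x).holder r f g)) := by
  rw [isRealField_emb_iff] at hf hg ⊢
  filter_upwards [hf, hg, (idxBil x).coeFn_holder (r := r) f g] with y h1 h2 h3 k
  rw [h3, idxBil, bil_apply, PiLp.smul_apply, smul_eq_mul]
  have h4 : (EuclideanSpace.single x.2.2 (1 : ℂ) : C3) k =
      ((if k = x.2.2 then 1 else 0 : ℝ) : ℂ) := by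
    split_ifs with h <;> simp [h]
  rw [h4, Complex.im_mul_ofReal, Complex.mul_im, h1, h2]
  simp

theorem IsDerivSymbol.isRealField_hmul {σ : R3 → ℂ} (hσ : IsDerivSymbol σ) {p q : ℝ≥0∞}
    [Fact (1 ≤ p)] [Fact (1 ≤ q)] [ENNReal.HolderConjugate p q] (hq2 : 2 ≤ q) (hq : q ≠ ⊤)
    {f : Lp C3 p (volume : Measure R3)} (hf : IsRealField (emb p f)) :
    IsRealField (hσ.hmul hq2 hq f) := by
  rw [isRealField_emb_iff] at hf
  have hi : ∀ φ : 𝓢(R3, ℂ), Integrable fun x =>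
      (𝓕 fun η => σ η * (𝓕⁻ φ : 𝓢(R3, ℂ)) η) x • f x := fun φ => by
    rw [← memLp_one_iff_integrable]
    exact (Lp.memLp f).smul (hσ.memLp_fourier hq2 hq (𝓕⁻ φ))
  refine isRealField_of_conjS fun φ k => ?_
  rw [hmul_apply, hmul_apply, integral_smul_coord (hi _), integral_smul_coord (hi _),
    ← integral_conj]
  refine integral_congr_ae ?_
  filter_upwards [hf] with x hx
  rw [fourier_mul_conjS (fun η => hσ.conj η), map_mul, Complex.conj_eq_iff_im.2 (hx k)]

theorem isRealField_advL {f g : Lp C3 3 (volume : Measure R3)} (hf : IsRealField (emb 3 f))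
    (hg : IsRealField (emb 3 g)) : IsRealField (advL f g) := by
  rw [advL_apply]
  exact IsRealField.sum _ fun x _ => IsDerivSymbol.isRealField_hmul _ _ _
    (isRealField_emb_holder x hf hg)

namespace IsLPCutoff

variable {χ : R3 → ℝ} (hχ : IsLPCutoff χ)

theorem isRealField_D (n : ℕ) {u : VField} (hu : IsRealField u) : IsRealField (hχ.D n u) :=
  hu.Mul (hχ.dSym n).hasTemperateGrowth fun η => by rw [hχ.conj_dSym, hχ.dSym_neg]

theorem isRealField_S (n : ℕ) {u : VField} (hu : IsRealField u) : IsRealField (hχ.S n u) :=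
  hu.Mul (hχ.sSym n).hasTemperateGrowth fun η => by rw [hχ.conj_sSym, hχ.sSym_neg]

theorem isRealField_emb_diag {p r : ℝ≥0∞} [Fact (1 ≤ p)] [Fact (1 ≤ r)]
    [ENNReal.HolderTriple p p r] (hp' : p ≠ ⊤) (x : Idx) {f g : hχ.absSum hp'}
    (hf : IsRealField (emb p (f : Lp C3 p volume))) (hg : IsRealField (emb p (g : Lp C3 p volume))) :
    IsRealField (emb r (hχ.diag hp' (idxBil x) f g)) := by
  have hd : ∀ {f : Lp C3 p (volume : Measure R3)}, IsRealField (emb p f) → ∀ n,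
      IsRealField (emb p (hχ.dL hp' n f)) := fun h n => by
    rw [emb_dL]
    exact hχ.isRealField_D n h
  refine isRealField_of_tendsto (u := fun N => emb r (∑ n ∈ Finset.range N, (idxBil x).holder r
    (hχ.dL hp' n (f : Lp C3 p volume)) (hχ.dL hp' n (g : Lp C3 p volume)))) (fun N => ?_) fun φ => ?_
  · rw [map_sum]
    exact IsRealField.sum _ fun n _ => isRealField_emb_holder x (hd hf n) (hd hg n)
  · have hc : Continuous fun f : Lp C3 r (volume : Measure R3) => emb r f φ :=
      (PointwiseConvergenceCLM.evalCLM (RingHom.id ℂ) C3 φ).continuous.comp (emb r).continuous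
    exact (hc.tendsto _).comp (hχ.tendsto_diag hp' (idxBil x) f g)

theorem isRealField_diagField {u v : besov χ (1 / 3) 3 2} (hu : IsRealField (u : VField))
    (hv : IsRealField (v : VField)) : IsRealField (hχ.diagField u v) := by
  rw [diagField_apply, advDiag_apply]
  rw [← hχ.emb_absRep] at hu hv
  exact IsRealField.sum _ fun x _ => IsDerivSymbol.isRealField_hmul _ _ _
    (hχ.isRealField_emb_diag three_ne_top x hu hv)

theorem isRealField_advField {u v : besov χ (1 / 3) 3 2} (hu : IsRealField (u : VField))
    (hv : IsRealField (v : VField)) : IsRealField (hχ.advField u v) := by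
  rw [advField_apply]
  rw [← hχ.emb_absRep] at hu hv
  exact isRealField_advL hu hv

end IsLPCutoff

/-! ### Smoothness of multipliers with Schwartz symbols -/

/-- The decay exponent four exceeds the dimension three. -/
theorem memLp_one_add_norm {q : ℝ≥0∞} (hq : 1 ≤ q) (hq' : q ≠ ⊤) :
    MemLp (fun z : R3 => (1 + ‖z‖) ^ (-4 : ℝ)) q volume := by
  have hm : AEStronglyMeasurable (fun z : R3 => (1 + ‖z‖) ^ (-4 : ℝ)) volume :=
    Measurable.aestronglyMeasurable (by fun_prop)
  have hq1 : 1 ≤ q.toReal := by simpa using ENNReal.toReal_mono hq' hq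
  rw [← integrable_norm_rpow_iff hm (by positivity) hq']
  have h := integrable_one_add_norm (E := R3) (μ := volume) (r := 4 * q.toReal)
    (by rw [finrank_euclideanSpace_fin]; push_cast; linarith)
  refine h.congr (Eventually.of_forall fun z => ?_)
  beta_reduce
  rw [Real.norm_of_nonneg (by positivity), ← Real.rpow_mul (by positivity)]
  congr 1
  ring

/-- The bound is uniform for `z` in a unit ball, as differentiation under the integral requires a
single majorant near each point. -/
theorem exists_norm_fderiv_le (K : 𝓢(R3, ℂ)) : ∃ A : ℝ, 0 ≤ A ∧ ∀ z z₀ : R3, ‖z - z₀‖ < 1 →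
    ‖fderiv ℝ K z‖ ≤ A * (1 + ‖z₀‖) ^ (-4 : ℝ) := by
  set B : ℝ := 2 ^ 4 * (Finset.Iic ((4, 1) : ℕ × ℕ)).sup
    (fun m => SchwartzMap.seminorm ℝ m.1 m.2) K with hB
  have hB0 : 0 ≤ B := by positivity
  refine ⟨16 * B, by positivity, fun z z₀ hz => ?_⟩
  have h1 := SchwartzMap.one_add_le_sup_seminorm_apply (𝕜 := ℝ) (m := (4, 1)) (k := 4) (n := 1)
    le_rfl le_rfl K z
  rw [norm_iteratedFDeriv_one, ← hB] at h1
  have h2 : ‖z₀‖ ≤ ‖z‖ + ‖z - z₀‖ := by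
    have := norm_sub_norm_le z₀ z
    rw [norm_sub_rev] at this
    linarith
  -- Since `‖z - z₀‖ < 1`, one has `1 + ‖z₀‖ ≤ 2 (1 + ‖z‖)`, and `16 = 2⁴`.
  have h3 : (1 + ‖z₀‖) ^ 4 ≤ 16 * (1 + ‖z‖) ^ 4 := by
    calc (1 + ‖z₀‖) ^ 4 ≤ (2 * (1 + ‖z‖)) ^ 4 := by
          gcongr
          linarith [norm_nonneg z]
      _ = _ := by ring
  rw [Real.rpow_neg (by positivity), ← div_eq_mul_inv, le_div_iff₀ (by positivity)]
  have h4 : (1 + ‖z₀‖) ^ (4 : ℝ) = (1 + ‖z₀‖) ^ 4 := by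
    rw [← Real.rpow_natCast]; norm_num
  rw [h4]
  calc ‖fderiv ℝ K z‖ * (1 + ‖z₀‖) ^ 4 ≤ ‖fderiv ℝ K z‖ * (16 * (1 + ‖z‖) ^ 4) := by gcongr
    _ = 16 * ((1 + ‖z‖) ^ 4 * ‖fderiv ℝ K z‖) := by ring
    _ ≤ 16 * B := by gcongr

section

variable {p q : ℝ≥0∞} {f : R3 → C3}

theorem integrable_schwartz_sub_smul (hp : 1 ≤ p) (K : 𝓢(R3, ℂ)) (hf : MemLp f p volume)
    (x : R3) : Integrable fun y => K (x - y) • f y := by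
  have hpq : ENNReal.HolderConjugate p (1 - p⁻¹)⁻¹ := ENNReal.HolderConjugate.inv_one_sub_inv' hp
  rw [← memLp_one_iff_integrable]
  have hK : MemLp (fun y => K (x - y)) (1 - p⁻¹)⁻¹ volume :=
    (K.memLp _ volume).comp_measurePreserving
      (Measure.measurePreserving_sub_left (volume : Measure R3) x)
  exact hf.smul hK

theorem continuous_smulRight :
    Continuous fun z : (R3 →L[ℝ] ℂ) × C3 =>
      ((ContinuousLinearMap.lsmul ℝ ℂ).flip z.2 : ℂ →L[ℝ] C3).comp z.1 :=
  (((ContinuousLinearMap.lsmul ℝ ℂ (E := C3)).flip.continuous.comp continuous_snd).clm_comp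
    continuous_fst)

/-- The derivative of `K(x - y) f(y)` in `x`. -/
def kerDeriv (K : 𝓢(R3, ℂ)) (f : R3 → C3) (x y : R3) : R3 →L[ℝ] C3 :=
  ((ContinuousLinearMap.lsmul ℝ ℂ).flip (f y) : ℂ →L[ℝ] C3).comp (fderiv ℝ K (x - y))

theorem kerDeriv_apply (K : 𝓢(R3, ℂ)) (f : R3 → C3) (x y v : R3) :
    kerDeriv K f x y v = (∂_{v} K) (x - y) • f y := rfl

theorem norm_kerDeriv_le (K : 𝓢(R3, ℂ)) (f : R3 → C3) (x y : R3) :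
    ‖kerDeriv K f x y‖ ≤ ‖fderiv ℝ K (x - y)‖ * ‖f y‖ := by
  refine ContinuousLinearMap.opNorm_le_bound _ (by positivity) fun v => ?_
  rw [kerDeriv_apply, norm_smul, mul_right_comm]
  gcongr
  exact (fderiv ℝ K (x - y)).le_opNorm v

theorem aestronglyMeasurable_kerDeriv (K : 𝓢(R3, ℂ)) (hf : AEStronglyMeasurable f volume)
    (x : R3) : AEStronglyMeasurable (kerDeriv K f x) volume := by
  have h1 : Continuous fun y => fderiv ℝ K (x - y) :=
    ((K.smooth 1).continuous_fderiv one_ne_zero).comp (by fun_prop)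
  have h2 : AEStronglyMeasurable (fun y => (fderiv ℝ K (x - y), f y)) volume :=
    h1.aestronglyMeasurable.prodMk hf
  have h3 := continuous_smulRight.comp_aestronglyMeasurable h2
  exact h3

theorem hasFDerivAt_kernel (K : 𝓢(R3, ℂ)) (f : R3 → C3) (x y : R3) :
    HasFDerivAt (fun x => K (x - y) • f y) (kerDeriv K f x y) x := by
  have h1 : HasFDerivAt (fun x => K (x - y)) (fderiv ℝ K (x - y)) x :=
    (K.differentiableAt (x := x - y)).hasFDerivAt.comp x ((hasFDerivAt_id x).sub_const y)
  exact ((ContinuousLinearMap.lsmul ℝ ℂ).flip (f y) : ℂ →L[ℝ] C3).hasFDerivAt.comp x h1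

theorem exists_integrable_bound_kerDeriv [hqp : ENNReal.HolderConjugate q p] (hq : q ≠ ⊤)
    (K : 𝓢(R3, ℂ)) (hf : MemLp f p volume) (x₀ : R3) : ∃ b : R3 → ℝ, Integrable b ∧
      ∀ y, ∀ x ∈ Metric.ball x₀ 1, ‖kerDeriv K f x y‖ ≤ b y := by
  have hq1 : 1 ≤ q := ENNReal.HolderConjugate.one_le q p
  obtain ⟨A, hA, hKA⟩ := exists_norm_fderiv_le K
  refine ⟨fun y => A * ((1 + ‖x₀ - y‖) ^ (-4 : ℝ) • ‖f y‖), ?_, fun y x hx => ?_⟩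
  · refine Integrable.const_mul ?_ A
    rw [← memLp_one_iff_integrable]
    have h1 : MemLp (fun y : R3 => (1 + ‖x₀ - y‖) ^ (-4 : ℝ)) q volume :=
      (memLp_one_add_norm hq1 hq).comp_measurePreserving
        (Measure.measurePreserving_sub_left (volume : Measure R3) x₀)
    exact hf.norm.smul h1
  · refine (norm_kerDeriv_le K f x y).trans ?_
    beta_reduce
    rw [smul_eq_mul, ← mul_assoc]
    gcongr
    refine hKA _ _ ?_
    rw [sub_sub_sub_cancel_right, ← dist_eq_norm]
    exact hx

theorem hasFDerivAt_integral_schwartz_smul [hqp : ENNReal.HolderConjugate q p] (hq : q ≠ ⊤)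
    (K : 𝓢(R3, ℂ)) (hf : MemLp f p volume) (x₀ : R3) :
    HasFDerivAt (fun x => ∫ y, K (x - y) • f y) (∫ y, kerDeriv K f x₀ y) x₀ := by
  have hpq : ENNReal.HolderConjugate p q := ENNReal.HolderConjugate.symm
  have hp : 1 ≤ p := ENNReal.HolderConjugate.one_le p q
  obtain ⟨b, hb, hKb⟩ := exists_integrable_bound_kerDeriv hq K hf x₀
  exact hasFDerivAt_integral_of_dominated_of_fderiv_le (𝕜 := ℝ) (s := Metric.ball x₀ 1)
    (F' := kerDeriv K f) (bound := b) (Metric.ball_mem_nhds _ one_pos)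
    (Eventually.of_forall fun x => (integrable_schwartz_sub_smul hp K hf x).1)
    (integrable_schwartz_sub_smul hp K hf x₀) (aestronglyMeasurable_kerDeriv K hf.1 x₀)
    (Eventually.of_forall hKb) hb
    (Eventually.of_forall fun y x _ => hasFDerivAt_kernel K f x y)

/-- A derivative in direction `v` gives an integral of the same form with the Schwartz kernel `∂_v
K`, so induction on the order works for all kernels at once. -/
theorem contDiff_integral_schwartz_smul [hqp : ENNReal.HolderConjugate q p] (hq : q ≠ ⊤)
    (K : 𝓢(R3, ℂ)) (hf : MemLp f p volume) : ContDiff ℝ ∞ fun x => ∫ y, K (x - y) • f y := by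
  rw [contDiff_infty]
  intro n
  induction n generalizing K with
  | zero =>
    exact contDiff_zero.2 (Differentiable.continuous (𝕜 := ℝ) fun x =>
      (hasFDerivAt_integral_schwartz_smul hq K hf x).differentiableAt)
  | succ n ih =>
    push_cast
    refine contDiff_succ_iff_fderiv_apply.2 ⟨fun x =>
      (hasFDerivAt_integral_schwartz_smul hq K hf x).differentiableAt, by simp, fun v => ?_⟩
    have h : (fun x => fderiv ℝ (fun x => ∫ y, K (x - y) • f y) x v) =
        fun x => ∫ y, (∂_{v} K) (x - y) • f y := funext fun x => by
      obtain ⟨b, hb, hKb⟩ := exists_integrable_bound_kerDeriv hq K hf x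
      rw [(hasFDerivAt_integral_schwartz_smul hq K hf x).fderiv,
        ContinuousLinearMap.integral_apply (hb.mono' (aestronglyMeasurable_kerDeriv K hf.1 x)
          (Eventually.of_forall fun y => hKb y x (Metric.mem_ball_self one_pos)))]
      rfl
    rw [h]
    exact ih (∂_{v} K)

/-- Multipliers with Schwartz symbols map `L^p` to smooth functions. -/
theorem exists_contDiff_isLpFun_Mul [hqp : ENNReal.HolderConjugate q p] (hq : q ≠ ⊤) (hp' : p ≠ ⊤)
    (a : 𝓢(R3, ℂ)) {u : VField} (hu : lpENorm p u < ⊤) :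
    ∃ g : R3 → C3, ContDiff ℝ ∞ g ∧ IsLpFun p (Mul a u) g := by
  have hpq : ENNReal.HolderConjugate p q := ENNReal.HolderConjugate.symm
  have hp : 1 ≤ p := ENNReal.HolderConjugate.one_le p q
  obtain ⟨f, hf⟩ := exists_isLpFun hu
  obtain ⟨C, hC⟩ := exists_lpENorm_Mul_le hp hp' a
  obtain ⟨h, hh⟩ := exists_isLpFun ((hC u).trans_lt (ENNReal.mul_lt_top ENNReal.coe_lt_top hu))
  obtain ⟨ψ, hψ⟩ := exists_tendsto_lpENorm_ofSchwartz_sub hp hp' hu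
  -- `g` is the smooth candidate, `h` the `L^p` representative. The multiplier applied to Schwartz
  -- approximants converges pointwise to `g` by Hölder and in `L^p` to `h`, so `g = h` almost
  -- everywhere along a subsequence.
  set g : R3 → C3 := fun x => ∫ y, (𝓕⁻ a : 𝓢(R3, ℂ)) (x - y) • f y with hg
  have hψf : ∀ n, lpENorm p (ofSchwartz (ψ n) - u) = eLpNorm (fun x => ψ n x - f x) p volume :=
    fun n => lpENorm_eq_eLpNorm hp ⟨((ψ n).memLp p volume).sub hf.1, fun φ => by
      have h1 : (ofSchwartz (ψ n) - u) φ = ofSchwartz (ψ n) φ - u φ := rfl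
      rw [h1, (isLpFun_ofSchwartz p (ψ n)).2, hf.2, ← integral_sub
        (integrable_schwartz_smul hp φ ((ψ n).memLp p volume))
        (integrable_schwartz_smul hp φ hf.1)]
      simp_rw [smul_sub]⟩
  simp_rw [hψf] at hψ
  have hgx : ∀ x, Tendsto (fun n => SchwartzMap.fourierMultiplierCLM C3 a (ψ n) x) atTop
      (𝓝 (g x)) := fun x => by
    rw [tendsto_iff_edist_tendsto_0]
    have hfin : eLpNorm (𝓕⁻ a : 𝓢(R3, ℂ)) q (volume : Measure R3) ≠ ⊤ :=
      ((𝓕⁻ a).memLp q volume).2.ne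
    have h2 : Tendsto (fun n => eLpNorm (𝓕⁻ a : 𝓢(R3, ℂ)) q volume *
        eLpNorm (fun x => ψ n x - f x) p volume) atTop (𝓝 0) := by
      generalize eLpNorm (𝓕⁻ a : 𝓢(R3, ℂ)) q (volume : Measure R3) = A at hfin
      have h3 := ENNReal.Tendsto.const_mul (a := A) hψ (Or.inr hfin)
      rwa [mul_zero] at h3
    refine tendsto_of_tendsto_of_tendsto_of_le_of_le tendsto_const_nhds h2 (fun _ => zero_le)
      fun n => ?_
    have e1 : g x = ∫ y, (𝓕⁻ a : 𝓢(R3, ℂ)) y • f (x - y) := by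
      rw [hg, ← integral_sub_left_eq_self (fun y => (𝓕⁻ a : 𝓢(R3, ℂ)) y • f (x - y)) volume x]
      simp
    have e2 : ∀ {F : R3 → C3}, MemLp F p volume →
        Integrable fun y => (𝓕⁻ a : 𝓢(R3, ℂ)) y • F (x - y) := fun hF => by
      have := (integrable_schwartz_sub_smul hp (𝓕⁻ a) hF x).comp_sub_left x
      simpa using this
    have e3 : SchwartzMap.fourierMultiplierCLM C3 a (ψ n) x - g x =
        ∫ y, (𝓕⁻ a : 𝓢(R3, ℂ)) y • (ψ n (x - y) - f (x - y)) := by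
      rw [fourierMultiplierCLM_apply_eq_integral, e1, ← integral_sub (e2 ((ψ n).memLp p volume))
        (e2 hf.1)]
      simp_rw [smul_sub]
    beta_reduce
    rw [edist_eq_enorm_sub, e3]
    exact enorm_integral_smul_sub_le (p := p) (q := q)
      (f := fun x => ψ n x - f x) (𝓕⁻ a).continuous.aestronglyMeasurable
      ((ψ n).continuous.aestronglyMeasurable.sub hf.1.1) x
  have hconv : Tendsto (fun n => eLpNorm ((SchwartzMap.fourierMultiplierCLM C3 a (ψ n) : R3 → C3) - h)
      p volume) atTop (𝓝 0) := by
    have h2 : Tendsto (fun n => (C : ℝ≥0∞) * eLpNorm (fun x => ψ n x - f x) p volume) atTop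
        (𝓝 0) := by
      have h3 := ENNReal.Tendsto.const_mul (a := (C : ℝ≥0∞)) hψ (Or.inr ENNReal.coe_ne_top)
      rwa [mul_zero] at h3
    refine tendsto_of_tendsto_of_tendsto_of_le_of_le tendsto_const_nhds h2 (fun _ => zero_le)
      fun n => ?_
    have h3 := hC (ofSchwartz (ψ n) - u)
    rw [hψf, map_sub, Mul_ofSchwartz a.hasTemperateGrowth] at h3
    refine le_of_eq_of_le ?_ h3
    refine (lpENorm_eq_eLpNorm hp ⟨((SchwartzMap.fourierMultiplierCLM C3 a (ψ n)).memLp p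
      volume).sub hh.1, fun φ => ?_⟩).symm
    have h1 : (ofSchwartz (SchwartzMap.fourierMultiplierCLM C3 a (ψ n)) - Mul a u) φ =
      ofSchwartz (SchwartzMap.fourierMultiplierCLM C3 a (ψ n)) φ - Mul a u φ := rfl
    rw [h1, (isLpFun_ofSchwartz p _).2, hh.2, ← integral_sub
      (integrable_schwartz_smul hp φ (SchwartzMap.memLp _ p volume))
      (integrable_schwartz_smul hp φ hh.1)]
    simp_rw [Pi.sub_apply, smul_sub]
  obtain ⟨ns, hns, hae⟩ := (tendstoInMeasure_of_tendsto_eLpNorm (zero_lt_one.trans_le hp).ne'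
    (fun n => (SchwartzMap.continuous _).aestronglyMeasurable) hh.1.1 hconv).exists_seq_tendsto_ae
  have hgh : h =ᵐ[volume] g := by
    filter_upwards [hae] with x hx
    exact tendsto_nhds_unique hx ((hgx x).comp hns.tendsto_atTop)
  refine ⟨g, contDiff_integral_schwartz_smul hq _ hf.1, hh.1.ae_eq hgh, fun φ => ?_⟩
  rw [hh.2]
  refine integral_congr_ae ?_
  filter_upwards [hgh] with x hx
  rw [hx]

end

/-! ### The duality of Besov spaces -/

/-- The bilinear product of vectors as a continuous bilinear map. -/
def dotB : C3 →L[ℂ] C3 →L[ℂ] ℂ :=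
  ∑ k : Fin 3, (ContinuousLinearMap.mul ℂ ℂ).bilinearComp (EuclideanSpace.proj k : C3 →L[ℂ] ℂ)
    (EuclideanSpace.proj k : C3 →L[ℂ] ℂ)

theorem dotB_apply (a b : C3) : dotB a b = dot a b := by
  simp [dotB, dot, sum_apply]

theorem pair_eq (u : VField) (w : 𝓢(R3, C3)) : pair u w = ∑ k, u (comp k w) k := rfl

theorem pair_add_left (u v : VField) (w : 𝓢(R3, C3)) : pair (u + v) w = pair u w + pair v w := by
  rw [pair, pair, pair, ← Finset.sum_add_distrib]
  rfl

theorem pair_sum_left (s : Finset ℕ) (u : ℕ → VField) (w : 𝓢(R3, C3)) :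
    pair (∑ i ∈ s, u i) w = ∑ i ∈ s, pair (u i) w := by
  classical
  induction s using Finset.induction_on with
  | empty =>
    rw [Finset.sum_empty, Finset.sum_empty, pair]
    exact Finset.sum_eq_zero fun k _ => rfl
  | insert i s hi ih => rw [Finset.sum_insert hi, Finset.sum_insert hi, pair_add_left, ih]

theorem pair_sum_right (s : Finset ℕ) (u : VField) (w : ℕ → 𝓢(R3, C3)) :
    pair u (∑ i ∈ s, w i) = ∑ i ∈ s, pair u (w i) := by
  simp_rw [pair_eq, map_sum]
  rw [Finset.sum_comm]
  refine Finset.sum_congr rfl fun k _ => ?_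
  exact map_sum (EuclideanSpace.proj k : C3 →L[ℂ] ℂ) _ _

theorem tendsto_pair {u : ℕ → VField} {v : VField}
    (h : ∀ φ : 𝓢(R3, ℂ), Tendsto (fun n => u n φ) atTop (𝓝 (v φ))) (w : 𝓢(R3, C3)) :
    Tendsto (fun n => pair (u n) w) atTop (𝓝 (pair v w)) := by
  refine tendsto_finsetSum _ fun k _ => ?_
  exact ((EuclideanSpace.proj k : C3 →L[ℂ] ℂ).continuous.tendsto _).comp (h (comp k w))

theorem IsLpFun.pair_eq {p : ℝ≥0∞} (hp : 1 ≤ p) {u : VField} {f : R3 → C3} (hf : IsLpFun p u f)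
    (w : 𝓢(R3, C3)) : pair u w = ∫ x, dot (f x) (w x) := by
  have hi : ∀ k, Integrable fun x => f x k * w x k := fun k => by
    refine (((EuclideanSpace.proj k : C3 →L[ℂ] ℂ).integrable_comp
      (integrable_schwartz_smul hp (comp k w) hf.1)).congr (Eventually.of_forall fun x => ?_))
    simp [comp_apply, mul_comm]
  simp_rw [dot]
  rw [integral_finsetSum _ fun k _ => hi k, Advective.pair_eq]
  refine Finset.sum_congr rfl fun k _ => ?_
  rw [hf.2, integral_smul_coord (integrable_schwartz_smul hp _ hf.1)]
  refine integral_congr_ae (Eventually.of_forall fun x => ?_)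
  simp [comp_apply, mul_comm]

/-- Even multipliers are symmetric. -/
theorem pair_Mul {a : R3 → ℂ} (ha : a.HasTemperateGrowth) (h : ∀ η, a (-η) = a η) (u : VField)
    (w : 𝓢(R3, C3)) : pair (Mul a u) w = pair u (SchwartzMap.fourierMultiplierCLM C3 a w) := by
  rw [pair_eq, pair_eq]
  refine Finset.sum_congr rfl fun k _ => ?_
  rw [TemperedDistribution.fourierMultiplierCLM_apply_apply]
  refine congrArg (fun ψ : 𝓢(R3, ℂ) => u ψ k) (SchwartzMap.ext fun x => ?_)
  rw [comp_apply, SchwartzMap.fourierMultiplierCLM_apply, SchwartzMap.fourierInv_coe,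
    fourierInv_apply_coord (SchwartzMap.integrable _), SchwartzMap.fourier_coe,
    Real.fourierInv_eq_fourier_comp_neg]
  refine congrArg (fun F : R3 → ℂ => 𝓕 F x) (funext fun η => ?_)
  rw [SchwartzMap.smulLeftCLM_apply_apply ha, SchwartzMap.smulLeftCLM_apply_apply ha, h,
    SchwartzMap.fourierInv_coe, Real.fourierInv_eq_fourier_neg, PiLp.smul_apply,
    SchwartzMap.fourier_coe, fourier_apply_coord, SchwartzMap.fourier_coe]

namespace IsLPCutoff

variable {χ : R3 → ℝ} (hχ : IsLPCutoff χ)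

/-- Neighbouring blocks. -/
def E (m : ℕ) : VField →L[ℂ] VField := ∑ n ∈ Finset.Icc (m - 1) (m + 1), hχ.D n

theorem E_apply (m : ℕ) (u : VField) :
    hχ.E m u = ∑ n ∈ Finset.Icc (m - 1) (m + 1), hχ.D n u := by
  rw [E, sum_apply]

/-- Only the blocks `m - 1`, `m`, `m + 1` overlap the block `m`, so their sum acts on it as the
identity. This lets a pairing with `D m G` be computed against a localised partner. At `m = 0` the
truncated `m - 1` is `0`, as it should be. -/
theorem E_D (m : ℕ) (u : VField) : hχ.E m (hχ.D m u) = hχ.D m u := by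
  have h1 : ∀ n, n + 2 ≤ m → hχ.D n (hχ.D m u) = 0 := fun n hn => by
    have h2 : hχ.D m (hχ.S n u) = 0 := hχ.D_S_of_lt hn u
    cases n with
    | zero =>
      have e : hχ.D 0 (hχ.D m u) = hχ.D m (hχ.D 0 u) :=
        Mul_comm (hχ.dSym _).hasTemperateGrowth (hχ.dSym _).hasTemperateGrowth u
      have e2 : hχ.D 0 u = hχ.S 0 u := by rw [← sum_D]; simp
      rw [e, e2, h2]
    | succ n =>
      have e : hχ.D (n + 1) (hχ.D m u) = hχ.D m (hχ.D (n + 1) u) :=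
        Mul_comm (hχ.dSym _).hasTemperateGrowth (hχ.dSym _).hasTemperateGrowth u
      have e2 : hχ.D (n + 1) u = hχ.S (n + 1) u - hχ.S n u := by
        rw [← sum_D, ← sum_D, Finset.sum_range_succ _ (n + 1)]
        abel
      rw [e, e2, map_sub, h2, hχ.D_S_of_lt (by omega), sub_zero]
  have h3 := hχ.sum_D (m + 1) (hχ.D m u)
  rw [hχ.S_D m.lt_succ_self] at h3
  rw [E_apply]
  refine Eq.trans ?_ h3
  refine Finset.sum_subset (fun n hn => ?_) fun n hn hn' => h1 n ?_
  · rw [Finset.mem_Icc] at hn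
    exact Finset.mem_range.2 (by omega)
  · rw [Finset.mem_Icc] at hn'
    rw [Finset.mem_range] at hn
    omega

theorem exists_lTwo_E_le {q : ℝ≥0∞} (hq : 1 ≤ q) (s : ℝ) : ∃ C : ℝ≥0, ∀ w,
    lTwo (fun m => 2 ^ ((m : ℝ) * s) * lpENorm q (hχ.E m w)) ≤ C * lTwo (hχ.coef s q w) := by
  have hθ : (2 : ℝ≥0∞) ^ (-(1 : ℝ)) < 1 := two_rpow_neg_lt_one one_pos
  -- `2^{|s|}` pays for moving the weight to a neighbouring index, and `2` for inserting `2^{-dist}`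
  -- with `dist ≤ 1`, which puts the finite sum into convolution form.
  set c : ℝ≥0∞ := 2 * 2 ^ |s| with hc
  have hct : c * (2 * (1 - (2 : ℝ≥0∞) ^ (-(1 : ℝ)))⁻¹) ≠ ⊤ :=
    ENNReal.mul_ne_top (ENNReal.mul_ne_top (by simp) (two_rpow_ne_top _)) (one_sub_inv_ne_top hθ)
  refine ⟨(c * (2 * (1 - (2 : ℝ≥0∞) ^ (-(1 : ℝ)))⁻¹)).toNNReal, fun w => ?_⟩
  rw [ENNReal.coe_toNNReal hct]
  refine lTwo_le_of_le_tsum_dist fun m => ?_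
  calc 2 ^ ((m : ℝ) * s) * lpENorm q (hχ.E m w)
      ≤ 2 ^ ((m : ℝ) * s) * ∑ n ∈ Finset.Icc (m - 1) (m + 1), lpENorm q (hχ.D n w) := by
        gcongr
        rw [E_apply]
        exact lpENorm_sum_le hq _ _
    _ = ∑ n ∈ Finset.Icc (m - 1) (m + 1), 2 ^ ((m : ℝ) * s) * lpENorm q (hχ.D n w) :=
        Finset.mul_sum _ _ _
    _ ≤ ∑ n ∈ Finset.Icc (m - 1) (m + 1),
          c * ((2 ^ (-(1 : ℝ))) ^ Nat.dist m n * hχ.coef s q w n) := by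
        refine Finset.sum_le_sum fun n hn => ?_
        rw [Finset.mem_Icc] at hn
        rw [hχ.lpENorm_D_eq s, ← mul_assoc, ← mul_assoc, hc, ← two_rpow_natCast_mul]
        have h2 : 2 * (2 : ℝ≥0∞) ^ |s| * 2 ^ ((Nat.dist m n : ℝ) * -1) =
            2 ^ (1 + |s| + (Nat.dist m n : ℝ) * -1) := by
          rw [two_rpow_add, two_rpow_add, ENNReal.rpow_one]
        rw [h2, ← two_rpow_add]
        gcongr ?_ * _
        refine ENNReal.rpow_le_rpow_of_exponent_le (by norm_num) ?_
        have h3 : |(m : ℝ) - n| ≤ 1 := by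
          rw [abs_le]
          have e1 : (m : ℝ) ≤ n + 1 := by exact_mod_cast (by omega : m ≤ n + 1)
          have e2 : (n : ℝ) ≤ m + 1 := by exact_mod_cast hn.2
          constructor <;> linarith
        have h4 : (Nat.dist m n : ℝ) ≤ 1 := by
          have : Nat.dist m n ≤ 1 := by unfold Nat.dist; omega
          exact_mod_cast this
        have h5 : ((m : ℝ) - n) * s ≤ |s| := by
          calc ((m : ℝ) - n) * s ≤ |((m : ℝ) - n) * s| := le_abs_self _
            _ = |(m : ℝ) - n| * |s| := abs_mul _ _
            _ ≤ 1 * |s| := by gcongr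
            _ = |s| := one_mul _
        linarith
    _ ≤ _ := by
        rw [← Finset.mul_sum]
        gcongr
        exact ENNReal.sum_le_tsum _

theorem lpENorm_E_lt_top {q : ℝ≥0∞} (hq : 1 ≤ q) {s : ℝ} {w : VField}
    (h : lTwo (hχ.coef s q w) < ⊤) (m : ℕ) : lpENorm q (hχ.E m w) < ⊤ := by
  rw [E_apply]
  refine (lpENorm_sum_le hq _ _).trans_lt ?_
  exact ENNReal.sum_lt_top.2 fun n _ => hχ.lpENorm_D_lt_top h n

theorem isRealField_E (m : ℕ) {u : VField} (hu : IsRealField u) : IsRealField (hχ.E m u) := by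
  rw [E_apply]
  exact IsRealField.sum _ fun n _ => hχ.isRealField_D n hu

section

variable {p : ℝ≥0∞} [hp : Fact (1 ≤ p)] (t : ℝ)

/-- With this, `lpRep` on the image of the block operator gives representatives linear in the field,
even for negative order, where the field itself need not be a function. -/
theorem lpENorm_map_D_lt_top (m : ℕ) :
    ∀ u ∈ (besov χ t p 2).map (hχ.D m : VField →ₗ[ℂ] VField), lpENorm p u < ⊤ := by
    rintro _ ⟨u, hu, rfl⟩
    exact hχ.lpENorm_D_lt_top (hχ.besovENorm_lt_top_iff_lTwo.1 hu) m

/-- The blocks of Besov fields as `L^p` functions. -/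
def blockRep (m : ℕ) : besov χ t p 2 →ₗ[ℂ] Lp C3 p (volume : Measure R3) :=
  lpRep p ((besov χ t p 2).map (hχ.D m : VField →ₗ[ℂ] VField)) (hχ.lpENorm_map_D_lt_top t m) ∘ₗ
  (hχ.D m : VField →ₗ[ℂ] VField).submoduleMap (besov χ t p 2)

theorem emb_blockRep (m : ℕ) (u : besov χ t p 2) : emb p (hχ.blockRep t m u) = hχ.D m u :=
  emb_lpRep (hχ.lpENorm_map_D_lt_top t m) _

theorem lpENorm_map_E_lt_top (m : ℕ) :
    ∀ u ∈ (besov χ t p 2).map (hχ.E m : VField →ₗ[ℂ] VField), lpENorm p u < ⊤ := by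
    rintro _ ⟨u, hu, rfl⟩
    exact hχ.lpENorm_E_lt_top hp.out (hχ.besovENorm_lt_top_iff_lTwo.1 hu) m

/-- Sums of neighbouring blocks of Besov fields as `L^p` functions. -/
def fatRep (m : ℕ) : besov χ t p 2 →ₗ[ℂ] Lp C3 p (volume : Measure R3) :=
  lpRep p ((besov χ t p 2).map (hχ.E m : VField →ₗ[ℂ] VField)) (hχ.lpENorm_map_E_lt_top t m) ∘ₗ
  (hχ.E m : VField →ₗ[ℂ] VField).submoduleMap (besov χ t p 2)

theorem emb_fatRep (m : ℕ) (u : besov χ t p 2) : emb p (hχ.fatRep t m u) = hχ.E m u :=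
  emb_lpRep (hχ.lpENorm_map_E_lt_top t m) _

end

end IsLPCutoff

namespace IsLPCutoff

variable {χ : R3 → ℝ} (hχ : IsLPCutoff χ)

section

variable {p q : ℝ≥0∞} [hp : Fact (1 ≤ p)] [hq : Fact (1 ≤ q)] [ENNReal.HolderConjugate p q]
  {s t : ℝ}

/-- The pairing of blocks. -/
def blockPair (m : ℕ) (G : besov χ t p 2) (w : besov χ s q 2) : ℂ :=
  dotB.lpPairing volume p q (hχ.blockRep t m G) (hχ.fatRep s m w)

theorem blockPair_eq_integral (m : ℕ) (G : besov χ t p 2) (w : besov χ s q 2) :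
    hχ.blockPair m G w = ∫ x, dot (hχ.blockRep t m G x) (hχ.fatRep s m w x) := by
  rw [blockPair, ContinuousLinearMap.lpPairing_eq_integral]
  simp_rw [dotB_apply]

/-- As `t = -s`, the weights of the two factors cancel; Hölder in space and Cauchy–Schwarz in `m`
finish. -/
theorem exists_tsum_enorm_blockPair_le (hst : t = -s) : ∃ K : ℝ≥0,
    ∀ (G : besov χ t p 2) (w : besov χ s q 2), ∑' m, ‖hχ.blockPair m G w‖ₑ ≤
      K * lTwo (hχ.coef t p G) * lTwo (hχ.coef s q w) := by
  obtain ⟨C, hC⟩ := hχ.exists_lTwo_E_le hq.out s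
  set N : ℝ≥0 := ‖(dotB.lpPairing (volume : Measure R3) p q)‖₊ with hN
  refine ⟨N * C, fun G w => ?_⟩
  calc ∑' m, ‖hχ.blockPair m G w‖ₑ
      ≤ ∑' m, N * (hχ.coef t p G m * (2 ^ ((m : ℝ) * s) * lpENorm q (hχ.E m w))) := by
        refine ENNReal.tsum_le_tsum fun m => ?_
        have h1 : ‖hχ.blockPair m G w‖ₑ ≤ N * ‖hχ.blockRep t m G‖ₑ * ‖hχ.fatRep s m w‖ₑ := by
          have h2 : ‖hχ.blockPair m G w‖₊ ≤ N * ‖hχ.blockRep t m G‖₊ * ‖hχ.fatRep s m w‖₊ :=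
            (dotB.lpPairing (volume : Measure R3) p q).le_opNorm₂ _ _
          calc ‖hχ.blockPair m G w‖ₑ = ((‖hχ.blockPair m G w‖₊ : ℝ≥0) : ℝ≥0∞) := rfl
            _ ≤ ((N * ‖hχ.blockRep t m G‖₊ * ‖hχ.fatRep s m w‖₊ : ℝ≥0) : ℝ≥0∞) :=
              ENNReal.coe_le_coe.2 h2
            _ = _ := by rw [ENNReal.coe_mul, ENNReal.coe_mul]; rfl
        refine h1.trans (le_of_eq ?_)
        rw [← lpENorm_emb, ← lpENorm_emb, emb_blockRep, emb_fatRep, hχ.lpENorm_D_eq t]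
        have h3 : (2 : ℝ≥0∞) ^ (-((m : ℝ) * t)) = 2 ^ ((m : ℝ) * s) := by
          rw [hst]; congr 1; ring
        rw [h3]
        ring
    _ = N * ∑' m, hχ.coef t p G m * (2 ^ ((m : ℝ) * s) * lpENorm q (hχ.E m w)) :=
        ENNReal.tsum_mul_left
    _ ≤ N * (lTwo (hχ.coef t p G) * (C * lTwo (hχ.coef s q w))) := by
        gcongr
        refine (tsum_mul_le_lTwo _ _).trans ?_
        gcongr
        exact hC w
    _ = _ := by push_cast; ring

theorem summable_blockPair (hst : t = -s) (G : besov χ t p 2) (w : besov χ s q 2) :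
    Summable fun m => hχ.blockPair m G w := by
  obtain ⟨K, hK⟩ := hχ.exists_tsum_enorm_blockPair_le (p := p) (q := q) hst
  have h1 := (hK G w).trans_lt (ENNReal.mul_lt_top (ENNReal.mul_lt_top ENNReal.coe_lt_top
    (hχ.lTwo_coef_lt_top G)) (hχ.lTwo_coef_lt_top w))
  have h2 : Summable fun m => ‖hχ.blockPair m G w‖₊ := by
    rw [← ENNReal.tsum_coe_ne_top_iff_summable]
    exact h1.ne
  exact Summable.of_nnnorm h2

/-- The duality pairing of `B^{-s}_{p,2}` and `B^s_{q,2}`. -/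
def dual (hst : t = -s) : besov χ t p 2 →ₗ[ℂ] besov χ s q 2 →ₗ[ℂ] ℂ :=
  LinearMap.mk₂ ℂ (fun G w => ∑' m, hχ.blockPair m G w)
    (fun G G' w => by
      refine Eq.trans (tsum_congr fun n => ?_)
        ((hχ.summable_blockPair hst G w).tsum_add (hχ.summable_blockPair hst G' w))
      rw [blockPair, map_add, map_add]
      rfl)
    (fun c G w => by
      refine Eq.trans (tsum_congr fun n => ?_) ((hχ.summable_blockPair hst G w).tsum_const_smul c)
      rw [blockPair, map_smul, map_smul]
      rfl)
    (fun G w w' => by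
      refine Eq.trans (tsum_congr fun n => ?_)
        ((hχ.summable_blockPair hst G w).tsum_add (hχ.summable_blockPair hst G w'))
      rw [blockPair, map_add, map_add]
      rfl)
    (fun c G w => by
      refine Eq.trans (tsum_congr fun n => ?_) ((hχ.summable_blockPair hst G w).tsum_const_smul c)
      rw [blockPair, map_smul, map_smul]
      rfl)

theorem dual_apply (hst : t = -s) (G : besov χ t p 2) (w : besov χ s q 2) :
    hχ.dual hst G w = ∑' m, hχ.blockPair m G w := rfl

theorem exists_enorm_dual_le (hst : t = -s) : ∃ K : ℝ≥0,
    ∀ (G : besov χ t p 2) (w : besov χ s q 2),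
      ‖hχ.dual hst G w‖ₑ ≤ K * lTwo (hχ.coef t p G) * lTwo (hχ.coef s q w) := by
  obtain ⟨K, hK⟩ := hχ.exists_tsum_enorm_blockPair_le (p := p) (q := q) (χ := χ) hst
  refine ⟨K, fun G w => le_trans ?_ (hK G w)⟩
  rw [dual_apply]
  exact enorm_tsum_le_tsum_enorm

/-- The symbols are even, so `E m` can be moved from the Schwartz field to `D m G`, which it fixes.
The terms are thus `⟨D m G, ψ⟩`, and their sum converges to `⟨G, ψ⟩`. -/
theorem dual_ofSchwartz (hst : t = -s) (G : besov χ t p 2) (w : besov χ s q 2) {ψ : 𝓢(R3, C3)}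
    (hw : (w : VField) = ofSchwartz ψ) : hχ.dual hst G w = pair G ψ := by
  have h1 : ∀ m, hχ.blockPair m G w = pair (hχ.D m G) ψ := fun m => by
    set Ψ : 𝓢(R3, C3) := ∑ n ∈ Finset.Icc (m - 1) (m + 1),
      SchwartzMap.fourierMultiplierCLM C3 (hχ.dSym n) ψ with hΨ
    have h2 : hχ.E m w = ofSchwartz Ψ := by
      rw [hw, E_apply]
      refine Eq.trans ?_ (map_sum (SchwartzMap.toTemperedDistributionCLM R3 C3 volume) _ _).symm
      exact Finset.sum_congr rfl fun n _ => Mul_ofSchwartz (hχ.dSym n).hasTemperateGrowth ψ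
    have h3 : pair (hχ.D m G) ψ = pair (hχ.D m G) Ψ := by
      conv_lhs => rw [← hχ.E_D]
      rw [E_apply, pair_sum_left, hΨ, pair_sum_right]
      exact Finset.sum_congr rfl fun n _ => pair_Mul (hχ.dSym n).hasTemperateGrowth
        (hχ.dSym_neg n) _ ψ
    have h4 : hχ.fatRep s m w =ᵐ[volume] Ψ := by
      refine (isLpFun_emb (hχ.fatRep s m w)).ae_eq hq.out hq.out ?_
      rw [emb_fatRep, h2]
      exact isLpFun_ofSchwartz q Ψ
    have h5 := isLpFun_emb (hχ.blockRep t m G)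
    rw [h3, ← emb_blockRep, h5.pair_eq hp.out, blockPair_eq_integral]
    refine integral_congr_ae ?_
    filter_upwards [h4] with x hx
    rw [hx]
  rw [dual_apply]
  refine tendsto_nhds_unique (hχ.summable_blockPair hst G w).hasSum.tendsto_sum_nat ?_
  refine (tendsto_pair (hχ.tendsto_sum_D_apply (G : VField)) ψ).congr fun n => ?_
  rw [pair_sum_left]
  exact Finset.sum_congr rfl fun m _ => (h1 m).symm

theorem dual_im (hst : t = -s) (G : besov χ t p 2) (w : besov χ s q 2)
    (hG : IsRealField (G : VField)) (hw : IsRealField (w : VField)) :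
    (hχ.dual hst G w).im = 0 := by
  rw [dual_apply, Complex.im_tsum (hχ.summable_blockPair hst G w)]
  refine (tsum_congr fun m => ?_).trans tsum_zero
  have h1 := (isRealField_emb_iff (hχ.blockRep t m G)).1 (by
    rw [emb_blockRep]; exact hχ.isRealField_D m hG)
  have h2 := (isRealField_emb_iff (hχ.fatRep s m w)).1 (by
    rw [emb_fatRep]; exact hχ.isRealField_E m hw)
  rw [blockPair_eq_integral, ← Complex.conj_eq_iff_im, ← integral_conj]
  refine integral_congr_ae ?_
  filter_upwards [h1, h2] with x hx hx'
  rw [dot, map_sum]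
  refine Finset.sum_congr rfl fun k _ => ?_
  rw [map_mul, Complex.conj_eq_iff_im.2 (hx k), Complex.conj_eq_iff_im.2 (hx' k)]

end

end IsLPCutoff

/-! ### Sobolev spaces -/

/-- The symbol of the Bessel potential. -/
def jap (s : ℝ) (η : R3) : ℂ := (((1 + ‖η‖ ^ 2) ^ (s / 2) : ℝ) : ℂ)

theorem hasTemperateGrowth_jap (s : ℝ) : (jap s).HasTemperateGrowth := by
  unfold jap
  fun_prop

theorem besselPotential_eq (s : ℝ) (u : VField) :
    TemperedDistribution.besselPotential R3 C3 s u = Mul (jap s) u := rfl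

theorem jap_neg (s : ℝ) (η : R3) : jap s (-η) = jap s η := by simp [jap]

theorem conj_jap (s : ℝ) (η : R3) : starRingEnd ℂ (jap s η) = jap s η := Complex.conj_ofReal _

theorem Mul_jap_neg (s : ℝ) (u : VField) : Mul (jap s) (Mul (jap (-s)) u) = u := by
  have h := TemperedDistribution.besselPotential_besselPotential_apply (-s) s u
  rw [neg_add_cancel, TemperedDistribution.besselPotential_zero] at h
  exact h

theorem Mul_jap_neg' (s : ℝ) (u : VField) : Mul (jap (-s)) (Mul (jap s) u) = u := by
  have h := TemperedDistribution.besselPotential_besselPotential_apply s (-s) u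
  rw [add_neg_cancel, TemperedDistribution.besselPotential_zero] at h
  exact h

/-- Plancherel's theorem for Fourier multipliers. -/
theorem lpENorm_two_Mul {b : R3 → ℂ} (hb : b.HasTemperateGrowth) {A : ℝ} (hA : ∀ η, ‖b η‖ ≤ A)
    (f : Lp C3 2 (volume : Measure R3)) :
    lpENorm 2 (Mul b (emb 2 f)) =
      eLpNorm (fun η => b η • (𝓕 f : Lp C3 2 (volume : Measure R3)) η) 2 volume := by
  have hb' : MemLp b ⊤ (volume : Measure R3) :=
    memLp_top_of_bound hb.1.continuous.aestronglyMeasurable A (Eventually.of_forall hA)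
  set g : Lp C3 2 (volume : Measure R3) := (hb'.toLp b) • (𝓕 f : Lp C3 2 (volume : Measure R3))
    with hg
  have h1 : Mul b (emb 2 f) = emb 2 (𝓕⁻ g) := by
    have e1 : 𝓕 (emb 2 f) = emb 2 (𝓕 f) := Lp.fourier_toTemperedDistribution_eq f
    have e2 : 𝓕⁻ (emb 2 g) = emb 2 (𝓕⁻ g) := Lp.fourierInv_toTemperedDistribution_eq g
    have e3 : emb 2 g = TemperedDistribution.smulLeftCLM C3 b (emb 2 (𝓕 f)) :=
      Lp.toTemperedDistribution_smul_eq hb hb' (𝓕 f)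
    rw [TemperedDistribution.fourierMultiplierCLM_apply, e1, ← e3, e2]
  have h2 : ‖(𝓕⁻ g : Lp C3 2 (volume : Measure R3))‖ = ‖g‖ := by
    rw [← Lp.norm_fourier_eq (𝓕⁻ g), FourierTransform.fourier_fourierInv_eq]
  rw [h1, lpENorm_emb, ← ofReal_norm, h2, ofReal_norm, Lp.enorm_def]
  refine eLpNorm_congr_ae ?_
  filter_upwards [Lp.coeFn_lpSMul (r := 2) (hb'.toLp b) (𝓕 f : Lp C3 2 (volume : Measure R3)),
    hb'.coeFn_toLp] with η h3 h4
  rw [h3, Pi.smul_apply', h4]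

namespace IsLPCutoff

variable {χ : R3 → ℝ} (hχ : IsLPCutoff χ)

theorem exists_norm_dSym_le : ∃ M : ℝ≥0, ∀ n η, ‖hχ.dSym n η‖ ≤ M := by
  obtain ⟨B, hB⟩ := hχ.smooth.continuous.bounded_above_of_compact_support hχ.support.1
  have hs : ∀ n η, ‖hχ.sSym n η‖ ≤ B.toNNReal := fun n η => by
    rw [sSym_apply, Complex.norm_real]
    exact (hB _).trans (Real.le_coe_toNNReal B)
  refine ⟨2 * B.toNNReal, fun n η => ?_⟩
  push_cast
  cases n with
  | zero =>
    rw [← sSym_zero]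
    linarith [hs 0 η, norm_nonneg (hχ.sSym 0 η)]
  | succ n =>
    rw [dSym_succ, sub_apply]
    linarith [norm_sub_le (hχ.sSym (n + 1) η) (hχ.sSym n η), hs n η, hs (n + 1) η]

theorem two_pow_le_of_dSym_ne_zero {n : ℕ} {η : R3} (h : hχ.dSym n η ≠ 0) :
    (2 : ℝ) ^ n ≤ 8 * Real.pi * Real.sqrt (1 + ‖η‖ ^ 2) := by
  have h1 : 1 ≤ Real.sqrt (1 + ‖η‖ ^ 2) := by
    rw [Real.one_le_sqrt]
    linarith [sq_nonneg ‖η‖]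
  have h2 : ‖η‖ ≤ Real.sqrt (1 + ‖η‖ ^ 2) := Real.le_sqrt_of_sq_le (by linarith)
  have hpi := Real.pi_gt_three
  cases n with
  | zero => rw [pow_zero]; nlinarith
  | succ n =>
    have h3 : 2 ^ n / 2 < 2 * Real.pi * ‖η‖ := by
      by_contra h4
      exact h (hχ.dSym_eq_zero_of_ge (not_lt.1 h4))
    rw [pow_succ]
    nlinarith

theorem le_succ_of_dSym_ne_zero {n m : ℕ} {η : R3} (hn : hχ.dSym n η ≠ 0)
    (hm : hχ.dSym m η ≠ 0) : m ≤ n + 1 := by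
  by_contra h
  obtain ⟨m, rfl⟩ : ∃ i, m = i + 1 := ⟨m - 1, by omega⟩
  have h1 : 2 ^ m / 2 < 2 * Real.pi * ‖η‖ := by
    by_contra h4
    exact hm (hχ.dSym_eq_zero_of_ge (not_lt.1 h4))
  have h2 : 2 * Real.pi * ‖η‖ < 2 ^ n := by
    by_contra h4
    exact hn (hχ.dSym_eq_zero_of_le (not_lt.1 h4))
  have h3 : (2 : ℝ) ^ (n + 1) ≤ 2 ^ m := pow_le_pow_right₀ (by norm_num) (by omega)
  rw [pow_succ] at h3
  linarith

/-- The weighted symbols of the blocks are square summable, uniformly in the frequency. -/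
theorem exists_tsum_symbol_le {s : ℝ} (hs : 0 ≤ s) : ∃ A : ℝ≥0,
    (∀ (n : ℕ) (η : R3), (2 : ℝ≥0∞) ^ ((n : ℝ) * s) * ‖hχ.dSym n η * jap (-s) η‖ₑ ≤ A) ∧
    ∀ η, ∑' n : ℕ, ((2 : ℝ≥0∞) ^ ((n : ℝ) * s) * ‖hχ.dSym n η * jap (-s) η‖ₑ) ^ (2 : ℝ) ≤ A := by
  -- Where the symbol of `D n` is nonzero, `2^n ≤ 8π (1 + ‖η‖²)^{1/2}`, so the weight is absorbed by
  -- the Bessel factor up to `(8π)^s`.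
  obtain ⟨M, hM⟩ := hχ.exists_norm_dSym_le
  set A : ℝ := M * (8 * Real.pi) ^ s with hA
  have hA0 : 0 ≤ A := by positivity
  have hle : ∀ (n : ℕ) (η : R3),
      (2 : ℝ≥0∞) ^ ((n : ℝ) * s) * ‖hχ.dSym n η * jap (-s) η‖ₑ ≤ ENNReal.ofReal A := by
    intro n η
    rcases eq_or_ne (hχ.dSym n η) 0 with h0 | h0
    · rw [h0]
      simp
    rw [← ofReal_two_rpow, ← ofReal_norm, ← ENNReal.ofReal_mul (by positivity)]
    refine ENNReal.ofReal_le_ofReal ?_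
    have h1 : (2 : ℝ) ^ ((n : ℝ) * s) ≤ (8 * Real.pi) ^ s * (1 + ‖η‖ ^ 2) ^ (s / 2) := by
      rw [Real.rpow_mul (by norm_num), Real.rpow_natCast]
      calc ((2 : ℝ) ^ n) ^ s ≤ (8 * Real.pi * Real.sqrt (1 + ‖η‖ ^ 2)) ^ s :=
            Real.rpow_le_rpow (by positivity) (hχ.two_pow_le_of_dSym_ne_zero h0) hs
        _ = _ := by
            rw [Real.mul_rpow (by positivity) (by positivity), Real.sqrt_eq_rpow,
              ← Real.rpow_mul (by positivity)]
            congr 2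
            ring
    rw [norm_mul, jap, Complex.norm_real, Real.norm_of_nonneg (by positivity)]
    have h2 : (1 + ‖η‖ ^ 2) ^ (s / 2) * (1 + ‖η‖ ^ 2) ^ (-s / 2) = 1 := by
      rw [← Real.rpow_add (by positivity)]
      have : s / 2 + -s / 2 = 0 := by ring
      rw [this, Real.rpow_zero]
    calc _ ≤ (8 * Real.pi) ^ s * (1 + ‖η‖ ^ 2) ^ (s / 2) *
          (M * (1 + ‖η‖ ^ 2) ^ (-s / 2)) := by
          gcongr
          exact hM n η
      _ = M * (8 * Real.pi) ^ s * ((1 + ‖η‖ ^ 2) ^ (s / 2) * (1 + ‖η‖ ^ 2) ^ (-s / 2)) := by ring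
      _ = A := by rw [h2, mul_one]
  -- The first summand serves the pointwise bound, the second the sum of squares, in which at most
  -- two terms are nonzero.
  refine ⟨A.toNNReal + 2 * A.toNNReal ^ (2 : ℝ), fun n η => (hle n η).trans ?_, fun η => ?_⟩
  · push_cast
    exact le_self_add
  set F : ℕ → ℝ≥0∞ := fun n =>
    ((2 : ℝ≥0∞) ^ ((n : ℝ) * s) * ‖hχ.dSym n η * jap (-s) η‖ₑ) ^ (2 : ℝ) with hF
  have hF0 : ∀ n, hχ.dSym n η = 0 → F n = 0 := fun n h => by
    rw [hF]
    simp [h]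
  have hFA : ∀ n, F n ≤ ((A.toNNReal ^ (2 : ℝ) : ℝ≥0) : ℝ≥0∞) := fun n => by
    rw [ENNReal.coe_rpow_of_nonneg _ (by norm_num)]
    exact ENNReal.rpow_le_rpow (hle n η) (by norm_num)
  change ∑' n, F n ≤ _
  by_cases h : ∃ n, hχ.dSym n η ≠ 0
  · classical
    -- With `n` the least index active at `η`, only `n` and `n + 1` can contribute.
    have hn := Nat.find_spec h
    set n := Nat.find h
    have hsub : ∀ m ∉ ({n, n + 1} : Finset ℕ), F m = 0 := fun m hm => hF0 m (by
      by_contra h1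
      have h2 := hχ.le_succ_of_dSym_ne_zero hn h1
      have h3 : n ≤ m := Nat.find_min' h h1
      simp only [Finset.mem_insert, Finset.mem_singleton] at hm
      omega)
    rw [tsum_eq_sum hsub, Finset.sum_pair (by omega)]
    refine (add_le_add (hFA n) (hFA (n + 1))).trans ?_
    push_cast
    rw [← two_mul]
    exact le_add_self
  · push Not at h
    rw [tsum_congr fun n => hF0 n (h n), tsum_zero]
    exact zero_le

/-- By Plancherel each squared coefficient is an integral of `|F|²` against a weighted symbol, `F`
being the transform of the Bessel potential of `u`. Sum and integral are exchanged and the pointwise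
bound on the symbols applies. -/
theorem exists_lTwo_coef_le_sobolev {s : ℝ} (hs : 0 ≤ s) : ∃ K : ℝ≥0, ∀ u,
    lTwo (hχ.coef s 2 u) ≤ K * sobolevENorm s u := by
  obtain ⟨A, hA, hA2⟩ := hχ.exists_tsum_symbol_le hs
  have hK0 : A ^ (1 / 2 : ℝ) + 1 ≠ 0 := by positivity
  refine ⟨A ^ (1 / 2 : ℝ) + 1, fun u => ?_⟩
  rw [sobolevENorm, besselPotential_eq]
  rcases eq_or_ne (lpENorm 2 (Mul (jap s) u)) ⊤ with h | h
  · rw [h, ENNReal.mul_top (by exact_mod_cast hK0)]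
    exact le_top
  obtain ⟨f, hf⟩ := exists_emb_eq h.lt_top
  set F : Lp C3 2 (volume : Measure R3) := 𝓕 f with hF
  have hu : u = Mul (jap (-s)) (emb 2 f) := by rw [hf, Mul_jap_neg']
  have hn : ‖f‖ₑ = eLpNorm F 2 volume := by
    rw [← Lp.enorm_def, ← ofReal_norm, ← ofReal_norm, hF, Lp.norm_fourier_eq]
  have hp0 : (2 : ℝ≥0∞) ≠ 0 := by simp
  have hD : ∀ n, hχ.coef s 2 u n ^ (2 : ℝ) =
      ∫⁻ η, ((2 : ℝ≥0∞) ^ ((n : ℝ) * s) * ‖hχ.dSym n η * jap (-s) η‖ₑ) ^ (2 : ℝ) *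
        ‖F η‖ₑ ^ (2 : ℝ) := fun n => by
    have hb : ∀ η, ‖((hχ.dSym n : R3 → ℂ) * jap (-s)) η‖ ≤ (A : ℝ) := fun η => by
      have h1 := hA n η
      have h2 : (1 : ℝ≥0∞) ≤ 2 ^ ((n : ℝ) * s) := by
        rw [← ENNReal.rpow_zero (x := 2)]
        exact ENNReal.rpow_le_rpow_of_exponent_le (by norm_num) (by positivity)
      have h3 : ‖hχ.dSym n η * jap (-s) η‖ₑ ≤ A := by
        refine le_trans ?_ h1
        exact le_mul_of_one_le_left zero_le h2
      exact_mod_cast ENNReal.coe_le_coe.1 h3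
    have hDu : hχ.D n u = Mul ((hχ.dSym n : R3 → ℂ) * jap (-s)) (emb 2 f) := by
      rw [hu, D, Mul_Mul (hχ.dSym n).hasTemperateGrowth (hasTemperateGrowth_jap _)]
    have e2 : (2 : ℝ≥0∞).toReal = 2 := by simp
    rw [coef, hDu, lpENorm_two_Mul ((hχ.dSym n).hasTemperateGrowth.mul
      (hasTemperateGrowth_jap _)) hb, eLpNorm_eq_lintegral_rpow_enorm_toReal hp0 (by simp), e2,
      ENNReal.mul_rpow_of_nonneg _ _ (by norm_num)]
    have e3 (y : ℝ≥0∞) : (y ^ (1 / 2 : ℝ)) ^ (2 : ℝ) = y := by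
      rw [← ENNReal.rpow_mul]
      norm_num
    rw [e3, ← lintegral_const_mul' _ _ (ENNReal.rpow_ne_top_of_nonneg (by norm_num)
      (two_rpow_ne_top _))]
    refine lintegral_congr fun η => ?_
    rw [enorm_smul, Pi.mul_apply, ENNReal.mul_rpow_of_nonneg _ _ (by norm_num),
      ENNReal.mul_rpow_of_nonneg _ _ (by norm_num), mul_assoc]
  rw [← hf, lpENorm_emb, hn, ← ENNReal.rpow_le_rpow_iff (by norm_num : (0 : ℝ) < 2), lTwo_rpow_two]
  simp_rw [hD]
  have hFm : AEMeasurable (fun η => ‖F η‖ₑ ^ (2 : ℝ)) volume := (Lp.aestronglyMeasurable F).enorm.pow_const _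
  have hsum := lintegral_tsum (μ := (volume : Measure R3)) (f := fun (n : ℕ) (η : R3) =>
    ((2 : ℝ≥0∞) ^ ((n : ℝ) * s) * ‖hχ.dSym n η * jap (-s) η‖ₑ) ^ (2 : ℝ) * ‖F η‖ₑ ^ (2 : ℝ))
    fun n => AEMeasurable.mul (by
      have : Continuous fun η => hχ.dSym n η * jap (-s) η :=
        (hχ.dSym n).continuous.mul (hasTemperateGrowth_jap _).1.continuous
      exact ((this.enorm.measurable.const_mul _).pow_const _).aemeasurable) hFm
  rw [← hsum]
  calc _ ≤ ∫⁻ η, A * ‖F η‖ₑ ^ (2 : ℝ) := by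
        refine lintegral_mono fun η => ?_
        rw [ENNReal.tsum_mul_right]
        gcongr
        exact hA2 η
    _ = A * eLpNorm F 2 volume ^ (2 : ℝ) := by
        have e2 : (2 : ℝ≥0∞).toReal = 2 := by simp
        rw [lintegral_const_mul' _ _ ENNReal.coe_ne_top,
          eLpNorm_eq_lintegral_rpow_enorm_toReal hp0 (by simp), e2, ← ENNReal.rpow_mul]
        norm_num
    _ ≤ _ := by
        rw [ENNReal.mul_rpow_of_nonneg _ _ (by norm_num)]
        gcongr
        calc (A : ℝ≥0∞) = ((A ^ (1 / 2 : ℝ) : ℝ≥0) : ℝ≥0∞) ^ (2 : ℝ) := by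
              rw [ENNReal.coe_rpow_of_nonneg _ (by norm_num), ← ENNReal.rpow_mul]
              norm_num
          _ ≤ _ := by
              gcongr
              exact le_self_add

end IsLPCutoff

/-! ### Low-frequency cut-offs as approximations of the identity -/

theorem tendsto_zero_of_le_const_mul {a b : ℕ → ℝ≥0∞} (C : ℝ≥0) (hb : Tendsto b atTop (𝓝 0))
    (h : ∀ n, a n ≤ C * b n) : Tendsto a atTop (𝓝 0) := by
  have h1 : Tendsto (fun n => (C : ℝ≥0∞) * b n) atTop (𝓝 0) := by
    have h2 := ENNReal.Tendsto.const_mul (a := (C : ℝ≥0∞)) hb (Or.inr ENNReal.coe_ne_top)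
    rwa [mul_zero] at h2
  exact tendsto_of_tendsto_of_tendsto_of_le_of_le tendsto_const_nhds h1 (fun _ => zero_le) h

/-- Dominated convergence for the counting measure. -/
theorem tendsto_lTwo_zero {e : ℕ → ℕ → ℝ≥0∞} {b : ℕ → ℝ≥0∞} (hb : lTwo b < ⊤)
    (h : ∀ n m, e n m ≤ b m) (he : ∀ m, Tendsto (fun n => e n m) atTop (𝓝 0)) :
    Tendsto (fun n => lTwo (e n)) atTop (𝓝 0) := by
  have h1 : Tendsto (fun n => ∑' m, e n m ^ (2 : ℝ)) atTop (𝓝 0) := by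
    have h2 := tendsto_lintegral_of_dominated_convergence (μ := (Measure.count : Measure ℕ))
      (F := fun n m => e n m ^ (2 : ℝ)) (f := fun _ => 0) (fun m => b m ^ (2 : ℝ))
      (fun n => by measurability)
      (fun n => Eventually.of_forall fun m => ENNReal.rpow_le_rpow (h n m) (by norm_num)) (by
        rw [lintegral_count, ← lTwo_rpow_two]
        exact ENNReal.rpow_ne_top_of_nonneg (by norm_num) hb.ne)
      (Eventually.of_forall fun m => by
        have h3 := (ENNReal.continuous_rpow_const (y := (2 : ℝ))).tendsto 0
        rw [ENNReal.zero_rpow_of_pos (by norm_num)] at h3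
        exact h3.comp (he m))
    simpa only [lintegral_count, tsum_zero] using h2
  have h3 := (ENNReal.continuous_rpow_const (y := (1 / 2 : ℝ))).tendsto 0
  rw [ENNReal.zero_rpow_of_pos (by norm_num)] at h3
  exact h3.comp h1

namespace IsLPCutoff

variable {χ : R3 → ℝ} (hχ : IsLPCutoff χ)

theorem tendsto_lpENorm_S_sub_ofSchwartz {p : ℝ≥0∞} (hp : 1 ≤ p) (ψ : 𝓢(R3, C3)) :
    Tendsto (fun n => lpENorm p (hχ.S n (ofSchwartz ψ) - ofSchwartz ψ)) atTop (𝓝 0) := by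
  have : Fact (1 ≤ p) := ⟨hp⟩
  have h1 : Tendsto (fun n => SchwartzMap.fourierMultiplierCLM C3 (hχ.sSym n : R3 → ℂ) ψ) atTop
      (𝓝 ψ) := by
    have h2 := hχ.tendsto_smulLeftCLM_sSym (𝓕 ψ : 𝓢(R3, C3))
    have h3 := ((FourierTransform.fourierInvCLM ℂ 𝓢(R3, C3)).continuous.tendsto (𝓕 ψ)).comp h2
    rw [FourierTransform.fourierInvCLM_apply, FourierTransform.fourierInv_fourier_eq] at h3
    exact h3
  have h5 := ((SchwartzMap.toLpCLM ℝ C3 p (volume : Measure R3)).continuous.tendsto ψ).comp h1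
  rw [tendsto_iff_edist_tendsto_0] at h5
  refine h5.congr fun n => ?_
  rw [edist_eq_enorm_sub, ← lpENorm_emb, map_sub, S, Mul_ofSchwartz (hχ.sSym n).hasTemperateGrowth]
  congr 2
  · exact Lp.toTemperedDistribution_toLp_eq _
  · exact Lp.toTemperedDistribution_toLp_eq _

theorem tendsto_lpENorm_S_sub {p : ℝ≥0∞} (hp : 1 ≤ p) (hp' : p ≠ ⊤) {u : VField}
    (hu : lpENorm p u < ⊤) :
    Tendsto (fun n => lpENorm p (hχ.S n u - u)) atTop (𝓝 0) := by
  obtain ⟨C, hC⟩ := hχ.exists_lpENorm_S_le_self hp hp'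
  obtain ⟨ψ, hψ⟩ := exists_tendsto_lpENorm_ofSchwartz_sub hp hp' hu
  have hψ' : Tendsto (fun k => (C + 1 : ℝ≥0) * lpENorm p (ofSchwartz (ψ k) - u)) atTop (𝓝 0) := by
    have h2 := ENNReal.Tendsto.const_mul (a := ((C + 1 : ℝ≥0) : ℝ≥0∞)) hψ
      (Or.inr ENNReal.coe_ne_top)
    rwa [mul_zero] at h2
  rw [ENNReal.tendsto_nhds_zero]
  intro ε hε
  obtain ⟨k, hk⟩ := (ENNReal.tendsto_nhds_zero.1 hψ' (ε / 2) (by simpa using hε.ne')).exists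
  filter_upwards [ENNReal.tendsto_nhds_zero.1 (hχ.tendsto_lpENorm_S_sub_ofSchwartz hp (ψ k)) (ε / 2)
    (by simpa using hε.ne')] with n hn
  set v := ofSchwartz (ψ k) with hv
  -- The uniform bound of `S n` on `L^p` controls the error of replacing `u` by the Schwartz field
  -- `v`.
  have e1 : hχ.S n u - u = (hχ.S n v - v) + ((v - u) - hχ.S n (v - u)) := by
    rw [map_sub]
    abel
  rw [e1, ← ENNReal.add_halves ε]
  refine (lpENorm_add_le hp _ _).trans (add_le_add hn (le_trans ?_ hk))
  refine (lpENorm_sub_le hp _ _).trans ?_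
  push_cast
  rw [add_mul, one_mul, add_comm]
  gcongr
  exact hC n _

theorem exists_lTwo_coef_S_le_self {s : ℝ} {p : ℝ≥0∞} (hp : 1 ≤ p) (hp' : p ≠ ⊤) : ∃ C : ℝ≥0,
    ∀ n u, lTwo (hχ.coef s p (hχ.S n u)) ≤ C * lTwo (hχ.coef s p u) := by
  obtain ⟨C, hC⟩ := hχ.exists_lpENorm_S_le_self hp hp'
  refine ⟨C, fun n u => ?_⟩
  rw [← lTwo_const_mul]
  refine lTwo_mono fun m => ?_
  rw [coef, coef, D_S_comm, mul_left_comm]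
  gcongr
  exact hC n _

theorem tendsto_lTwo_coef_S_sub {s : ℝ} {p : ℝ≥0∞} (hp : 1 ≤ p) (hp' : p ≠ ⊤) {u : VField}
    (hu : lTwo (hχ.coef s p u) < ⊤) :
    Tendsto (fun n => lTwo (hχ.coef s p (hχ.S n u - u))) atTop (𝓝 0) := by
  obtain ⟨C, hC⟩ := hχ.exists_lpENorm_S_le_self hp hp'
  have hb : lTwo (fun m => ((C + 1 : ℝ≥0) : ℝ≥0∞) * hχ.coef s p u m) < ⊤ := by
    rw [lTwo_const_mul]
    exact ENNReal.mul_lt_top ENNReal.coe_lt_top hu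
  have e1 : ∀ n m, hχ.D m (hχ.S n u - u) = hχ.S n (hχ.D m u) - hχ.D m u := fun n m => by
    rw [map_sub, D_S_comm]
  refine tendsto_lTwo_zero hb (fun n m => ?_) fun m => ?_
  · rw [coef, coef, e1, mul_left_comm]
    gcongr
    refine (lpENorm_sub_le hp _ _).trans ?_
    push_cast
    rw [add_mul, one_mul]
    gcongr
    exact hC n _
  · have h1 := hχ.tendsto_lpENorm_S_sub hp hp' (hχ.lpENorm_D_lt_top hu m)
    have h2 := ENNReal.Tendsto.const_mul (a := (2 : ℝ≥0∞) ^ ((m : ℝ) * s)) h1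
      (Or.inr (two_rpow_ne_top _))
    rw [mul_zero] at h2
    refine h2.congr fun n => ?_
    rw [coef, e1]

/-- `S n u` has only finitely many blocks, so an `L^p` bound with a constant depending on `n`
suffices. It carries density from `L^p` to the Besov space. -/
theorem exists_lTwo_coef_S_le {s : ℝ} {p : ℝ≥0∞} (hp : 1 ≤ p) (hp' : p ≠ ⊤) (n : ℕ) :
    ∃ C : ℝ≥0, ∀ u, lTwo (hχ.coef s p (hχ.S n u)) ≤ C * lpENorm p u := by
  obtain ⟨A, hA⟩ := hχ.exists_lpENorm_S_le_self hp hp'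
  obtain ⟨B, hB⟩ := hχ.exists_lpENorm_D_le_self hp hp'
  set e : ℕ → ℝ≥0∞ := fun m => if m < n + 2 then 2 ^ ((m : ℝ) * s) else 0 with he
  have hfin : lTwo e ≠ ⊤ := by
    refine ENNReal.rpow_ne_top_of_nonneg (by norm_num) ?_
    rw [tsum_eq_sum (s := Finset.range (n + 2)) fun m hm => by
      rw [he]
      simp only [Finset.mem_range] at hm
      simp [hm]]
    refine ENNReal.sum_ne_top.2 fun m _ => ENNReal.rpow_ne_top_of_nonneg (by norm_num) ?_
    rw [he]
    beta_reduce
    split_ifs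
    · exact two_rpow_ne_top _
    · simp
  refine ⟨A * B * (lTwo e).toNNReal, fun u => ?_⟩
  push_cast
  rw [ENNReal.coe_toNNReal hfin, mul_right_comm, ← lTwo_const_mul]
  refine lTwo_mono fun m => ?_
  rw [coef, he]
  beta_reduce
  split_ifs with hm
  · rw [mul_comm]
    gcongr
    calc _ ≤ B * lpENorm p (hχ.S n u) := hB m _
      _ ≤ B * (A * lpENorm p u) := by
        gcongr
        exact hA n u
      _ = _ := by ring
  · rw [hχ.D_S_of_lt (by omega), lpENorm_zero, mul_zero]
    exact zero_le

theorem S_jap (n : ℕ) (s : ℝ) (u : VField) :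
    Mul (jap s) (hχ.S n u) = hχ.S n (Mul (jap s) u) :=
  Mul_comm (hasTemperateGrowth_jap s) (hχ.sSym n).hasTemperateGrowth u

theorem exists_sobolevENorm_S_le_self (s : ℝ) : ∃ C : ℝ≥0, ∀ n u,
    sobolevENorm s (hχ.S n u) ≤ C * sobolevENorm s u := by
  obtain ⟨C, hC⟩ := hχ.exists_lpENorm_S_le_self (p := 2) (by norm_num) (by simp)
  refine ⟨C, fun n u => ?_⟩
  rw [sobolevENorm, sobolevENorm, besselPotential_eq, besselPotential_eq, S_jap]
  exact hC n _

theorem tendsto_sobolevENorm_S_sub {s : ℝ} {u : VField} (hu : sobolevENorm s u < ⊤) :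
    Tendsto (fun n => sobolevENorm s (hχ.S n u - u)) atTop (𝓝 0) := by
  have h := hχ.tendsto_lpENorm_S_sub (p := 2) (by norm_num) (by simp) hu
  refine h.congr fun n => ?_
  rw [sobolevENorm, besselPotential_eq, besselPotential_eq, map_sub, S_jap]

theorem isDivFree_S (n : ℕ) {u : VField} (hu : IsDivFree u) : IsDivFree (hχ.S n u) := by
  intro φ
  have h : ∀ j, (∂_{basisVec j} (hχ.S n u) : VField) = hχ.S n (∂_{basisVec j} u) := fun j => by
    rw [TemperedDistribution.lineDeriv_eq_fourierMultiplierCLM,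
      TemperedDistribution.lineDeriv_eq_fourierMultiplierCLM, map_smul, S,
      Mul_comm (by fun_prop) (hχ.sSym n).hasTemperateGrowth]
  simp_rw [h, S, TemperedDistribution.fourierMultiplierCLM_apply_apply]
  exact hu _

end IsLPCutoff

/-! ### Density of Schwartz fields and of real Schwartz fields -/

/-- The componentwise real part. -/
def reField : C3 →L[ℝ] C3 :=
  LinearMap.toContinuousLinearMap
    { toFun := fun z => WithLp.toLp 2 fun k => ((z k).re : ℂ)
      map_add' := fun z w => by ext k; simp
      map_smul' := fun c z => by ext k; simp }

theorem reField_apply (z : C3) (k : Fin 3) : reField z k = ((z k).re : ℂ) := rfl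

theorem norm_reField_le (z : C3) : ‖reField z‖ ≤ ‖z‖ := by
  rw [EuclideanSpace.norm_eq, EuclideanSpace.norm_eq]
  refine Real.sqrt_le_sqrt (Finset.sum_le_sum fun k _ => ?_)
  rw [reField_apply, Complex.norm_real]
  gcongr
  exact Complex.abs_re_le_norm _

theorem reField_of_im_eq_zero {z : C3} (h : ∀ k, (z k).im = 0) : reField z = z := by
  ext k
  rw [reField_apply]
  exact Complex.ext rfl (h k).symm

theorem exists_tendsto_lpENorm_ofSchwartz_sub_real {p : ℝ≥0∞} (hp : 1 ≤ p) (hp' : p ≠ ⊤)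
    {u : VField} (hu : lpENorm p u < ⊤) : ∃ ψ : ℕ → 𝓢(R3, C3),
      Tendsto (fun n => lpENorm p (ofSchwartz (ψ n) - u)) atTop (𝓝 0) ∧
      (IsRealField u → ∀ n, IsRealField (ofSchwartz (ψ n))) := by
  obtain ⟨ψ, hψ⟩ := exists_tendsto_lpENorm_ofSchwartz_sub hp hp' hu
  by_cases hr : IsRealField u
  swap
  · exact ⟨ψ, hψ, fun h => absurd h hr⟩
  obtain ⟨f, hf⟩ := exists_isLpFun hu
  have hsub : ∀ φ : 𝓢(R3, C3), IsLpFun p (ofSchwartz φ - u) (fun x => φ x - f x) := fun φ => by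
    have h1 := (isLpFun_ofSchwartz p φ).add hp (hf.smul (-1))
    have h2 : ofSchwartz φ + (-1 : ℂ) • u = ofSchwartz φ - u := by
      rw [sub_eq_add_neg]
      exact congrArg _ (neg_one_smul ℂ u)
    have h3 : (φ : R3 → C3) + (-1 : ℂ) • f = fun x => φ x - f x := by
      ext1 x
      simp [sub_eq_add_neg]
    rwa [h2, h3] at h1
  -- Taking real parts of the approximants does not increase their distance to a real field.
  refine ⟨fun n => (ψ n).postcompCLM reField, ?_, fun _ n => ?_⟩
  · refine tendsto_of_tendsto_of_tendsto_of_le_of_le tendsto_const_nhds hψ (fun _ => zero_le)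
      fun n => ?_
    rw [lpENorm_eq_eLpNorm hp (hsub _), lpENorm_eq_eLpNorm hp (hsub _)]
    refine eLpNorm_mono_ae ?_
    filter_upwards [hf.ae_real hp hr] with x hx
    have h1 : (ψ n).postcompCLM reField x - f x = reField (ψ n x - f x) := by
      rw [map_sub, reField_of_im_eq_zero hx]
      rfl
    rw [h1]
    exact norm_reField_le _
  · refine (isLpFun_ofSchwartz p _).isRealField hp (Eventually.of_forall fun x k => ?_)
    exact Complex.ofReal_im _

/-- The Bessel potential is an isometry onto `L²`, preserves Schwartz fields and, having a real even
symbol, real fields; so the density in `L²` is pulled back. -/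
theorem exists_tendsto_sobolevENorm_ofSchwartz_sub {s : ℝ} {u : VField}
    (hu : sobolevENorm s u < ⊤) : ∃ ψ : ℕ → 𝓢(R3, C3),
      Tendsto (fun n => sobolevENorm s (ofSchwartz (ψ n) - u)) atTop (𝓝 0) ∧
      (IsRealField u → ∀ n, IsRealField (ofSchwartz (ψ n))) := by
  have hreal : ∀ (t : ℝ) {v : VField}, IsRealField v → IsRealField (Mul (jap t) v) := fun t v hv =>
    hv.Mul (hasTemperateGrowth_jap t) fun η => by rw [conj_jap, jap_neg]
  obtain ⟨ψ, hψ, hr⟩ := exists_tendsto_lpENorm_ofSchwartz_sub_real (p := 2) (by norm_num) (by simp) hu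
  have h1 : ∀ n, ofSchwartz (SchwartzMap.fourierMultiplierCLM C3 (jap (-s)) (ψ n)) =
      Mul (jap (-s)) (ofSchwartz (ψ n)) := fun n =>
    (Mul_ofSchwartz (hasTemperateGrowth_jap _) _).symm
  refine ⟨fun n => SchwartzMap.fourierMultiplierCLM C3 (jap (-s)) (ψ n), ?_, fun h n => ?_⟩
  · refine hψ.congr fun n => ?_
    rw [h1, sobolevENorm, besselPotential_eq, besselPotential_eq, map_sub, Mul_jap_neg]
  · rw [h1]
    exact hreal _ (hr (hreal _ h) n)

theorem sobolevENorm_ofSchwartz_lt_top (s : ℝ) (ψ : 𝓢(R3, C3)) :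
    sobolevENorm s (ofSchwartz ψ) < ⊤ := by
  rw [sobolevENorm, besselPotential_eq, Mul_ofSchwartz (hasTemperateGrowth_jap s)]
  exact (isLpFun_ofSchwartz 2 _).lpENorm_lt_top (by norm_num)

namespace IsLPCutoff

variable {χ : R3 → ℝ} (hχ : IsLPCutoff χ)

/-- A diagonal choice: `S n u` tends to `u` in the Besov norm, and for each `n` some index `k n`
brings `S n (ψ (k n))` within `1/n` of `S n u`. At `n = 0` the tolerance is infinite. -/
theorem exists_tendsto_lTwo_coef_ofSchwartz_sub {s : ℝ} {p : ℝ≥0∞} (hp : 1 ≤ p) (hp' : p ≠ ⊤)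
    {u : VField} (hu : lpENorm p u < ⊤) (hu' : lTwo (hχ.coef s p u) < ⊤) : ∃ ψ : ℕ → 𝓢(R3, C3),
      Tendsto (fun n => lTwo (hχ.coef s p (ofSchwartz (ψ n) - u))) atTop (𝓝 0) ∧
      (IsRealField u → ∀ n, IsRealField (ofSchwartz (ψ n))) := by
  obtain ⟨ψ, hψ, hr⟩ := exists_tendsto_lpENorm_ofSchwartz_sub_real hp hp' hu
  choose C hC using hχ.exists_lTwo_coef_S_le (s := s) hp hp'
  have hk : ∀ n : ℕ, ∃ k, lTwo (hχ.coef s p (hχ.S n (ofSchwartz (ψ k) - u))) ≤ (n : ℝ≥0∞)⁻¹ :=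
    fun n => by
      have h1 := tendsto_zero_of_le_const_mul (C n) hψ fun k => hC n _
      exact (ENNReal.tendsto_nhds_zero.1 h1 _ (by simp)).exists
  choose k hk using hk
  have h2 : ∀ n, hχ.S n (ofSchwartz (ψ (k n))) =
      ofSchwartz (SchwartzMap.fourierMultiplierCLM C3 (hχ.sSym n : R3 → ℂ) (ψ (k n))) := fun n =>
    Mul_ofSchwartz (hχ.sSym n).hasTemperateGrowth _
  refine ⟨fun n => SchwartzMap.fourierMultiplierCLM C3 (hχ.sSym n : R3 → ℂ) (ψ (k n)), ?_,
    fun h n => ?_⟩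
  · have h3 := ENNReal.tendsto_inv_nat_nhds_zero.add (hχ.tendsto_lTwo_coef_S_sub hp hp' hu')
    rw [add_zero] at h3
    refine tendsto_of_tendsto_of_tendsto_of_le_of_le tendsto_const_nhds h3 (fun _ => zero_le)
      fun n => ?_
    beta_reduce
    have h4 : hχ.S n (ofSchwartz (ψ (k n))) - u =
        hχ.S n (ofSchwartz (ψ (k n)) - u) + (hχ.S n u - u) := by
      rw [map_sub]
      abel
    rw [← h2, h4]
    refine le_trans ?_ (add_le_add (hk n) le_rfl)
    refine le_trans (lTwo_mono fun m => ?_) (lTwo_add_le _ _)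
    rw [coef, coef, coef, ← mul_add, map_add]
    gcongr
    exact lpENorm_add_le hp _ _
  · rw [← h2]
    exact hχ.isRealField_S n (hr h _)

end IsLPCutoff

/-! ### Uniqueness of continuous extensions -/

/-- Every field in `U` is a limit of smooth `L³` fields in `U`. -/
def SmoothDense (N : VField → ℝ≥0∞) (U : Set VField) : Prop :=
  ∀ u ∈ U, ∃ u' : ℕ → VField, (∀ n, u' n ∈ U) ∧
    (∀ n, ∃ f, ContDiff ℝ ∞ f ∧ IsLpFun 3 (u' n) f) ∧ Tendsto (fun n => N (u' n - u)) atTop (𝓝 0)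

/-- Every field in `W` is a limit of Schwartz fields in `W`. -/
def SchwartzDense (N : VField → ℝ≥0∞) (W : Set VField) : Prop :=
  ∀ w ∈ W, ∃ ψ : ℕ → 𝓢(R3, C3), (∀ n, ofSchwartz (ψ n) ∈ W) ∧
    Tendsto (fun n => N (ofSchwartz (ψ n) - w)) atTop (𝓝 0)

theorem extensionUnique_of_dense {N : VField → ℝ≥0∞} {U V W : Set VField} (hU : SmoothDense N U)
    (hV : SmoothDense N V) (hW : SchwartzDense N W) : ExtensionUnique N U V W := by
  intro T₁ T₂ h1 h2 e1 e2 u hu v hv w hw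
  obtain ⟨u', hu', hf, hul⟩ := hU u hu
  obtain ⟨v', hv', hg, hvl⟩ := hV v hv
  obtain ⟨ψ, hψ, hwl⟩ := hW w hw
  choose f hfs hf using hf
  choose g hgs hg using hg
  refine tendsto_nhds_unique (h1 u hu v hv w hw u' v' _ hu' hv' hψ hul hvl hwl)
    ((h2 u hu v hv w hw u' v' _ hu' hv' hψ hul hvl hwl).congr fun n => ?_)
  rw [e1 _ (hu' n) _ (hv' n) (f n) (g n) (ψ n) (hψ n) (hf n) (hg n) (hfs n) (hgs n),
    e2 _ (hu' n) _ (hv' n) (f n) (g n) (ψ n) (hψ n) (hf n) (hg n) (hfs n) (hgs n)]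

namespace IsLPCutoff

variable {χ : R3 → ℝ} (hχ : IsLPCutoff χ)

include hχ in
theorem smoothDense_of_S {X : Submodule ℂ VField} {N : VField → ℝ≥0∞} {P : VField → Prop}
    (h3 : ∀ u ∈ X, lpENorm 3 u < ⊤) (hS : ∀ u ∈ X, ∀ n, hχ.S n u ∈ X)
    (hl : ∀ u ∈ X, Tendsto (fun n => N (hχ.S n u - u)) atTop (𝓝 0))
    (hP : ∀ u, P u → ∀ n, P (hχ.S n u)) : SmoothDense N (X ∩ {u | P u}) := by
  have hc : ENNReal.HolderConjugate (3 / 2) 3 := holderTriple_of_toReal (by simp) (by simp) (by simp)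
    (by norm_num)
  rintro u ⟨hu, hPu⟩
  have hq : (3 / 2 : ℝ≥0∞) ≠ ⊤ := ENNReal.div_ne_top (by simp) (by simp)
  exact ⟨fun n => hχ.S n u, fun n => ⟨hS u hu n, hP u hPu n⟩,
    fun n => exists_contDiff_isLpFun_Mul (q := 3 / 2) (p := 3) hq three_ne_top _ (h3 u hu),
    hl u hu⟩

end IsLPCutoff

/-! ### The extension of the trilinear form -/

theorem advection_congr_ae {f f' g g' : R3 → C3} (hf : f =ᵐ[volume] f') (hg : g =ᵐ[volume] g')
    (w : 𝓢(R3, C3)) : advection f g w = advection f' g' w := by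
  rw [advection, advection]
  congr 1
  refine integral_congr_ae ?_
  filter_upwards [hf, hg] with x h1 h2
  rw [h1, h2]

theorem pair_advL_eq_advection {F G : Lp C3 3 (volume : Measure R3)} {u v : VField}
    (hu : emb 3 F = u) (hv : emb 3 G = v) {f g : R3 → C3} (hf : IsLpFun 3 u f) (hg : IsLpFun 3 v g)
    (w : 𝓢(R3, C3)) : pair (advL F G) w = advection f g w := by
  rw [pair_advL]
  exact advection_congr_ae ((hu ▸ isLpFun_emb F).ae_eq Fact.out Fact.out hf)
    ((hv ▸ isLpFun_emb G).ae_eq Fact.out Fact.out hg) w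

theorem tendsto_integral_dot {p q : ℝ≥0∞} [hp : Fact (1 ≤ p)] [hq : Fact (1 ≤ q)]
    [ENNReal.HolderConjugate p q] {b h : R3 → C3} (hb : MemLp b p volume) {w : VField}
    (hw : IsLpFun q w h) {ψ : ℕ → 𝓢(R3, C3)}
    (hψ : Tendsto (fun n => lpENorm q (ofSchwartz (ψ n) - w)) atTop (𝓝 0)) :
    Tendsto (fun n => ∫ x, dot (b x) (ψ n x)) atTop (𝓝 (∫ x, dot (b x) (h x))) := by
  have h1 : Tendsto (fun n => (ψ n).toLp q volume) atTop (𝓝 (hw.1.toLp h)) := by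
    rw [tendsto_iff_edist_tendsto_0]
    refine hψ.congr fun n => ?_
    rw [edist_eq_enorm_sub, ← lpENorm_emb, map_sub, hw.emb_toLp]
    congr 2
    exact (Lp.toTemperedDistribution_toLp_eq (ψ n)).symm
  have h2 := ((dotB.lpPairing volume p q (hb.toLp b)).continuous.tendsto _).comp h1
  have h3 : ∀ F : Lp C3 q (volume : Measure R3), dotB.lpPairing volume p q (hb.toLp b) F =
      ∫ x, dot (b x) (F x) := fun F => by
    rw [ContinuousLinearMap.lpPairing_eq_integral]
    refine integral_congr_ae ?_
    filter_upwards [hb.coeFn_toLp] with x hx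
    rw [hx, dotB_apply]
  rw [h3] at h2
  have h4 : ∫ x, dot (b x) (hw.1.toLp h x) = ∫ x, dot (b x) (h x) := by
    refine integral_congr_ae ?_
    filter_upwards [hw.1.coeFn_toLp] with x hx
    rw [hx]
  rw [h4] at h2
  refine h2.congr fun n => ?_
  rw [Function.comp_apply, h3]
  refine integral_congr_ae ?_
  filter_upwards [(ψ n).coeFn_toLp q volume] with x hx
  rw [hx]

namespace IsLPCutoff

variable {χ : R3 → ℝ} (hχ : IsLPCutoff χ)

instance : Fact ((1 : ℝ≥0∞) ≤ 18 / 11) := ⟨one_le_eighteen_elevenths⟩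

instance : ENNReal.HolderConjugate (3 / 2) 3 :=
  holderTriple_of_toReal (by simp) (by simp) (by simp) (by norm_num)

instance : ENNReal.HolderConjugate (18 / 11) (18 / 7) :=
  holderTriple_of_toReal (by simp) (by simp) (by simp) (by norm_num)

-- The argument common to the Besov and the Sobolev space: boundedness, control of `L³`, dense
-- Schwartz fields and convergent cut-offs `S n` suffice. Each uniqueness clause restricts to a
-- property that these approximations preserve.
include hχ in
theorem isUniqueExtension_of {X : Submodule ℂ VField} {N : VField → ℝ≥0∞}
    {T : X →ₗ[ℂ] X →ₗ[ℂ] X →ₗ[ℂ] ℂ}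
    (hb : ∃ K : ℝ≥0, ∀ u v w : X, ‖T u v w‖ₑ ≤ K * N u * N v * N w)
    (hfin : ∀ u ∈ X, N u < ⊤) (h3 : ∃ K : ℝ≥0, ∀ u, lpENorm 3 u ≤ K * N u)
    (hmem : ∀ ψ, ofSchwartz ψ ∈ X)
    (hd : ∀ w ∈ X, ∃ ψ : ℕ → 𝓢(R3, C3), Tendsto (fun n => N (ofSchwartz (ψ n) - w)) atTop (𝓝 0) ∧
      (IsRealField w → ∀ n, IsRealField (ofSchwartz (ψ n))))
    (hS : ∀ u ∈ X, ∀ n, hχ.S n u ∈ X)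
    (hl : ∀ u ∈ X, Tendsto (fun n => N (hχ.S n u - u)) atTop (𝓝 0))
    (heq : ∀ (u v w : X) (f g : R3 → C3) (ψ : 𝓢(R3, C3)), IsLpFun 3 u f → IsLpFun 3 v g →
      (w : VField) = ofSchwartz ψ → T u v w = advection f g ψ)
    (hreal : ∀ u v w : X, IsRealField u → IsRealField v → IsRealField w → (T u v w).im = 0) :
    IsUniqueExtension X N T := by
  have h3' : ∀ u ∈ X, lpENorm 3 u < ⊤ := fun u hu => by
    obtain ⟨K, hK⟩ := h3
    exact (hK u).trans_lt (ENNReal.mul_lt_top ENNReal.coe_lt_top (hfin u hu))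
  have hsm : ∀ {P : VField → Prop}, (∀ u, P u → ∀ n, P (hχ.S n u)) →
      SmoothDense N (X ∩ {u | P u}) := fun hP => hχ.smoothDense_of_S h3' hS hl hP
  have hX : (X : Set VField) = (X : Set VField) ∩ {_u | True} := by simp
  have hsm' : SmoothDense N X := by
    rw [hX]
    exact hsm fun _ _ _ => trivial
  have hsc : SchwartzDense N X := fun w hw => by
    obtain ⟨ψ, hψ, -⟩ := hd w hw
    exact ⟨ψ, fun n => hmem _, hψ⟩
  have hsr : SchwartzDense N (X ∩ {w | IsRealField w}) := fun w hw => by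
    obtain ⟨ψ, hψ, hr⟩ := hd w hw.1
    exact ⟨ψ, fun n => ⟨hmem _, hr hw.2 n⟩, hψ⟩
  have hR : ∀ u, IsRealField u → ∀ n, IsRealField (hχ.S n u) := fun u hu n => hχ.isRealField_S n hu
  have hD : ∀ u, IsDivFree u → ∀ n, IsDivFree (hχ.S n u) := fun u hu n => hχ.isDivFree_S n hu
  refine ⟨hb, fun u => exists_isLpFun (h3' u u.2), hmem, heq, ?_, hreal,
    extensionUnique_of_dense hsm' hsm' hsc, extensionUnique_of_dense (hsm hD) hsm' hsc,
    extensionUnique_of_dense (hsm hR) (hsm hR) hsr,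
    extensionUnique_of_dense (hsm fun u hu n => ⟨hD u hu.1 n, hR u hu.2 n⟩) (hsm hR) hsr⟩
  -- Only `w` is approximated: `T u v` is continuous by its bound, and the integrals against `b ∈
  -- L^{3/2}` converge because the norm controls that of `L³`. On Schwartz fields both sides agree.
  intro u v w f g h b hf hg hh hbL hadv
  obtain ⟨K, hK⟩ := hb
  obtain ⟨K3, hK3⟩ := h3
  obtain ⟨ψ, hψ, -⟩ := hd w w.2
  set w' : ℕ → X := fun n => ⟨ofSchwartz (ψ n), hmem _⟩ with hw'
  have h1 : Tendsto (fun n => T u v (w' n)) atTop (𝓝 (T u v w)) := by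
    rw [tendsto_iff_edist_tendsto_0]
    have hc : (K : ℝ≥0∞) * N u * N v ≠ ⊤ :=
      (ENNReal.mul_lt_top (ENNReal.mul_lt_top ENNReal.coe_lt_top (hfin u u.2)) (hfin v v.2)).ne
    refine tendsto_zero_of_le_const_mul ((K : ℝ≥0∞) * N u * N v).toNNReal hψ fun n => ?_
    rw [ENNReal.coe_toNNReal hc, edist_eq_enorm_sub, ← map_sub]
    exact hK u v (w' n - w)
  have h2 := tendsto_integral_dot hbL hh
    (tendsto_zero_of_le_const_mul K3 hψ fun n => hK3 (ofSchwartz (ψ n) - w))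
  refine tendsto_nhds_unique h1 (h2.congr fun n => ?_)
  rw [hadv, heq u v (w' n) f g (ψ n) hf hg rfl]

/-- The `L³` representative of a field in `B^{1/2}_{18/7,2}`. -/
def rep : besov χ (1 / 2) (18 / 7) 2 →ₗ[ℂ] Lp C3 3 (volume : Measure R3) :=
  lpRep 3 _ hχ.lpENorm_three_lt_top

theorem emb_rep (u : besov χ (1 / 2) (18 / 7) 2) : emb 3 (hχ.rep u) = u :=
  emb_lpRep hχ.lpENorm_three_lt_top u

theorem exists_lTwo_coef_advL_rep_le : ∃ K : ℝ≥0, ∀ u v : besov χ (1 / 2) (18 / 7) 2,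
    lTwo (hχ.coef (-1 / 2) (18 / 11) (advL (hχ.rep u) (hχ.rep v))) ≤
      K * (lTwo (hχ.coef (1 / 2) (18 / 7) u) * lTwo (hχ.coef (1 / 2) (18 / 7) v)) := by
  obtain ⟨K, hK⟩ := hχ.exists_lTwo_coef_advL_le
  refine ⟨K, fun u v => ?_⟩
  have h := hK (hχ.rep u) (hχ.rep v)
  rw [emb_rep, emb_rep] at h
  exact h (hχ.lTwo_coef_lt_top u) (hχ.lTwo_coef_lt_top v)

theorem advL_rep_mem (u v : besov χ (1 / 2) (18 / 7) 2) :
    advL.compl₁₂ hχ.rep hχ.rep u v ∈ besov χ (-1 / 2) (18 / 11) 2 := by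
  obtain ⟨K, hK⟩ := hχ.exists_lTwo_coef_advL_rep_le
  exact hχ.besovENorm_lt_top_iff_lTwo.2 ((hK u v).trans_lt (ENNReal.mul_lt_top ENNReal.coe_lt_top
    (ENNReal.mul_lt_top (hχ.lTwo_coef_lt_top u) (hχ.lTwo_coef_lt_top v))))

theorem neg_one_div_two : (-1 / 2 : ℝ) = -(1 / 2) := by norm_num

/-- The trilinear form on `B^{1/2}_{18/7,2}`. -/
def triform : besov χ (1 / 2) (18 / 7) 2 →ₗ[ℂ] besov χ (1 / 2) (18 / 7) 2 →ₗ[ℂ]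
    besov χ (1 / 2) (18 / 7) 2 →ₗ[ℂ] ℂ :=
  (codRestrict₂ (besov χ (-1 / 2) (18 / 11) 2) (advL.compl₁₂ hχ.rep hχ.rep)
    hχ.advL_rep_mem).compr₂ (hχ.dual neg_one_div_two)

theorem triform_apply (u v w : besov χ (1 / 2) (18 / 7) 2) : hχ.triform u v w =
    hχ.dual neg_one_div_two (⟨advL (hχ.rep u) (hχ.rep v), hχ.advL_rep_mem u v⟩ :
      besov χ (-1 / 2) (18 / 11) 2) w := rfl

theorem exists_enorm_triform_le : ∃ K : ℝ≥0, ∀ u v w : besov χ (1 / 2) (18 / 7) 2,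
    ‖hχ.triform u v w‖ₑ ≤ K * lTwo (hχ.coef (1 / 2) (18 / 7) u) *
      lTwo (hχ.coef (1 / 2) (18 / 7) v) * lTwo (hχ.coef (1 / 2) (18 / 7) w) := by
  obtain ⟨A, hA⟩ := hχ.exists_lTwo_coef_advL_rep_le
  obtain ⟨B, hB⟩ := hχ.exists_enorm_dual_le (p := 18 / 11) (q := 18 / 7) neg_one_div_two
  refine ⟨B * A, fun u v w => ?_⟩
  rw [triform_apply]
  refine (hB _ w).trans ?_
  push_cast
  refine le_trans (mul_le_mul_left (mul_le_mul_right (hA u v) _) _) (le_of_eq ?_)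
  ring

theorem triform_eq_advection (u v w : besov χ (1 / 2) (18 / 7) 2) (f g : R3 → C3) (ψ : 𝓢(R3, C3))
    (hf : IsLpFun 3 u f) (hg : IsLpFun 3 v g) (hw : (w : VField) = ofSchwartz ψ) :
    hχ.triform u v w = advection f g ψ := by
  rw [triform_apply, hχ.dual_ofSchwartz _ _ _ hw]
  exact pair_advL_eq_advection (hχ.emb_rep u) (hχ.emb_rep v) hf hg ψ

theorem triform_im (u v w : besov χ (1 / 2) (18 / 7) 2) (hu : IsRealField (u : VField))
    (hv : IsRealField (v : VField)) (hw : IsRealField (w : VField)) :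
    (hχ.triform u v w).im = 0 := by
  rw [triform_apply]
  refine hχ.dual_im _ _ _ ?_ hw
  rw [← hχ.emb_rep] at hu hv
  exact isRealField_advL hu hv

-- Plancherel gives `H^{5/6} ⊂ B^{5/6}_{2,2}`, and Bernstein then raises the exponent to `18/7`, as
-- `3(1/2 - 7/18) = 5/6 - 1/2`.
include hχ in
theorem exists_besovENorm_le_sobolevENorm : ∃ K : ℝ≥0, ∀ u,
    besovENorm χ (1 / 2) (18 / 7) 2 u ≤ K * sobolevENorm (5 / 6) u := by
  obtain ⟨A, hA⟩ := hχ.exists_besovENorm_le_lTwo_coef (1 / 2) (18 / 7)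
  obtain ⟨B, hB⟩ := hχ.exists_lTwo_coef_le (p := 2) (q := 18 / 7) (s := 5 / 6) (t := 1 / 2)
    (by norm_num) (by rw [ENNReal.le_div_iff_mul_le (by simp) (by simp)]; norm_num)
    (ENNReal.div_ne_top (by simp) (by simp)) (by norm_num)
  obtain ⟨C, hC⟩ := hχ.exists_lTwo_coef_le_sobolev (s := 5 / 6) (by norm_num)
  refine ⟨A * B * C, fun u => ?_⟩
  push_cast
  calc _ ≤ A * lTwo (hχ.coef (1 / 2) (18 / 7) u) := hA u
    _ ≤ A * (B * lTwo (hχ.coef (5 / 6) 2 u)) := by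
      gcongr
      exact hB u
    _ ≤ A * (B * (C * sobolevENorm (5 / 6) u)) := by
      gcongr
      exact hC u
    _ = _ := by ring

include hχ in
theorem sobolev_le_besov : sobolev (5 / 6) ≤ besov χ (1 / 2) (18 / 7) 2 := fun u hu => by
  obtain ⟨K, hK⟩ := hχ.exists_besovENorm_le_sobolevENorm
  exact (hK u).trans_lt (ENNReal.mul_lt_top ENNReal.coe_lt_top hu)

theorem exists_enorm_triform_le_besovENorm : ∃ K : ℝ≥0, ∀ u v w : besov χ (1 / 2) (18 / 7) 2,
    ‖hχ.triform u v w‖ₑ ≤ K * besovENorm χ (1 / 2) (18 / 7) 2 u *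
      besovENorm χ (1 / 2) (18 / 7) 2 v * besovENorm χ (1 / 2) (18 / 7) 2 w := by
  obtain ⟨A, hA⟩ := hχ.exists_enorm_triform_le
  obtain ⟨B, hB⟩ := hχ.exists_lTwo_coef_le_besovENorm (1 / 2) (18 / 7)
  refine ⟨A * B ^ 3, fun u v w => (hA u v w).trans ?_⟩
  push_cast
  calc _ ≤ A * (B * besovENorm χ (1 / 2) (18 / 7) 2 u) * (B * besovENorm χ (1 / 2) (18 / 7) 2 v) *
        (B * besovENorm χ (1 / 2) (18 / 7) 2 w) := by
        gcongr
        · exact hB u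
        · exact hB v
        · exact hB w
    _ = _ := by ring

include hχ in
theorem exists_lpENorm_three_le_besovENorm : ∃ K : ℝ≥0, ∀ u,
    lpENorm 3 u ≤ K * besovENorm χ (1 / 2) (18 / 7) 2 u := by
  obtain ⟨A, hA⟩ := hχ.exists_lpENorm_three_le
  obtain ⟨B, hB⟩ := hχ.exists_lTwo_coef_le_besovENorm (1 / 2) (18 / 7)
  refine ⟨A * B, fun u => (hA u).trans ?_⟩
  push_cast
  rw [mul_assoc]
  gcongr
  exact hB u

theorem eighteen_sevenths_ne_top : (18 / 7 : ℝ≥0∞) ≠ ⊤ := ENNReal.div_ne_top (by simp) (by simp)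

theorem isUniqueExtension_triform :
    IsUniqueExtension (besov χ (1 / 2) (18 / 7) 2) (besovENorm χ (1 / 2) (18 / 7) 2) hχ.triform := by
  have hp : (1 : ℝ≥0∞) ≤ 18 / 7 := Fact.out
  obtain ⟨B, hB⟩ := hχ.exists_besovENorm_le_lTwo_coef (1 / 2) (18 / 7)
  refine hχ.isUniqueExtension_of hχ.exists_enorm_triform_le_besovENorm (fun u hu => hu)
    hχ.exists_lpENorm_three_le_besovENorm
    (fun ψ => hχ.sobolev_le_besov (sobolevENorm_ofSchwartz_lt_top _ ψ)) (fun w hw => ?_)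
    (fun u hu n => ?_) (fun u hu => ?_) hχ.triform_eq_advection hχ.triform_im
  · obtain ⟨ψ, hψ, hr⟩ := hχ.exists_tendsto_lTwo_coef_ofSchwartz_sub (s := 1 / 2) hp
      eighteen_sevenths_ne_top (hχ.lpENorm_lt_top_of_mem_besov (by norm_num) w hw)
      (hχ.besovENorm_lt_top_iff_lTwo.1 hw)
    exact ⟨ψ, tendsto_zero_of_le_const_mul B hψ fun n => hB _, hr⟩
  · obtain ⟨C, hC⟩ := hχ.exists_lTwo_coef_S_le_self (s := 1 / 2) hp eighteen_sevenths_ne_top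
    exact hχ.besovENorm_lt_top_iff_lTwo.2 ((hC n u).trans_lt (ENNReal.mul_lt_top ENNReal.coe_lt_top
      (hχ.besovENorm_lt_top_iff_lTwo.1 hu)))
  · exact tendsto_zero_of_le_const_mul B (hχ.tendsto_lTwo_coef_S_sub hp eighteen_sevenths_ne_top
      (hχ.besovENorm_lt_top_iff_lTwo.1 hu)) fun n => hB _

/-- The trilinear form on `H^{5/6}`. -/
def sobolevTriform : sobolev (5 / 6) →ₗ[ℂ] sobolev (5 / 6) →ₗ[ℂ] sobolev (5 / 6) →ₗ[ℂ] ℂ :=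
  let ι := Submodule.inclusion hχ.sobolev_le_besov
  (hχ.triform.compl₁₂ ι ι).compr₂ (LinearMap.lcomp ℂ ℂ ι)

theorem sobolevTriform_apply (u v w : sobolev (5 / 6)) : hχ.sobolevTriform u v w =
    hχ.triform ⟨u, hχ.sobolev_le_besov u.2⟩ ⟨v, hχ.sobolev_le_besov v.2⟩
      ⟨w, hχ.sobolev_le_besov w.2⟩ := rfl

theorem isUniqueExtension_sobolevTriform :
    IsUniqueExtension (sobolev (5 / 6)) (sobolevENorm (5 / 6)) hχ.sobolevTriform := by
  obtain ⟨B, hB⟩ := hχ.exists_besovENorm_le_sobolevENorm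
  refine hχ.isUniqueExtension_of ?_ (fun u hu => hu) ?_ (sobolevENorm_ofSchwartz_lt_top _)
    (fun w hw => exists_tendsto_sobolevENorm_ofSchwartz_sub hw) (fun u hu n => ?_)
    (fun u hu => hχ.tendsto_sobolevENorm_S_sub hu)
    (fun u v w f g ψ hf hg hw => hχ.triform_eq_advection _ _ _ f g ψ hf hg hw)
    (fun u v w hu hv hw => hχ.triform_im _ _ _ hu hv hw)
  · obtain ⟨A, hA⟩ := hχ.exists_enorm_triform_le_besovENorm
    refine ⟨A * B ^ 3, fun u v w => (hA _ _ _).trans ?_⟩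
    push_cast
    calc _ ≤ A * (B * sobolevENorm (5 / 6) u) * (B * sobolevENorm (5 / 6) v) *
          (B * sobolevENorm (5 / 6) w) := by
          gcongr
          · exact hB u
          · exact hB v
          · exact hB w
      _ = _ := by ring
  · obtain ⟨A, hA⟩ := hχ.exists_lpENorm_three_le_besovENorm
    refine ⟨A * B, fun u => (hA u).trans ?_⟩
    push_cast
    rw [mul_assoc]
    gcongr
    exact hB u
  · obtain ⟨C, hC⟩ := hχ.exists_sobolevENorm_S_le_self (5 / 6)
    exact (hC n u).trans_lt (ENNReal.mul_lt_top ENNReal.coe_lt_top hu)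

end IsLPCutoff

end Advective

end

/-! ### The theorem -/

open Advective in
theorem mainTheorem6 (χ : R3 → ℝ) (hχ : IsLPCutoff χ) :
    -- for smooth fields with divergence-free `f`: `ℙ div(f ⊗ g) = ℙ(f·∇g)`
    (∀ f g : R3 → C3, ContDiff ℝ ∞ f → ContDiff ℝ ∞ g → MemLp f 3 volume → MemLp g 3 volume →
      MemLp (fderiv ℝ f) 3 volume → MemLp (fderiv ℝ g) 3 volume →
      (∀ x, ∑ j : Fin 3, partialD j f x j = 0) →
      ∀ w : 𝓢(R3, C3), advection f g w = ∫ x, dot (convect f g x) (leray w x)) ∧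
    -- `B(u,v)` is defined on `B^{1/3}_{3,2}`
    (∀ u ∈ besov χ (1 / 3) 3 2, ∃ f, IsLpFun 3 u f) ∧
    -- `B = C + I`
    (∃ (C : besov χ (1 / 3) 3 2 →ₗ[ℂ] besov χ (1 / 3) 3 2 →ₗ[ℂ] besov χ (-1 / 3) (3 / 2) 2)
      (I : besov χ (1 / 3) 3 2 →ₗ[ℂ] besov χ (1 / 3) 3 2 →ₗ[ℂ] besov χ (-2 / 3) (9 / 5) 2)
      (K : ℝ≥0),
      (∀ u v : besov χ (1 / 3) 3 2,
        besovENorm χ (-1 / 3) (3 / 2) 2 (C u v) ≤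
          K * besovENorm χ (1 / 3) 3 2 u * besovENorm χ (1 / 3) 3 2 v ∧
        besovENorm χ (-2 / 3) (9 / 5) 2 (I u v) ≤
          K * besovENorm χ (1 / 3) 3 2 u * besovENorm χ (1 / 3) 3 2 v) ∧
      (∀ (u v : besov χ (1 / 3) 3 2) (f g : R3 → C3), IsLpFun 3 u f → IsLpFun 3 v g →
        ∀ w : 𝓢(R3, C3), pair ((C u v : VField) + (I u v : VField)) w = advection f g w) ∧
      (∀ u v : besov χ (1 / 3) 3 2, IsRealField u → IsRealField v →
        IsRealField (C u v) ∧ IsRealField (I u v))) ∧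
    -- the trilinear form on `B^{1/2}_{18/7,2}` and on `H^{5/6}`
    (∃ (T : besov χ (1 / 2) (18 / 7) 2 →ₗ[ℂ] besov χ (1 / 2) (18 / 7) 2 →ₗ[ℂ]
        besov χ (1 / 2) (18 / 7) 2 →ₗ[ℂ] ℂ)
      (TH : sobolev (5 / 6) →ₗ[ℂ] sobolev (5 / 6) →ₗ[ℂ] sobolev (5 / 6) →ₗ[ℂ] ℂ)
      (hsub : sobolev (5 / 6) ≤ besov χ (1 / 2) (18 / 7) 2) (K : ℝ≥0),
      IsUniqueExtension (besov χ (1 / 2) (18 / 7) 2) (besovENorm χ (1 / 2) (18 / 7) 2) T ∧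
      IsUniqueExtension (sobolev (5 / 6)) (sobolevENorm (5 / 6)) TH ∧
      (∀ u : sobolev (5 / 6), besovENorm χ (1 / 2) (18 / 7) 2 u ≤ K * sobolevENorm (5 / 6) u) ∧
      (∀ u v w : sobolev (5 / 6),
        TH u v w = T ⟨u, hsub u.2⟩ ⟨v, hsub v.2⟩ ⟨w, hsub w.2⟩)) := by
  refine ⟨fun f g hf hg hf3 hg3 hf' hg' hdiv w =>
      advection_eq_integral_convect hf hg hf3 hg3 hf' hg' hdiv w,
    fun u hu => exists_isLpFun (hχ.lpENorm_lt_top_of_mem_besov (by norm_num) u hu), ?_, ?_⟩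
  · obtain ⟨K₁, h₁⟩ := hχ.exists_besovENorm_diagField_le
    obtain ⟨K₂, h₂⟩ := hχ.exists_besovENorm_advField_sub_diagField_le
    -- `C` is the diagonal part and `I` the whole term minus it; the sum of the two constants serves
    -- both bounds.
    refine ⟨codRestrict₂ _ hχ.diagField hχ.diagField_mem,
      codRestrict₂ _ (hχ.advField - hχ.diagField) hχ.advField_sub_diagField_mem, K₁ + K₂,
      fun u v => ⟨(h₁ u v).trans ?_, (h₂ u v).trans ?_⟩, fun u v f g hf hg w => ?_,
      fun u v hu hv => ⟨hχ.isRealField_diagField hu hv,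
        (hχ.isRealField_advField hu hv).sub (hχ.isRealField_diagField hu hv)⟩⟩
    · gcongr
      exact_mod_cast le_self_add
    · gcongr
      exact_mod_cast le_add_self
    · have h : hχ.diagField u v + (hχ.advField - hχ.diagField) u v =
          advL (hχ.absRep u : Lp C3 3 (volume : Measure R3)) (hχ.absRep v) :=
        add_sub_cancel _ _
      rw [coe_codRestrict₂, coe_codRestrict₂, h]
      exact pair_advL_eq_advection (hχ.emb_absRep u) (hχ.emb_absRep v) hf hg w
  · obtain ⟨K, hK⟩ := hχ.exists_besovENorm_le_sobolevENorm
    exact ⟨hχ.triform, hχ.sobolevTriform, hχ.sobolev_le_besov, K, hχ.isUniqueExtension_triform,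
      hχ.isUniqueExtension_sobolevTriform, fun u => hK u, hχ.sobolevTriform_apply⟩
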